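/- **Setting.** Work in $\mathbb{R}^d$ with the Euclidean norm. For $\Gamma\subset\mathbb{R}^d\times\mathbb{R}^d$ put $\Gamma_x=\{y:(x,y)\in\Gamma\}$, and let $X_\Gamma,Y_\Gamma$ be the two projections of $\Gamma$. For $A\subset\mathbb{R}^d$ let $V(A)$ be its affine span and $IC(A)$ the interior of $\mathrm{conv}(A)$ relative to $V(A)$. A Borel set $\Gamma$ is *martingale supporting* ($\Gamma\in\mathcal{S}_{MT}$) if $x\in IC(\Gamma_x)$ for all $x\in X_\Gamma$. A *convex paving* of $\Gamma$ is a family $\Phi$ of mutually disjoint convex sets $C$, each open in $V(C)$, which covers $X_\Gamma$, each of which meets $X_\Gamma$, and such that $IC(\Gamma_z)\cap C\neq\emptyset$ implies $IC(\Gamma_z)\subset C$ for $z\in X_\Gamma$, $C\in\Phi$; $C(x)$ is the member containing $x$. It is *irreducible* if for every convex paving $\Psi$ of $\Gamma$ and all $C\in\Phi$, $D\in\Psi$, $C\cap D\ne\emptyset$ implies $C\subset D$. Write $\Gamma_C=\Gamma\cap(C\times\mathbb{R}^d)$. Probability measures $\mu,\nu$ are in *convex order* if they have finite first moments and $\int\varphi\,d\mu\le\int\varphi\,d\nu$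 for all convex $\varphi:\mathbb{R}^d\to\mathbb{R}$. $MT(\mu,\nu)$ is the set of probability measures $\pi$ with marginals $\mu,\nu$ whose disintegration $d\pi(x,y)=d\pi_x(y)\,d\mu(x)$ satisfies: $\pi_x$ has barycenter $x$ for $\mu$-a.e. $x$. For $c:\mathbb{R}^d\times\mathbb{R}^d\to\mathbb{R}$ consider the problem of minimizing, or of maximizing, $\int c\,d\pi$ over the $\pi\in MT(\mu,\nu)$ for which $c$ is integrable; its solutions are called *optimal*. In the minimization problem a triple of Borel measurable functions $\alpha:X\to\mathbb{R}$, $\gamma:X\to\mathbb{R}^d$, $\beta:Y\to\mathbb{R}$ is *admissible on $X\times Y$* if $\beta(y)-\alpha(x)-\gamma(x)\cdot(y-x)\le c(x,y)$ on $X\times Y$; in the maximization problem the inequality is reversed. A nonempty set $G$ is a *$c$-contact layer* if some triple admissible on $X_G\times Y_G$ has equality on $G$; a set is *$c$-finitely exposable* if all its nonempty finite subsets are $c$-contact layers. *Duality is attained for $\pi$ on $X\times Y$*, where $\pi$ has first marginal $\mu$ and disintegration $(\pi_x)$, if there is a triple, admissible on $X\times Y$, with equality $\pi$-a.e. and with $\int\big(\int\beta\,d\pi_x-\alpha(x)\big)d\mu(x)=\int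 c\,d\pi$, all these integrals being finite and $\beta$ being $\pi_x$-integrable for $\mu$-a.e. $x$ (the left side is $\int\beta\,d\nu-\int\alpha\,d\mu$ when $\alpha$ and $\beta$ are integrable). Let $\mathcal{K}(\mathbb{R}^d)$ be the set of nonempty closed convex subsets of $\mathbb{R}^d$ with the $\sigma$-algebra generated by the maps $K\mapsto \mathrm{dist}(x,K)$, $x\in\mathbb{R}^d$; this is the Borel $\sigma$-algebra of the Polish topology of Hausdorff convergence on bounded sets, and it is contained in the Borel $\sigma$-algebra of the Hausdorff metric. **Theorem 9.1.** Let $\mu,\nu$ be probability measures on $\mathbb{R}^d$ in convex order, let $\pi\in MT(\mu,\nu)$, and let $\Gamma\in\mathcal{S}_{MT}$ with $\pi(\Gamma)=1$. Then $\Gamma$ has exactly one irreducible convex paving $\Phi$. If $c$ is continuous and $\pi$ is optimal (for the minimization or for the maximization problem), then the concentration set can be chosen $c$-finitely exposable: there is a $c$-finitely exposable $\Gamma'\in\mathcal{S}_{MT}$ with $\Gamma'\subset\Gamma$ and $\pi(\Gamma')=1$, which if $\mu\wedge\nu=0$ can moreover be chosen to contain no point $(x,x)$. Assume that the map $\Xi:\Gamma\to\mathcal{K}(\mathbb{R}^d)$,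 $(x,y)\mapsto\overline{C(x)}$, is measurable, and let $\tilde\pi=\Xi_\#\pi$. A point $\overline{C}$ of the image $I=\Xi(\Gamma)=\{\overline{C}:C\in\Phi\}$ is identified with the set $C\in\Phi$. Then there is a measurable family $(\pi_C)$ of measures on $\mathbb{R}^d\times\mathbb{R}^d$ such that the following hold. 1. $\pi(S)=\int \pi_C(S)\,d\tilde\pi(C)$ for every Borel set $S\subset\mathbb{R}^d\times\mathbb{R}^d$, and for $\tilde\pi$-a.e. $C$ (in particular $C\in I$) $\pi_C$ is a probability measure with $\pi_C(\Gamma_C)=1$. 2. For $\tilde\pi$-a.e. $C$ there are probability measures $\mu_C,\nu_C$ in convex order, with $\mu_C$ concentrated on $X_\Gamma\cap C$ and $\nu_C$ concentrated on $Y_{\Gamma_C}$, such that $\pi_C\in MT(\mu_C,\nu_C)$. 3. Let $c$ be Borel measurable and let $\pi$ be optimal in $MT(\mu,\nu)$ for the minimization (respectively maximization) problem. Then for $\tilde\pi$-a.e. $C$, $\pi_C$ is optimal for the same problem on $MT(\mu_C,\nu_C)$. If moreover $c$ is continuous and $\Gamma$ is $c$-finitely exposable, then $\Gamma_C$ is a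 $c$-contact layer for every $C\in\Phi$, and for $\tilde\pi$-a.e. $C$ duality is attained for $\pi_C$ on $X_{\Gamma_C}\times Y_{\Gamma_C}$. 4. Let $c(x,y)=|x-y|$, let $\pi$ be optimal for the minimization or the maximization problem, and let $\Gamma$ be $c$-finitely exposable and, in the case of minimization, contain no point $(x,x)$. Then for $\tilde\pi$-a.e. $C$: if $\mu_C$ is absolutely continuous with respect to the Lebesgue measure on $V(C)$, then $\overline{\Gamma_x}=\mathrm{Ext}\big(\mathrm{conv}(\overline{\Gamma_x})\big)$ for $\mu_C$-a.e. $x$. -/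

import Mathlib

open MeasureTheory ProbabilityTheory Set

noncomputable section

namespace MartingaleTransport

/-- The Euclidean space `ℝ^d`. -/
abbrev Eucl (d : ℕ) : Type := EuclideanSpace ℝ (Fin d)

variable {d : ℕ}

/-! ### Sets: fibres, projections, relative interiors of convex hulls -/

/-- The projection `X_Γ` on the first coordinate. -/
def projX (Γ : Set (Eucl d × Eucl d)) : Set (Eucl d) := Prod.fst '' Γ

/-- The projection `Y_Γ` on the second coordinate. -/
def projY (Γ : Set (Eucl d × Eucl d)) : Set (Eucl d) := Prod.snd '' Γ

/-- The vertical fibre `Γ_x`. -/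
def fiber (Γ : Set (Eucl d × Eucl d)) (x : Eucl d) : Set (Eucl d) := {y | (x, y) ∈ Γ}

/-- `Γ_C = Γ ∩ (C × ℝ^d)`. -/
def restr (Γ : Set (Eucl d × Eucl d)) (C : Set (Eucl d)) : Set (Eucl d × Eucl d) :=
  Γ ∩ C ×ˢ univ

/-- `IC(A)`: the interior of the convex hull of `A` in the topology of the affine span of `A`. -/
def IC (A : Set (Eucl d)) : Set (Eucl d) := intrinsicInterior ℝ (convexHull ℝ A)

/-- Martingale supporting sets, i.e. the class `S_MT`. -/
def MartingaleSupporting (Γ : Set (Eucl d × Eucl d)) : Prop :=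
  MeasurableSet Γ ∧ ∀ x ∈ projX Γ, x ∈ IC (fiber Γ x)

/-! ### Convex pavings -/

/-- `Φ` is a convex paving for `Γ`: a family of mutually disjoint convex sets, each open in its
affine span, covering `X_Γ`, each meeting `X_Γ`, and absorbing every `IC(Γ_z)` that it meets. -/
structure IsConvexPaving (Γ : Set (Eucl d × Eucl d)) (Φ : Set (Set (Eucl d))) : Prop where
  disjoint : ∀ C ∈ Φ, ∀ D ∈ Φ, (C ∩ D).Nonempty → C = D
  convex : ∀ C ∈ Φ, Convex ℝ C
  relOpen : ∀ C ∈ Φ, intrinsicInterior ℝ C = C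
  cover : ∀ x ∈ projX Γ, ∃ C ∈ Φ, x ∈ C
  meets : ∀ C ∈ Φ, ∃ x ∈ projX Γ, x ∈ C
  absorb : ∀ z ∈ projX Γ, ∀ C ∈ Φ, (IC (fiber Γ z) ∩ C).Nonempty → IC (fiber Γ z) ⊆ C

/-- `Φ` is an irreducible convex paving for `Γ`. -/
def IsIrreducibleConvexPaving (Γ : Set (Eucl d × Eucl d)) (Φ : Set (Set (Eucl d))) : Prop :=
  IsConvexPaving Γ Φ ∧
    ∀ Ψ, IsConvexPaving Γ Ψ → ∀ C ∈ Φ, ∀ D ∈ Ψ, (C ∩ D).Nonempty → C ⊆ D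

/-- The component `C(x)` of `x`, i.e. the member of `Φ` containing `x`. -/
def component (Φ : Set (Set (Eucl d))) (x : Eucl d) : Set (Eucl d) := ⋃₀ {C ∈ Φ | x ∈ C}

theorem IsConvexPaving.component_eq {Γ : Set (Eucl d × Eucl d)} {Φ : Set (Set (Eucl d))}
    (h : IsConvexPaving Γ Φ) {C : Set (Eucl d)} (hC : C ∈ Φ) {x : Eucl d} (hx : x ∈ C) :
    component Φ x = C := by
  apply Subset.antisymm
  · rintro y ⟨D, ⟨hD, hxD⟩, hy⟩
    rwa [h.disjoint C hC D hD ⟨x, hx, hxD⟩]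
  · exact fun y hy => ⟨C, ⟨hC, hx⟩, hy⟩

/-! ### The space of closed convex sets -/

/-- The space `𝒦(ℝ^d)` of nonempty closed convex subsets of `ℝ^d`. -/
structure ClosedConvex (d : ℕ) where
  carrier : Set (Eucl d)
  isClosed : IsClosed carrier
  convex : Convex ℝ carrier
  nonempty : carrier.Nonempty

/-- The σ-algebra on `𝒦(ℝ^d)` generated by the distance functions `K ↦ dist(x, K)`, `x ∈ ℝ^d`.
It is the Borel σ-algebra of the Polish topology of Hausdorff convergence on bounded sets (locally
uniform convergence of the distance functions). -/
instance : MeasurableSpace (ClosedConvex d) :=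
  ⨆ x : Eucl d, MeasurableSpace.comap (fun K : ClosedConvex d => Metric.infDist x K.carrier)
    inferInstance

/-- A closed convex set viewed in Mathlib's space of closed sets, whose extended metric is the
Hausdorff distance. -/
def ClosedConvex.toCloseds (K : ClosedConvex d) : TopologicalSpace.Closeds (Eucl d) :=
  ⟨K.carrier, K.isClosed⟩

/-- A map into `𝒦(ℝ^d)` that is measurable for the Borel σ-algebra of the (extended) Hausdorff
metric is measurable. -/
theorem ClosedConvex.measurable_of_hausdorff {Ω : Type*} [MeasurableSpace Ω]
    (f : Ω → ClosedConvex d)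
    (hf : @Measurable Ω (TopologicalSpace.Closeds (Eucl d)) _ (borel _)
      (fun ω => (f ω).toCloseds)) : Measurable f := by
  let _ : MeasurableSpace (TopologicalSpace.Closeds (Eucl d)) := borel _
  have _ : BorelSpace (TopologicalSpace.Closeds (Eucl d)) := ⟨rfl⟩
  refine Measurable.of_le_map (iSup_le fun x => ?_)
  rw [MeasurableSpace.comap_le_iff_le_map, MeasurableSpace.map_comp]
  refine Measurable.le_map ?_
  have hc : Continuous fun S : TopologicalSpace.Closeds (Eucl d) =>
      Metric.infEDist x (S : Set (Eucl d)) := by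
    refine continuous_of_le_add_edist 1 (by simp) ?_
    intro S T
    rw [one_mul]
    have h := Metric.infEDist_le_infEDist_add_hausdorffEDist (x := x) (s := (T : Set (Eucl d)))
      (t := (S : Set (Eucl d)))
    rwa [Metric.hausdorffEDist_comm] at h
  exact (hc.measurable.comp hf).ennreal_toReal

/-- The map `Ξ : Γ → 𝒦(ℝ^d)`, `(x, y) ↦ closure of C(x)`. -/
def closureMap {Γ : Set (Eucl d × Eucl d)} {Φ : Set (Set (Eucl d))} (h : IsConvexPaving Γ Φ)
    (p : Γ) : ClosedConvex d where
  carrier := closure (component Φ p.1.1)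
  isClosed := isClosed_closure
  convex := by
    obtain ⟨C, hC, hx⟩ := h.cover p.1.1 ⟨p.1, p.2, rfl⟩
    rw [h.component_eq hC hx]
    exact (h.convex C hC).closure
  nonempty := by
    obtain ⟨C, hC, hx⟩ := h.cover p.1.1 ⟨p.1, p.2, rfl⟩
    rw [h.component_eq hC hx]
    exact ⟨_, subset_closure hx⟩

/-- The push-forward `π̃ = Ξ_# π` of `π` (a measure concentrated on the Borel set `Γ`). -/
def closureLaw {Γ : Set (Eucl d × Eucl d)} {Φ : Set (Set (Eucl d))} (h : IsConvexPaving Γ Φ)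
    (π : Measure (Eucl d × Eucl d)) : Measure (ClosedConvex d) :=
  (π.comap (Subtype.val : Γ → Eucl d × Eucl d)).map (closureMap h)

/-! ### Convex order, martingale transport plans, optimality -/

/-- `μ ≤_C ν`: probability measures with finite first moments and `∫ φ dμ ≤ ∫ φ dν` for all convex
`φ`. Convex functions are bounded below by affine ones, so both integrals are well defined in
`(-∞, ∞]` and the inequality only has content when `φ` is `ν`-integrable. -/
structure ConvexOrder (μ ν : Measure (Eucl d)) : Prop where
  prob_left : IsProbabilityMeasure μ
  prob_right : IsProbabilityMeasure ν
  moment_left : Integrable (fun x => x) μ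
  moment_right : Integrable (fun y => y) ν
  le : ∀ φ : Eucl d → ℝ, ConvexOn ℝ univ φ → Integrable φ ν →
    Integrable φ μ ∧ ∫ x, φ x ∂μ ≤ ∫ y, φ y ∂ν

/-- `MT(μ, ν)`: probability measures with marginals `μ` and `ν` whose disintegration
`dπ(x, y) = dπ_x(y) dμ(x)` is such that `π_x` has barycenter `x` for `μ`-a.e. `x`. -/
def MT (μ ν : Measure (Eucl d)) : Set (Measure (Eucl d × Eucl d)) :=
  {π | IsProbabilityMeasure π ∧ π.fst = μ ∧ π.snd = ν ∧
    ∃ k : Kernel (Eucl d) (Eucl d), IsMarkovKernel k ∧ π = μ ⊗ₘ k ∧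
      ∀ᵐ x ∂μ, Integrable (fun y => y) (k x) ∧ ∫ y, y ∂(k x) = x}

/-- The two optimization problems. -/
inductive Goal
  | minimize
  | maximize

/-- `a ≤ b` for the minimization problem, `b ≤ a` for the maximization problem. -/
def Goal.le : Goal → ℝ → ℝ → Prop
  | .minimize, a, b => a ≤ b
  | .maximize, a, b => b ≤ a

/-- `π` solves the martingale transport problem with cost `c` on `MT(μ, ν)`; the cost is computed
for plans for which `c` is integrable. -/
def IsOptimal (g : Goal) (c : Eucl d × Eucl d → ℝ) (μ ν : Measure (Eucl d))
    (π : Measure (Eucl d × Eucl d)) : Prop :=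
  π ∈ MT μ ν ∧ Integrable c π ∧
    ∀ ρ ∈ MT μ ν, Integrable c ρ → g.le (∫ p, c p ∂π) (∫ p, c p ∂ρ)

/-! ### Admissible triples, contact layers, duality -/

/-- `(α, γ, β)` is an admissible triple on `X × Y`, i.e. belongs to `E_m(c, X, Y)` for the
minimization problem and to `E_M(c, X, Y)` for the maximization problem. Measurable functions on
`X`, `Y` are given by Borel functions on `ℝ^d`, of which only the values on `X`, `Y` matter. -/
structure IsAdmissible (g : Goal) (c : Eucl d × Eucl d → ℝ) (X Y : Set (Eucl d))
    (α : Eucl d → ℝ) (γ : Eucl d → Eucl d) (β : Eucl d → ℝ) : Prop where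
  measurable_α : Measurable α
  measurable_γ : Measurable γ
  measurable_β : Measurable β
  ineq : ∀ x ∈ X, ∀ y ∈ Y, g.le (β y - α x - inner ℝ (γ x) (y - x)) (c (x, y))

/-- `G` is a `c`-contact layer (in `X_G × Y_G`). -/
def IsContactLayer (g : Goal) (c : Eucl d × Eucl d → ℝ) (G : Set (Eucl d × Eucl d)) : Prop :=
  G.Nonempty ∧ ∃ α γ β, IsAdmissible g c (projX G) (projY G) α γ β ∧
    ∀ x y, (x, y) ∈ G → β y - α x - inner ℝ (γ x) (y - x) = c (x, y)

/-- `Γ` is `c`-finitely exposable: all its (nonempty) finite subsets are `c`-contact layers. -/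
def FinitelyExposable (g : Goal) (c : Eucl d × Eucl d → ℝ) (Γ : Set (Eucl d × Eucl d)) : Prop :=
  ∀ H ⊆ Γ, H.Finite → H.Nonempty → IsContactLayer g c H

/-- Duality is attained for `π` on `X × Y`: there is an admissible triple on `X × Y` with equality
`π`-a.e., and whose dual value is the cost of `π`. Since `α` and `β` need not be separately
integrable, the dual value `∫ β dν - ∫ α dμ` is written `∫ (∫ β dπ_x - α(x)) dμ(x)`, which is the
same number when they are. -/
def DualityAttained (g : Goal) (c : Eucl d × Eucl d → ℝ) (X Y : Set (Eucl d))
    (π : Measure (Eucl d × Eucl d)) : Prop :=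
  ∃ α γ β, IsAdmissible g c X Y α γ β ∧
    (∀ᵐ p ∂π, β p.2 - α p.1 - inner ℝ (γ p.1) (p.2 - p.1) = c p) ∧
    ∃ k : Kernel (Eucl d) (Eucl d), IsMarkovKernel k ∧ π = π.fst ⊗ₘ k ∧
      (∀ᵐ x ∂π.fst, Integrable β (k x)) ∧
      Integrable (fun x => ∫ y, β y ∂(k x) - α x) π.fst ∧
      ∫ x, (∫ y, β y ∂(k x) - α x) ∂π.fst = ∫ p, c p ∂π

/-- `μ` is absolutely continuous with respect to the Lebesgue measure of the (nonempty) affine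
subspace `V`, the image of the Lebesgue measure of the direction of `V` under any `v ↦ v + p`,
`p ∈ V`. -/
def AbsContOn (μ : Measure (Eucl d)) (V : AffineSubspace ℝ (Eucl d)) : Prop :=
  ∀ p ∈ V, μ ≪ (volume : Measure V.direction).map (fun v : V.direction => (v : Eucl d) + p)

end MartingaleTransport

end

open MartingaleTransport

open MartingaleTransport

namespace MartingaleTransport

section RelativelyOpen

variable {E : Type*} [NormedAddCommGroup E] [NormedSpace ℝ E]

/-- Every segment in `s` can be prolonged inside `s` beyond its endpoints. -/
def Prolongable (s : Set E) : Prop := ∀ x ∈ s, ∀ y ∈ s, ∃ ε : ℝ, 0 < ε ∧ x + ε • (x - y) ∈ s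

theorem mem_intrinsicInterior_iff_ball {s : Set E} {x : E} :
    x ∈ intrinsicInterior ℝ s ↔ x ∈ affineSpan ℝ s ∧
      ∃ r : ℝ, 0 < r ∧ ∀ y ∈ affineSpan ℝ s, dist y x < r → y ∈ s := by
  rw [mem_intrinsicInterior]
  constructor
  · rintro ⟨y, hy, rfl⟩
    rw [mem_interior_iff_mem_nhds, Metric.mem_nhds_iff] at hy
    obtain ⟨r, hr, h⟩ := hy
    exact ⟨y.2, r, hr, fun z hz hzr => h (show (⟨z, hz⟩ : affineSpan ℝ s) ∈ Metric.ball y r from hzr)⟩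
  · rintro ⟨hx, r, hr, h⟩
    refine ⟨⟨x, hx⟩, ?_, rfl⟩
    rw [mem_interior_iff_mem_nhds, Metric.mem_nhds_iff]
    exact ⟨r, hr, fun z hz => h z z.2 hz⟩

theorem add_smul_sub_mem_affineSpan {V : AffineSubspace ℝ E} {x y z : E}
    (hx : x ∈ V) (hy : y ∈ V) (hz : z ∈ V) (t : ℝ) : x + t • (y - z) ∈ V := by
  have := AffineSubspace.vadd_mem_of_mem_direction
    (V.direction.smul_mem t (AffineSubspace.vsub_mem_direction hy hz)) hx
  simpa [add_comm] using this

theorem Convex.add_smul_sub_mem_of_le {s : Set E} (hs : Convex ℝ s) {x v : E} (hx : x ∈ s)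
    {ε δ : ℝ} (hδ : 0 ≤ δ) (h : δ ≤ ε) (hε : x + ε • v ∈ s) : x + δ • v ∈ s := by
  rcases hδ.eq_or_lt with rfl | hδ
  · simpa using hx
  have hε0 : 0 < ε := hδ.trans_le h
  have := hs hx hε (a := 1 - δ / ε) (b := δ / ε) (by
    rw [sub_nonneg, div_le_one hε0]; exact h) (by positivity) (by ring)
  convert this using 1
  rw [smul_add, ← smul_assoc, smul_eq_mul, div_mul_cancel₀ _ hε0.ne', sub_smul, one_smul]
  abel

/-- A point strictly between an intrinsic interior point and a point of the closure of a convex set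
is an intrinsic interior point. -/
theorem Convex.combo_mem_intrinsicInterior [FiniteDimensional ℝ E] {s : Set E} (hs : Convex ℝ s)
    {x z : E} (hx : x ∈ intrinsicInterior ℝ s) (hz : z ∈ closure s) {t : ℝ} (ht : 0 < t)
    (ht1 : t < 1) :
    t • x + (1 - t) • z ∈ intrinsicInterior ℝ s := by
  rw [mem_intrinsicInterior_iff_ball] at hx ⊢
  obtain ⟨hxV, r, hr, h⟩ := hx
  have hclV : closure s ⊆ affineSpan ℝ s :=
    closure_minimal (subset_affineSpan ℝ s) (AffineSubspace.closed_of_finiteDimensional _)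
  have hpV : t • x + (1 - t) • z ∈ affineSpan ℝ s := by
    have := add_smul_sub_mem_affineSpan (hclV hz) hxV (hclV hz) t
    convert this using 1
    rw [smul_sub, sub_smul, one_smul]; abel
  refine ⟨hpV, t * (r / 2), by positivity, fun y hyV hy => ?_⟩
  obtain ⟨z', hz', hzz'⟩ := Metric.mem_closure_iff.1 hz (t * (r / 2)) (by positivity)
  have h1t : (0 : ℝ) < 1 - t := by linarith
  set x' : E := x + t⁻¹ • (y - (t • x + (1 - t) • z)) + (t⁻¹ * (1 - t)) • (z - z') with hx'
  have hx'V : x' ∈ affineSpan ℝ s :=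
    add_smul_sub_mem_affineSpan (add_smul_sub_mem_affineSpan hxV hyV hpV _) (hclV hz)
      (hclV (subset_closure hz')) _
  have hx's : x' ∈ s := by
    apply h _ hx'V
    rw [dist_eq_norm] at hy hzz' ⊢
    have : x' - x = t⁻¹ • (y - (t • x + (1 - t) • z)) + (t⁻¹ * (1 - t)) • (z - z') := by
      rw [hx']; abel
    rw [this]
    have ht' : 0 < t⁻¹ := by positivity
    calc _ ≤ ‖t⁻¹ • (y - (t • x + (1 - t) • z))‖ + ‖(t⁻¹ * (1 - t)) • (z - z')‖ := norm_add_le _ _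
      _ = t⁻¹ * ‖y - (t • x + (1 - t) • z)‖ + t⁻¹ * (1 - t) * ‖z - z'‖ := by
          rw [norm_smul, norm_smul, Real.norm_of_nonneg ht'.le,
            Real.norm_of_nonneg (by positivity)]
      _ < t⁻¹ * (t * (r / 2)) + t⁻¹ * (t * (r / 2)) := by
          refine add_lt_add ?_ ?_
          · gcongr
          · rw [mul_assoc]
            exact mul_lt_mul_of_pos_left (lt_of_le_of_lt
              (mul_le_of_le_one_left (norm_nonneg _) (by linarith)) hzz') ht'
      _ = r := by field_simp; ring
  have := hs hx's hz' ht.le h1t.le (by ring)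
  convert this using 1
  rw [hx', smul_add, smul_add, smul_smul, smul_smul, mul_inv_cancel₀ ht.ne', one_smul,
    ← mul_assoc, mul_inv_cancel₀ ht.ne', one_mul, smul_sub (1 - t) z z']
  abel

theorem Convex.mem_intrinsicInterior_iff [FiniteDimensional ℝ E] {s : Set E} (hs : Convex ℝ s)
    {x : E} :
    x ∈ intrinsicInterior ℝ s ↔ x ∈ s ∧ ∀ y ∈ s, ∃ ε : ℝ, 0 < ε ∧ x + ε • (x - y) ∈ s := by
  constructor
  · intro hx
    refine ⟨intrinsicInterior_subset hx, fun y hy => ?_⟩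
    rw [mem_intrinsicInterior_iff_ball] at hx
    obtain ⟨hxV, r, hr, h⟩ := hx
    have hpos : 0 < ‖x - y‖ + 1 := by positivity
    refine ⟨r / (‖x - y‖ + 1), by positivity, h _ (add_smul_sub_mem_affineSpan hxV hxV
      (subset_affineSpan ℝ s hy) _) ?_⟩
    rw [dist_eq_norm, add_sub_cancel_left, norm_smul, Real.norm_of_nonneg (by positivity),
      div_mul_eq_mul_div, div_lt_iff₀ hpos]
    nlinarith [norm_nonneg (x - y)]
  · rintro ⟨hx, h⟩
    obtain ⟨q, hq⟩ := Set.Nonempty.intrinsicInterior hs ⟨x, hx⟩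
    obtain ⟨ε, hε, hz⟩ := h q (intrinsicInterior_subset hq)
    have h1 : (0 : ℝ) < 1 + ε := by linarith
    have := Convex.combo_mem_intrinsicInterior hs hq (subset_closure hz) (t := ε / (1 + ε))
      (by positivity) (by rw [div_lt_one h1]; linarith)
    convert this using 1
    have e1 : (1 : ℝ) - ε / (1 + ε) = (1 + ε)⁻¹ := by field_simp; ring
    rw [e1, ← sub_eq_zero]
    have : (1 + ε) • (x - ((ε / (1 + ε)) • q + (1 + ε)⁻¹ • (x + ε • (x - q)))) = 0 := by
      rw [smul_sub, smul_add, smul_smul, smul_smul, mul_inv_cancel₀ h1.ne', mul_div_cancel₀ _ h1.ne',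
        one_smul, add_smul, one_smul, smul_sub]
      abel
    exact (smul_eq_zero.1 this).resolve_left h1.ne'

theorem Convex.intrinsicInterior_eq_iff [FiniteDimensional ℝ E] {s : Set E} (hs : Convex ℝ s) :
    intrinsicInterior ℝ s = s ↔ Prolongable s := by
  constructor
  · intro h x hx y hy
    rw [← h] at hx
    exact (Convex.mem_intrinsicInterior_iff hs |>.1 hx).2 y hy
  · intro h
    exact intrinsicInterior_subset.antisymm fun x hx =>
      (Convex.mem_intrinsicInterior_iff hs).2 ⟨hx, h x hx⟩

theorem Convex.convex_intrinsicInterior [FiniteDimensional ℝ E] {s : Set E} (hs : Convex ℝ s) :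
    Convex ℝ (intrinsicInterior ℝ s) := by
  intro x hx z hz a b ha hb hab
  rcases ha.eq_or_lt with rfl | ha
  · rw [zero_add] at hab; subst hab; simpa using hz
  rcases hb.eq_or_lt with rfl | hb
  · rw [add_zero] at hab; subst hab; simpa using hx
  obtain rfl : b = 1 - a := by linarith
  exact Convex.combo_mem_intrinsicInterior hs hx
    (subset_closure (intrinsicInterior_subset hz)) ha (by linarith)

theorem Convex.prolongable_intrinsicInterior [FiniteDimensional ℝ E] {s : Set E}
    (hs : Convex ℝ s) : Prolongable (intrinsicInterior ℝ s) := by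
  intro x hx y hy
  obtain ⟨ε, hε, hz⟩ := (Convex.mem_intrinsicInterior_iff hs |>.1 hx).2 y
    (intrinsicInterior_subset hy)
  refine ⟨2⁻¹ * ε, by positivity, ?_⟩
  have := Convex.combo_mem_intrinsicInterior hs hx (subset_closure hz) (t := 2⁻¹) (by norm_num)
    (by norm_num)
  convert this using 1
  rw [show (1 : ℝ) - 2⁻¹ = 2⁻¹ by norm_num, smul_add (2⁻¹ : ℝ), ← add_assoc, ← add_smul, smul_smul]
  norm_num

theorem closure_injective_of_prolongable [FiniteDimensional ℝ E] {C D : Set E}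
    (hC : Convex ℝ C) (hC' : Prolongable C) (hD : Convex ℝ D) (hD' : Prolongable D)
    (h : closure C = closure D) : C = D := by
  have key : ∀ {C D : Set E}, Prolongable C → Convex ℝ C → Convex ℝ D →
      Prolongable D → closure C = closure D → C ⊆ D := by
    intro C D hC' hC hD hD' h x hx
    have hne : D.Nonempty := by
      rw [← closure_nonempty_iff, ← h]; exact ⟨x, subset_closure hx⟩
    obtain ⟨q, hq⟩ := hne
    obtain ⟨p, hp⟩ := (⟨x, hx⟩ : C.Nonempty)
    have hqC : q ∈ closure C := h ▸ subset_closure hq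
    have hxI : x ∈ intrinsicInterior ℝ C := by
      rw [(Convex.intrinsicInterior_eq_iff hC).2 hC']; exact hx
    rw [mem_intrinsicInterior_iff_ball] at hxI
    obtain ⟨hxV, r, hr, hb⟩ := hxI
    have hqV : q ∈ affineSpan ℝ C :=
      closure_minimal (subset_affineSpan ℝ C) (AffineSubspace.closed_of_finiteDimensional _) hqC
    have hpos : 0 < ‖x - q‖ + 1 := by positivity
    set ε := r / (‖x - q‖ + 1) with hεdef
    have hε : 0 < ε := by positivity
    have hz : x + ε • (x - q) ∈ C := by
      refine hb _ (add_smul_sub_mem_affineSpan hxV hxV hqV _) ?_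
      rw [dist_eq_norm, add_sub_cancel_left, norm_smul, Real.norm_of_nonneg (by positivity),
        div_mul_eq_mul_div, div_lt_iff₀ hpos]
      nlinarith [norm_nonneg (x - q)]
    have h1 : (0 : ℝ) < 1 + ε := by linarith
    have hqI : q ∈ intrinsicInterior ℝ D := by
      rw [(Convex.intrinsicInterior_eq_iff hD).2 hD']; exact hq
    have := Convex.combo_mem_intrinsicInterior hD hqI (h ▸ subset_closure hz) (t := ε / (1 + ε))
      (by positivity) (by rw [div_lt_one h1]; linarith)
    have h2 := intrinsicInterior_subset this
    convert h2 using 1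
    have e1 : (1 : ℝ) - ε / (1 + ε) = (1 + ε)⁻¹ := by field_simp; ring
    rw [e1, ← sub_eq_zero]
    have : (1 + ε) • (x - ((ε / (1 + ε)) • q + (1 + ε)⁻¹ • (x + ε • (x - q)))) = 0 := by
      rw [smul_sub, smul_add, smul_smul, smul_smul, mul_inv_cancel₀ h1.ne', mul_div_cancel₀ _ h1.ne',
        one_smul, add_smul, one_smul, smul_sub]
      abel
    exact (smul_eq_zero.1 this).resolve_left h1.ne'
  exact (key hC' hC hD hD' h).antisymm (key hD' hD hC hC' h.symm)

/-- The intrinsic interior of the smallest face of `D` containing `x`. -/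
def relFace (D : Set E) (x : E) : Set E :=
  {y ∈ D | ∃ ε : ℝ, 0 < ε ∧ x + ε • (x - y) ∈ D ∧ y + ε • (y - x) ∈ D}

theorem relFace_subset (D : Set E) (x : E) : relFace D x ⊆ D := fun _ h => h.1

theorem self_mem_relFace {D : Set E} {x : E} (hx : x ∈ D) : x ∈ relFace D x :=
  ⟨hx, 1, one_pos, by simpa using hx, by simpa using hx⟩

theorem mem_relFace_comm {D : Set E} {x y : E} (hx : x ∈ D) (h : y ∈ relFace D x) :
    x ∈ relFace D y := by
  obtain ⟨_, ε, hε, h1, h2⟩ := h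
  exact ⟨hx, ε, hε, h2, h1⟩

theorem mem_relFace_trans {D : Set E} (hD : Convex ℝ D) {x y z : E} (hx : x ∈ D)
    (hy : y ∈ relFace D x) (hz : z ∈ relFace D y) : z ∈ relFace D x := by
  obtain ⟨hyD, ε₁, hε₁, h1, h2⟩ := hy
  obtain ⟨hzD, ε₂, hε₂, h3, h4⟩ := hz
  set ε := min ε₁ ε₂
  have hε : 0 < ε := lt_min hε₁ hε₂
  have h1 := Convex.add_smul_sub_mem_of_le hD hx hε.le (min_le_left _ _) h1
  have h2 := Convex.add_smul_sub_mem_of_le hD hyD hε.le (min_le_left _ _) h2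
  have h3 := Convex.add_smul_sub_mem_of_le hD hyD hε.le (min_le_right _ _) h3
  have h4 := Convex.add_smul_sub_mem_of_le hD hzD hε.le (min_le_right _ _) h4
  have hp : (0 : ℝ) < 1 + 2 * ε := by positivity
  have key : ∀ {p q r : E}, p + ε • (p - q) ∈ D → q + ε • (q - r) ∈ D →
      p + (ε ^ 2 / (1 + 2 * ε)) • (p - r) ∈ D := by
    intro p q r hpq hqr
    have := hD hpq hqr (a := (1 + ε) / (1 + 2 * ε)) (b := ε / (1 + 2 * ε)) (by positivity)
      (by positivity) (by field_simp; ring)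
    convert this using 1
    match_scalars
    · field_simp; ring
    · field_simp
    · field_simp; ring
  exact ⟨hzD, _, by positivity, key h1 h3, key h4 h2⟩

theorem convex_relFace {D : Set E} (hD : Convex ℝ D) {x : E} (hx : x ∈ D) :
    Convex ℝ (relFace D x) := by
  rintro y₁ ⟨hy₁, ε₁, hε₁, h1, h2⟩ y₂ ⟨hy₂, ε₂, hε₂, h3, h4⟩ a b ha hb hab
  set ε := min ε₁ ε₂
  have hε : 0 < ε := lt_min hε₁ hε₂
  have h1 := Convex.add_smul_sub_mem_of_le hD hx hε.le (min_le_left _ _) h1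
  have h2 := Convex.add_smul_sub_mem_of_le hD hy₁ hε.le (min_le_left _ _) h2
  have h3 := Convex.add_smul_sub_mem_of_le hD hx hε.le (min_le_right _ _) h3
  have h4 := Convex.add_smul_sub_mem_of_le hD hy₂ hε.le (min_le_right _ _) h4
  obtain rfl : b = 1 - a := by linarith
  refine ⟨hD hy₁ hy₂ ha hb hab, ε, hε, ?_, ?_⟩
  · convert hD h1 h3 ha hb hab using 1
    match_scalars <;> ring
  · convert hD h2 h4 ha hb hab using 1
    match_scalars <;> ring

theorem prolongable_relFace {D : Set E} (hD : Convex ℝ D) {x : E} (hx : x ∈ D) :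
    Prolongable (relFace D x) := by
  intro y₁ h₁ y₂ h₂
  have h12 : y₁ ∈ relFace D y₂ := mem_relFace_trans hD h₂.1 (mem_relFace_comm hx h₂) h₁
  obtain ⟨_, ε, hε, _, h⟩ := h12
  have h := Convex.add_smul_sub_mem_of_le hD h₁.1 (lt_min hε one_pos).le (min_le_left ε 1) h
  set δ := min ε 1
  have hδ : 0 < δ := lt_min hε one_pos
  have hδ1 : δ ≤ 1 := min_le_right _ _
  refine ⟨2⁻¹ * δ, by positivity, mem_relFace_trans hD hx h₁ ⟨?_, 1, one_pos, ?_, ?_⟩⟩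
  · exact Convex.add_smul_sub_mem_of_le hD h₁.1 (by positivity) (by linarith) h
  · convert hD h₁.1 h₂.1 (a := 1 - 2⁻¹ * δ) (b := 2⁻¹ * δ) (by linarith) (by positivity) (by ring)
      using 1
    match_scalars <;> ring
  · convert h using 1
    match_scalars <;> ring

theorem Prolongable.subset_relFace {A D : Set E} (hA : Prolongable A) (hD : Convex ℝ D)
    (hAD : A ⊆ D) {x : E} (hx : x ∈ D) (h : (A ∩ relFace D x).Nonempty) : A ⊆ relFace D x := by
  obtain ⟨a₀, ha₀, h₀⟩ := h
  intro a ha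
  refine mem_relFace_trans hD hx h₀ ⟨hAD ha, ?_⟩
  obtain ⟨ε₁, hε₁, h1⟩ := hA a₀ ha₀ a ha
  obtain ⟨ε₂, hε₂, h2⟩ := hA a ha a₀ ha₀
  exact ⟨min ε₁ ε₂, lt_min hε₁ hε₂,
    Convex.add_smul_sub_mem_of_le hD (hAD ha₀) (lt_min hε₁ hε₂).le (min_le_left _ _) (hAD h1),
    Convex.add_smul_sub_mem_of_le hD (hAD ha) (lt_min hε₁ hε₂).le (min_le_right _ _) (hAD h2)⟩

/-- The convex hull of the union of two intersecting relatively open convex sets is relatively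
open. -/
theorem Prolongable.convexHull_union {A B : Set E} (hA : Prolongable A) (hB : Prolongable B)
    (h : (A ∩ B).Nonempty) :
    Prolongable (convexHull ℝ (A ∪ B)) := by
  obtain ⟨p, hpA, hpB⟩ := h
  set D := convexHull ℝ (A ∪ B)
  have hD : Convex ℝ D := convex_convexHull ℝ _
  have hAD : A ⊆ D := subset_union_left.trans (subset_convexHull ℝ _)
  have hBD : B ⊆ D := subset_union_right.trans (subset_convexHull ℝ _)
  have hpD := hAD hpA
  have hA' := hA.subset_relFace hD hAD hpD ⟨p, hpA, self_mem_relFace hpD⟩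
  have hB' := hB.subset_relFace hD hBD hpD ⟨p, hpB, self_mem_relFace hpD⟩
  have : D = relFace D p := ((convexHull_min (union_subset hA' hB')
    (convex_relFace hD hpD))).antisymm (relFace_subset _ _)
  rw [this]
  exact prolongable_relFace hD hpD

end RelativelyOpen

variable {d : ℕ}

theorem convex_IC (A : Set (Eucl d)) : Convex ℝ (IC A) :=
  Convex.convex_intrinsicInterior (convex_convexHull ℝ A)

theorem prolongable_IC (A : Set (Eucl d)) : Prolongable (IC A) :=
  Convex.prolongable_intrinsicInterior (convex_convexHull ℝ A)

theorem IC_subset_convexHull (A : Set (Eucl d)) : IC A ⊆ convexHull ℝ A := intrinsicInterior_subset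

theorem subset_affineSpan_of_IC_subset {A C : Set (Eucl d)} {x : Eucl d} (hx : x ∈ IC A)
    (h : IC A ⊆ C) : A ⊆ affineSpan ℝ C := by
  intro y hy
  have hm := Convex.combo_mem_intrinsicInterior (convex_convexHull ℝ A) hx
    (subset_closure (subset_convexHull ℝ A hy)) (t := 2⁻¹) (by norm_num) (by norm_num)
  have := add_smul_sub_mem_affineSpan (subset_affineSpan ℝ C (h hx))
    (subset_affineSpan ℝ C (h hm)) (subset_affineSpan ℝ C (h hx)) 2
  convert! this using 1
  match_scalars <;> norm_num

/-- A supply of convex pavings: the relatively open faces of a partition into convex sets. -/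
theorem isConvexPaving_relFace {Γ : Set (Eucl d × Eucl d)}
    (hΓ : ∀ x ∈ projX Γ, x ∈ IC (fiber Γ x)) (P : Eucl d → Set (Eucl d))
    (hc : ∀ x ∈ projX Γ, Convex ℝ (P x)) (hIC : ∀ x ∈ projX Γ, IC (fiber Γ x) ⊆ P x)
    (hdis : ∀ x ∈ projX Γ, ∀ y ∈ projX Γ, (P x ∩ P y).Nonempty → P x = P y) :
    IsConvexPaving Γ ((fun x => relFace (P x) x) '' projX Γ) := by
  have hself : ∀ x ∈ projX Γ, x ∈ P x := fun x hx => hIC x hx (hΓ x hx)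
  refine ⟨?_, ?_, ?_, ?_, ?_, ?_⟩
  · rintro _ ⟨x, hx, rfl⟩ _ ⟨y, hy, rfl⟩ ⟨z, hz, hz'⟩
    have hP := hdis x hx y hy ⟨z, hz.1, hz'.1⟩
    have hyx := hself y hy
    simp only [← hP] at hz' hyx ⊢
    have hzx := mem_relFace_comm (hself x hx) hz
    have hzy := mem_relFace_comm hyx hz'
    apply Subset.antisymm
    · intro w hw
      exact mem_relFace_trans (hc x hx) hyx hz' (mem_relFace_trans (hc x hx) hz.1 hzx hw)
    · intro w hw
      exact mem_relFace_trans (hc x hx) (hself x hx) hz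
        (mem_relFace_trans (hc x hx) hz.1 hzy hw)
  · rintro _ ⟨x, hx, rfl⟩
    exact convex_relFace (hc x hx) (hself x hx)
  · rintro _ ⟨x, hx, rfl⟩
    exact (Convex.intrinsicInterior_eq_iff (convex_relFace (hc x hx) (hself x hx))).2
      (prolongable_relFace (hc x hx) (hself x hx))
  · intro x hx
    exact ⟨_, ⟨x, hx, rfl⟩, self_mem_relFace (hself x hx)⟩
  · rintro _ ⟨x, hx, rfl⟩
    exact ⟨x, hx, self_mem_relFace (hself x hx)⟩
  · rintro z hz _ ⟨x, hx, rfl⟩ ⟨w, hw, hw'⟩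
    have hP := hdis x hx z hz ⟨w, hw'.1, hIC z hz hw⟩
    exact (prolongable_IC _).subset_relFace (hc x hx) (hP ▸ hIC z hz) (hself x hx) ⟨w, hw, hw'⟩

namespace IsConvexPaving

variable {Γ : Set (Eucl d × Eucl d)} {Φ : Set (Set (Eucl d))}

theorem prolongable (h : IsConvexPaving Γ Φ) {C : Set (Eucl d)} (hC : C ∈ Φ) : Prolongable C :=
  (Convex.intrinsicInterior_eq_iff (h.convex C hC)).1 (h.relOpen C hC)

theorem component_mem (h : IsConvexPaving Γ Φ) {x : Eucl d} (hx : x ∈ projX Γ) :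
    component Φ x ∈ Φ ∧ x ∈ component Φ x := by
  obtain ⟨C, hC, hxC⟩ := h.cover x hx
  rw [h.component_eq hC hxC]
  exact ⟨hC, hxC⟩

theorem IC_subset (h : IsConvexPaving Γ Φ) (hΓ : ∀ x ∈ projX Γ, x ∈ IC (fiber Γ x))
    {C : Set (Eucl d)} (hC : C ∈ Φ) {x : Eucl d} (hx : x ∈ projX Γ) (hxC : x ∈ C) :
    IC (fiber Γ x) ⊆ C :=
  h.absorb x hx C hC ⟨x, hΓ x hx, hxC⟩

theorem eq_of_closure_eq (h : IsConvexPaving Γ Φ) {C D : Set (Eucl d)} (hC : C ∈ Φ) (hD : D ∈ Φ)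
    (hCD : closure C = closure D) : C = D :=
  closure_injective_of_prolongable (h.convex C hC) (h.prolongable hC) (h.convex D hD)
    (h.prolongable hD) hCD

theorem measurableSet (h : IsConvexPaving Γ Φ) {C : Set (Eucl d)} (hC : C ∈ Φ) :
    MeasurableSet C := by
  rw [← h.relOpen C hC, intrinsicInterior]
  exact (MeasurableEmbedding.subtype_coe
    (AffineSubspace.closed_of_finiteDimensional (affineSpan ℝ C)).measurableSet).measurableSet_image.2
    isOpen_interior.measurableSet

end IsConvexPaving

theorem exists_irreducibleConvexPaving {Γ : Set (Eucl d × Eucl d)}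
    (hΓ : ∀ x ∈ projX Γ, x ∈ IC (fiber Γ x)) : ∃ Φ, IsIrreducibleConvexPaving Γ Φ := by
  set P : Eucl d → Set (Eucl d) := fun x => ⋂ (Ψ) (_ : IsConvexPaving Γ Ψ), component Ψ x with hP
  have hmem : ∀ {x z}, z ∈ P x ↔ ∀ Ψ, IsConvexPaving Γ Ψ → z ∈ component Ψ x := by
    intro x z; simp [hP]
  refine ⟨(fun x => relFace (P x) x) '' projX Γ, ?_, ?_⟩
  · refine isConvexPaving_relFace hΓ P ?_ ?_ ?_
    · intro x hx
      exact convex_iInter fun Ψ => convex_iInter fun hΨ =>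
        hΨ.convex _ (hΨ.component_mem hx).1
    · intro x hx z hz
      rw [hmem]
      intro Ψ hΨ
      exact hΨ.IC_subset hΓ (hΨ.component_mem hx).1 hx (hΨ.component_mem hx).2 hz
    · rintro x hx y hy ⟨z, hzx, hzy⟩
      have : ∀ Ψ, IsConvexPaving Γ Ψ → component Ψ x = component Ψ y := fun Ψ hΨ =>
        hΨ.disjoint _ (hΨ.component_mem hx).1 _ (hΨ.component_mem hy).1
          ⟨z, hmem.1 hzx Ψ hΨ, hmem.1 hzy Ψ hΨ⟩
      ext w
      rw [hmem, hmem]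
      exact forall₂_congr fun Ψ hΨ => by rw [this Ψ hΨ]
  · rintro Ψ hΨ _ ⟨x, hx, rfl⟩ D hD ⟨w, hw, hwD⟩ z hz
    have h1 := hmem.1 hw.1 Ψ hΨ
    have h2 := hmem.1 hz.1 Ψ hΨ
    rwa [hΨ.disjoint _ (hΨ.component_mem hx).1 D hD ⟨w, h1, hwD⟩] at h2

namespace IsIrreducibleConvexPaving

variable {Γ : Set (Eucl d × Eucl d)} {Φ Ψ : Set (Set (Eucl d))}

theorem subset (h : IsIrreducibleConvexPaving Γ Φ) (h' : IsIrreducibleConvexPaving Γ Ψ) :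
    Φ ⊆ Ψ := by
  intro C hC
  obtain ⟨x, hx, hxC⟩ := h.1.meets C hC
  obtain ⟨D, hD, hxD⟩ := h'.1.cover x hx
  rwa [(h.2 Ψ h'.1 C hC D hD ⟨x, hxC, hxD⟩).antisymm (h'.2 Φ h.1 D hD C hC ⟨x, hxD, hxC⟩)]

theorem subset_of_partition (h : IsIrreducibleConvexPaving Γ Φ)
    (hΓ : ∀ x ∈ projX Γ, x ∈ IC (fiber Γ x)) {P : Eucl d → Set (Eucl d)}
    (hc : ∀ x ∈ projX Γ, Convex ℝ (P x)) (hIC : ∀ x ∈ projX Γ, IC (fiber Γ x) ⊆ P x)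
    (hdis : ∀ x ∈ projX Γ, ∀ y ∈ projX Γ, (P x ∩ P y).Nonempty → P x = P y)
    {C : Set (Eucl d)} (hC : C ∈ Φ) {x : Eucl d} (hx : x ∈ projX Γ) (hxC : x ∈ C) : C ⊆ P x :=
  (h.2 _ (isConvexPaving_relFace hΓ P hc hIC hdis) C hC _ ⟨x, hx, rfl⟩
    ⟨x, hxC, self_mem_relFace (hIC x hx (hΓ x hx))⟩).trans (relFace_subset _ _)

theorem subset_convexHull (h : IsIrreducibleConvexPaving Γ Φ)
    (hΓ : ∀ x ∈ projX Γ, x ∈ IC (fiber Γ x)) {C : Set (Eucl d)} (hC : C ∈ Φ) :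
    C ⊆ convexHull ℝ (⋃ z ∈ projX Γ ∩ C, IC (fiber Γ z)) := by
  obtain ⟨x, hx, hxC⟩ := h.1.meets C hC
  have hsub : ∀ y ∈ projX Γ,
      convexHull ℝ (⋃ z ∈ projX Γ ∩ component Φ y, IC (fiber Γ z)) ⊆ component Φ y := by
    intro y hy
    refine convexHull_min (iUnion₂_subset fun z hz => ?_) (h.1.convex _ (h.1.component_mem hy).1)
    exact h.1.IC_subset hΓ (h.1.component_mem hy).1 hz.1 hz.2
  have := h.subset_of_partition hΓ
    (P := fun y => convexHull ℝ (⋃ z ∈ projX Γ ∩ component Φ y, IC (fiber Γ z)))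
    (fun y _ => convex_convexHull ℝ _) (fun y hy => ?_) (fun y hy z hz hyz => ?_) hC hx hxC
  · rwa [h.1.component_eq hC hxC] at this
  · refine Subset.trans ?_ (_root_.subset_convexHull ℝ _)
    exact subset_biUnion_of_mem (u := fun z => IC (fiber Γ z))
      (⟨hy, (h.1.component_mem hy).2⟩ : y ∈ projX Γ ∩ component Φ y)
  · obtain ⟨w, hw, hw'⟩ := hyz
    simp only [h.1.disjoint _ (h.1.component_mem hy).1 _ (h.1.component_mem hz).1
      ⟨w, hsub y hy hw, hsub z hz hw'⟩]

end IsIrreducibleConvexPaving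

theorem existsUnique_irreducibleConvexPaving {Γ : Set (Eucl d × Eucl d)}
    (hΓ : ∀ x ∈ projX Γ, x ∈ IC (fiber Γ x)) : ∃! Φ, IsIrreducibleConvexPaving Γ Φ := by
  obtain ⟨Φ, hΦ⟩ := exists_irreducibleConvexPaving hΓ
  exact ⟨Φ, hΦ, fun Ψ hΨ => (hΨ.subset hΦ).antisymm (hΦ.subset hΨ)⟩

end MartingaleTransport

namespace MartingaleTransport

section FiniteCone

variable {F : Type*} [NormedAddCommGroup F] [NormedSpace ℝ F] [FiniteDimensional ℝ F]

/-- The sum of a subspace and a finitely generated cone is closed. -/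
theorem isClosed_submodule_add_cone {ι : Type*} [DecidableEq ι] (L : Submodule ℝ F) (v : ι → F)
    (T : Finset ι) :
    IsClosed {x : F | ∃ l ∈ L, ∃ t : ι → ℝ, (∀ i ∈ T, 0 ≤ t i) ∧ x = l + ∑ i ∈ T, t i • v i} := by
  induction T using Finset.strongInduction with
  | H T ih =>
  by_cases hdep : ∀ r : ι → ℝ, ∑ i ∈ T, r i • v i ∈ L → ∀ i ∈ T, r i = 0
  · let φ : (L × (T → ℝ)) →ₗ[ℝ] F :=
      L.subtype.comp (LinearMap.fst ℝ L (T → ℝ)) +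
        (Fintype.linearCombination ℝ fun i : T => v i).comp (LinearMap.snd ℝ L (T → ℝ))
    have hφ : ∀ p, φ p = (p.1 : F) + ∑ i : T, p.2 i • v i := fun p => by
      simp [φ, Fintype.linearCombination_apply]
    have hker : LinearMap.ker φ = ⊥ := by
      rw [LinearMap.ker_eq_bot']
      rintro ⟨l, t⟩ h
      rw [hφ] at h
      have hs : ∑ i ∈ T, (fun i => if hi : i ∈ T then t ⟨i, hi⟩ else 0) i • v i
          = ∑ i : T, t i • v i := by
        rw [← Finset.sum_coe_sort T]
        exact Finset.sum_congr rfl fun i _ => by simp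
      have h0 := hdep (fun i => if hi : i ∈ T then t ⟨i, hi⟩ else 0) (by
        rw [hs, show ∑ i : T, t i • v i = -(l : F) from (neg_eq_of_add_eq_zero_right h).symm]
        exact L.neg_mem l.2)
      have ht : t = 0 := by
        ext i
        simpa using h0 i i.2
      subst ht
      simpa using h
    have hcl := (LinearMap.isClosedEmbedding_of_injective hker).isClosedMap
      {p : L × (T → ℝ) | ∀ i, 0 ≤ p.2 i} (by
        simp only [Set.ofPred_forall]
        exact isClosed_iInter fun i => isClosed_le continuous_const (by fun_prop))
    convert hcl using 1
    ext x
    constructor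
    · rintro ⟨l, hl, t, ht, rfl⟩
      refine ⟨(⟨l, hl⟩, fun i => t i), fun i => ht i i.2, ?_⟩
      rw [hφ, ← Finset.sum_coe_sort T]
    · rintro ⟨⟨l, t⟩, ht, rfl⟩
      refine ⟨l, l.2, fun i => if hi : i ∈ T then t ⟨i, hi⟩ else 0, fun i hi => ?_, ?_⟩
      · simpa [hi] using ht ⟨i, hi⟩
      · rw [hφ, ← Finset.sum_coe_sort T]
        congr 1
        exact Finset.sum_congr rfl fun i _ => by simp
  · push Not at hdep
    obtain ⟨r, hr, i₀, hi₀, hri₀⟩ := hdep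
    obtain ⟨r, hr, i₀, hi₀, hri₀⟩ : ∃ r : ι → ℝ, ∑ i ∈ T, r i • v i ∈ L ∧ ∃ i ∈ T, 0 < r i := by
      rcases lt_or_gt_of_ne hri₀ with h | h
      · refine ⟨fun i => -r i, ?_, i₀, hi₀, by simpa using h⟩
        simpa using L.neg_mem hr
      · exact ⟨r, hr, i₀, hi₀, h⟩
    have : {x : F | ∃ l ∈ L, ∃ t : ι → ℝ, (∀ i ∈ T, 0 ≤ t i) ∧ x = l + ∑ i ∈ T, t i • v i} =
        ⋃ j ∈ T, {x : F | ∃ l ∈ L, ∃ t : ι → ℝ, (∀ i ∈ T.erase j, 0 ≤ t i) ∧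
          x = l + ∑ i ∈ T.erase j, t i • v i} := by
      ext x
      simp only [Set.mem_iUnion, Set.mem_ofPred_eq, exists_prop]
      constructor
      · rintro ⟨l, hl, t, ht, rfl⟩
        obtain ⟨j, hj, hjmin⟩ := Finset.exists_min_image (T.filter fun i => 0 < r i)
          (fun i => t i / r i) ⟨i₀, by simp [hi₀, hri₀]⟩
        simp only [Finset.mem_filter] at hj hjmin
        set s := t j / r j with hs
        have hs0 : 0 ≤ s := div_nonneg (ht j hj.1) hj.2.le
        refine ⟨j, hj.1, l + s • ∑ i ∈ T, r i • v i, L.add_mem hl (L.smul_mem _ hr),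
          fun i => t i - s * r i, fun i hi => ?_, ?_⟩
        · have hiT := Finset.mem_of_mem_erase hi
          rcases le_or_gt (r i) 0 with h | h
          · nlinarith [ht i hiT]
          · have := hjmin i ⟨hiT, h⟩
            rw [le_div_iff₀ h] at this
            linarith
        · have hz : (t j - s * r j) • v j = 0 := by
            rw [hs, div_mul_cancel₀ _ hj.2.ne', sub_self, zero_smul]
          rw [← Finset.add_sum_erase T _ hj.1, ← Finset.add_sum_erase T _ hj.1,
            add_assoc, add_right_inj]
          have : ∑ i ∈ T.erase j, (t i - s * r i) • v i =
            ∑ i ∈ T.erase j, t i • v i - s • ∑ i ∈ T.erase j, r i • v i := by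
            rw [Finset.smul_sum, ← Finset.sum_sub_distrib]
            exact Finset.sum_congr rfl fun i _ => by rw [sub_smul, mul_smul]
          rw [this]
          rw [sub_smul, sub_eq_zero] at hz
          rw [hz, mul_smul, smul_add]
          abel
      · rintro ⟨j, hj, l, hl, t, ht, rfl⟩
        refine ⟨l, hl, Function.update t j 0, fun i hi => ?_, ?_⟩
        · by_cases h : i = j
          · simp [h]
          · simpa [h] using ht i (Finset.mem_erase.2 ⟨h, hi⟩)
        · rw [← Finset.add_sum_erase T _ hj]
          simp only [Function.update_self, zero_smul, zero_add]
          congr 1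
          exact Finset.sum_congr rfl fun i hi => by
            rw [Function.update_of_ne (Finset.ne_of_mem_erase hi)]
    rw [this]
    exact T.finite_toSet.isClosed_biUnion fun j hj => ih _ (Finset.erase_ssubset hj)

/-- A finite system of linear equations and inequalities that is approximately solvable is
solvable. -/
theorem exists_mem_submodule_of_approx {J : Type*} [Fintype J] (L : Submodule ℝ (J → ℝ))
    (c : J → ℝ) (S : Set J) (l : ℕ → J → ℝ) (hl : ∀ n, l n ∈ L) (hle : ∀ n j, l n j ≤ c j)
    (hlim : ∀ j ∈ S, Filter.Tendsto (fun n => l n j) Filter.atTop (nhds (c j))) :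
    ∃ k ∈ L, (∀ j, k j ≤ c j) ∧ ∀ j ∈ S, k j = c j := by
  classical
  have hcl := isClosed_submodule_add_cone L (fun j : J => (Pi.single j 1 : J → ℝ))
    (Finset.univ.filter fun j => j ∉ S)
  have hsum : ∀ t : J → ℝ, ∑ j ∈ Finset.univ.filter (fun j => j ∉ S), t j • (Pi.single j 1 : J → ℝ)
      = fun j => if j ∉ S then t j else 0 := by
    intro t
    ext i
    simp [Finset.sum_apply, Pi.single_apply]
  have hmem : c ∈ {x : J → ℝ | ∃ l ∈ L, ∃ t : J → ℝ,
      (∀ i ∈ Finset.univ.filter (fun j => j ∉ S), 0 ≤ t i) ∧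
      x = l + ∑ i ∈ Finset.univ.filter (fun j => j ∉ S), t i • (Pi.single i 1 : J → ℝ)} := by
    refine hcl.mem_of_tendsto (f := fun n => l n + ∑ i ∈ Finset.univ.filter (fun j => j ∉ S),
      (c i - l n i) • (Pi.single i 1 : J → ℝ)) (b := Filter.atTop) ?_ (Filter.Eventually.of_forall
        fun n => ⟨l n, hl n, fun i => c i - l n i, fun i _ => sub_nonneg.2 (hle n i), rfl⟩)
    rw [tendsto_pi_nhds]
    intro j
    simp only [Pi.add_apply]
    simp only [hsum]
    by_cases hj : j ∈ S
    · simpa [hj] using hlim j hj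
    · simp [hj]
  obtain ⟨k, hk, t, ht, hc⟩ := hmem
  rw [hsum] at hc
  refine ⟨k, hk, fun j => ?_, fun j hj => ?_⟩
  · have := congrFun hc j
    by_cases hj : j ∈ S
    · simp [hj] at this; exact this.ge
    · simp [hj] at this
      have := ht j (by simpa using hj)
      linarith
  · have := congrFun hc j
    simp [hj] at this; exact this.symm

end FiniteCone

variable {d : ℕ}

/-- The cost whose minimization is the problem `g` for the cost `c`. -/
def Goal.cost (g : Goal) (c : Eucl d × Eucl d → ℝ) : Eucl d × Eucl d → ℝ :=
  match g with
  | .minimize => c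
  | .maximize => fun p => -c p

theorem Goal.continuous_cost (g : Goal) {c : Eucl d × Eucl d → ℝ} (hc : Continuous c) :
    Continuous (g.cost c) := by
  cases g
  · exact hc
  · exact hc.neg

theorem Goal.measurable_cost (g : Goal) {c : Eucl d × Eucl d → ℝ} (hc : Measurable c) :
    Measurable (g.cost c) := by
  cases g
  · exact hc
  · exact hc.neg

theorem isContactLayer_cost_iff {g : Goal} {c : Eucl d × Eucl d → ℝ} {G : Set (Eucl d × Eucl d)} :
    IsContactLayer g c G ↔ IsContactLayer .minimize (g.cost c) G := by
  cases g
  · rfl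
  constructor
  · rintro ⟨hG, α, γ, β, h, heq⟩
    refine ⟨hG, -α, -γ, -β, ⟨h.measurable_α.neg, h.measurable_γ.neg, h.measurable_β.neg, ?_⟩, ?_⟩
    · intro x hx y hy
      have := h.ineq x hx y hy
      simp only [Goal.le, Goal.cost, Pi.neg_apply, inner_neg_left] at this ⊢
      linarith
    · intro x y hxy
      have := heq x y hxy
      simp only [Goal.cost, Pi.neg_apply, inner_neg_left]
      linarith
  · rintro ⟨hG, α, γ, β, h, heq⟩
    refine ⟨hG, -α, -γ, -β, ⟨h.measurable_α.neg, h.measurable_γ.neg, h.measurable_β.neg, ?_⟩, ?_⟩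
    · intro x hx y hy
      have := h.ineq x hx y hy
      simp only [Goal.le, Goal.cost, Pi.neg_apply, inner_neg_left] at this ⊢
      linarith
    · intro x y hxy
      have := heq x y hxy
      simp only [Goal.cost, Pi.neg_apply, inner_neg_left] at this ⊢
      linarith

theorem finitelyExposable_cost_iff {g : Goal} {c : Eucl d × Eucl d → ℝ}
    {G : Set (Eucl d × Eucl d)} :
    FinitelyExposable g c G ↔ FinitelyExposable .minimize (g.cost c) G :=
  forall₄_congr fun _ _ _ _ => isContactLayer_cost_iff

theorem isOptimal_cost_iff {g : Goal} {c : Eucl d × Eucl d → ℝ} {μ ν : Measure (Eucl d)}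
    {π : Measure (Eucl d × Eucl d)} :
    IsOptimal g c μ ν π ↔ IsOptimal .minimize (g.cost c) μ ν π := by
  cases g
  · rfl
  refine and_congr_right fun _ => and_congr ?_ (forall₂_congr fun ρ _ => ?_)
  · exact integrable_neg_iff.symm
  · simp only [Goal.cost, Goal.le, integral_neg, neg_le_neg_iff]
    exact imp_congr integrable_neg_iff.symm Iff.rfl

theorem FinitelyExposable.mono {g : Goal} {c : Eucl d × Eucl d → ℝ}
    {G G' : Set (Eucl d × Eucl d)} (h : FinitelyExposable g c G) (hG : G' ⊆ G) :
    FinitelyExposable g c G' := fun H hH => h H (hH.trans hG)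

/-- A finite set on which triples with arbitrarily small slack exist is a contact layer. -/
theorem isContactLayer_of_approx {c : Eucl d × Eucl d → ℝ} {H : Set (Eucl d × Eucl d)}
    (hfin : H.Finite) (hne : H.Nonempty) (α : ℕ → Eucl d → ℝ) (γ : ℕ → Eucl d → Eucl d)
    (β : ℕ → Eucl d → ℝ)
    (hle : ∀ n, ∀ x ∈ projX H, ∀ y ∈ projY H,
      β n y - α n x - inner ℝ (γ n x) (y - x) ≤ c (x, y))
    (hlim : ∀ p ∈ H, Filter.Tendsto
      (fun n => β n p.2 - α n p.1 - inner ℝ (γ n p.1) (p.2 - p.1)) Filter.atTop (nhds (c p))) :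
    IsContactLayer .minimize c H := by
  have hX : (projX H).Finite := hfin.image _
  have hY : (projY H).Finite := hfin.image _
  have := hX.fintype
  have := hY.fintype
  let Λ : ((Eucl d → ℝ) × (Eucl d → Eucl d) × (Eucl d → ℝ)) →ₗ[ℝ]
      (projX H × projY H → ℝ) :=
    { toFun := fun T j => T.2.2 j.2 - T.1 j.1 - inner ℝ (T.2.1 j.1) (j.2.1 - j.1.1)
      map_add' := fun T T' => by
        ext j
        simp only [Prod.fst_add, Prod.snd_add, Pi.add_apply, inner_add_left]
        ring
      map_smul' := fun r T => by
        ext j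
        simp only [Prod.smul_fst, Prod.smul_snd, Pi.smul_apply, inner_smul_left, smul_eq_mul,
          RingHom.id_apply, conj_trivial]
        ring }
  obtain ⟨k, ⟨⟨α', γ', β'⟩, rfl⟩, hk, hk'⟩ := exists_mem_submodule_of_approx (LinearMap.range Λ)
    (fun j => c (j.1, j.2)) {j | ((j.1 : Eucl d), (j.2 : Eucl d)) ∈ H}
    (fun n => Λ (α n, γ n, β n)) (fun n => ⟨_, rfl⟩) (fun n j => hle n _ j.1.2 _ j.2.2)
    (fun j hj => hlim _ hj)
  have hm : ∀ {F : Type} [NormedAddCommGroup F] [MeasurableSpace F] (f : Eucl d → F)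
      (s : Set (Eucl d)), s.Finite → Measurable (s.indicator f) := by
    intro F _ _ f s hs
    refine (measurable_const (a := (0 : F))).measurable_of_countable_ne (hs.countable.mono ?_)
    intro x hx
    by_contra h
    exact hx (by simp [h])
  refine ⟨hne, (projX H).indicator α', (projX H).indicator γ', (projY H).indicator β',
    ⟨hm _ _ hX, hm _ _ hX, hm _ _ hY, ?_⟩, ?_⟩
  · intro x hx y hy
    have := hk (⟨x, hx⟩, ⟨y, hy⟩)
    simpa [Goal.le, hx, hy, Λ] using this
  · intro x y hxy
    have hx : x ∈ projX H := ⟨_, hxy, rfl⟩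
    have hy : y ∈ projY H := ⟨_, hxy, rfl⟩
    have := hk' (⟨x, hx⟩, ⟨y, hy⟩) hxy
    simpa [hx, hy, Λ] using this

end MartingaleTransport

namespace MartingaleTransport

/-- Absence of a duality gap for a linear program over the measures on a compact space. -/
theorem exists_le_integral_of_forall_measure {Z : Type*} [TopologicalSpace Z] [CompactSpace Z]
    [T2Space Z] [MeasurableSpace Z] [BorelSpace Z] (π : Measure Z) [IsFiniteMeasure π]
    (L : Submodule ℝ C(Z, ℝ)) (h1 : (ContinuousMap.const Z (1 : ℝ)) ∈ L) (c : C(Z, ℝ))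
    (hopt : ∀ ρ : Measure Z, IsFiniteMeasure ρ → (∀ l ∈ L, ∫ z, l z ∂ρ = ∫ z, l z ∂π) →
      ∫ z, c z ∂π ≤ ∫ z, c z ∂ρ) {ε : ℝ} (hε : 0 < ε) :
    ∃ l ∈ L, (∀ z, l z ≤ c z) ∧ ∫ z, c z ∂π - ε ≤ ∫ z, l z ∂π := by
  classical
  have hint : ∀ f : C(Z, ℝ), Integrable f π := fun f =>
    f.continuous.integrable_of_hasCompactSupport (HasCompactSupport.of_compactSpace _)
  let V : C(Z, ℝ) → Set ℝ := fun f => {r | ∃ l ∈ L, (∀ z, f z ≤ l z) ∧ r = ∫ z, l z ∂π}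
  let N : C(Z, ℝ) → ℝ := fun f => sInf (V f)
  have hVne : ∀ f, (V f).Nonempty := fun f =>
    ⟨_, ‖f‖ • ContinuousMap.const Z (1 : ℝ), L.smul_mem _ h1, fun z => by
      simpa using (le_abs_self _).trans (f.norm_coe_le_norm z), rfl⟩
  have hVbd : ∀ f, ∀ r ∈ V f, ∫ z, f z ∂π ≤ r := by
    rintro f _ ⟨l, _, hl, rfl⟩
    exact integral_mono (hint f) (hint l) hl
  have hVbb : ∀ f, BddBelow (V f) := fun f => ⟨_, hVbd f⟩
  have hNle : ∀ f, ∀ l ∈ L, (∀ z, f z ≤ l z) → N f ≤ ∫ z, l z ∂π := fun f l hl h =>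
    csInf_le (hVbb f) ⟨l, hl, h, rfl⟩
  have hNadd : ∀ f g, N (f + g) ≤ N f + N g := by
    intro f g
    refine le_of_forall_pos_lt_add fun η hη => ?_
    obtain ⟨_, ⟨l, hl, hfl, rfl⟩, h2⟩ := exists_lt_of_csInf_lt (hVne f)
      (show sInf (V f) < N f + η / 2 by show N f < _; linarith)
    obtain ⟨_, ⟨k, hk, hgk, rfl⟩, h3⟩ := exists_lt_of_csInf_lt (hVne g)
      (show sInf (V g) < N g + η / 2 by show N g < _; linarith)
    have := hNle (f + g) (l + k) (L.add_mem hl hk) (fun z => add_le_add (hfl z) (hgk z))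
    have e : ∫ z, (l + k) z ∂π = ∫ z, l z ∂π + ∫ z, k z ∂π := integral_add (hint l) (hint k)
    linarith
  have hNsmul_le : ∀ t : ℝ, 0 < t → ∀ f, N (t • f) ≤ t * N f := by
    intro t ht f
    rw [← div_le_iff₀' ht]
    refine le_csInf (hVne f) ?_
    rintro _ ⟨l, hl, hfl, rfl⟩
    rw [div_le_iff₀' ht]
    have := hNle (t • f) (t • l) (L.smul_mem _ hl) (fun z => by
      simpa using mul_le_mul_of_nonneg_left (hfl z) ht.le)
    rwa [show ∫ z, (t • l) z ∂π = t * ∫ z, l z ∂π from integral_const_mul t _] at this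
  have hNsmul : ∀ t : ℝ, 0 < t → ∀ f, N (t • f) = t * N f := by
    intro t ht f
    refine (hNsmul_le t ht f).antisymm ?_
    have := hNsmul_le t⁻¹ (inv_pos.2 ht) (t • f)
    rw [smul_smul, inv_mul_cancel₀ ht.ne', one_smul, ← div_eq_inv_mul, le_div_iff₀' ht] at this
    exact this
  have hN0 : N 0 = 0 := by
    have := hNsmul 2 two_pos 0
    rw [smul_zero] at this; linarith
  have hgoal : N (-c) ≤ -∫ z, c z ∂π := by
    rcases eq_or_ne c 0 with rfl | hc
    · simp [hN0]
    obtain ⟨g, hg, hgN⟩ := exists_extension_of_le_sublinear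
      (LinearPMap.mkSpanSingleton c (-N (-c)) hc) N hNsmul hNadd (by
        rintro ⟨x, hx⟩
        obtain ⟨t, rfl⟩ := Submodule.mem_span_singleton.1 hx
        rw [LinearPMap.mkSpanSingleton'_apply]
        have hcc : 0 ≤ N c + N (-c) := by
          have := hNadd c (-c)
          rwa [add_neg_cancel, hN0] at this
        rcases lt_trichotomy t 0 with ht | rfl | ht
        · have := hNsmul (-t) (neg_pos.2 ht) (-c)
          rw [smul_neg, neg_smul, neg_neg] at this
          simp only [smul_eq_mul, RingHom.id_apply]
          rw [this]; linarith
        · simp [hN0]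
        · simp only [smul_eq_mul, RingHom.id_apply]
          rw [hNsmul t ht]
          nlinarith)
    have hgc : g c = -N (-c) := by
      have := hg ⟨c, Submodule.mem_span_singleton_self c⟩
      rw [LinearPMap.mkSpanSingleton_apply] at this
      exact this
    have hgpos : ∀ f : C(Z, ℝ), (∀ z, 0 ≤ f z) → 0 ≤ g f := by
      intro f hf
      have h2 := hgN (-f)
      have h3 := hNle (-f) 0 L.zero_mem (fun z => by simpa using hf z)
      rw [map_neg] at h2
      simp only [ContinuousMap.zero_apply, integral_zero] at h3
      linarith
    have hgL : ∀ l ∈ L, g l = ∫ z, l z ∂π := by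
      intro l hl
      have h2 := (hgN l).trans (hNle l l hl fun _ => le_rfl)
      have h3 := (hgN (-l)).trans (hNle (-l) (-l) (L.neg_mem hl) fun _ => le_rfl)
      rw [map_neg, show ∫ z, (-l) z ∂π = -∫ z, l z ∂π from integral_neg _] at h3
      linarith
    let Λ : CompactlySupportedContinuousMap Z ℝ →ₚ[ℝ] ℝ := PositiveLinearMap.mk₀
      { toFun := fun f => g f.toContinuousMap
        map_add' := fun f f' => g.map_add f.toContinuousMap f'.toContinuousMap
        map_smul' := fun t f => g.map_smul t f.toContinuousMap } (fun f hf => hgpos _ hf)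
    have hR : ∀ f : C(Z, ℝ), ∫ z, f z ∂(RealRMK.rieszMeasure Λ) = g f := fun f =>
      RealRMK.integral_rieszMeasure Λ ⟨f, HasCompactSupport.of_compactSpace _⟩
    have hfin : IsFiniteMeasure (RealRMK.rieszMeasure Λ) := inferInstance
    have := hopt _ hfin (fun l hl => by rw [hR, hgL l hl])
    rw [hR, hgc] at this
    linarith
  obtain ⟨_, ⟨l, hl, hcl, rfl⟩, h2⟩ := exists_lt_of_csInf_lt (hVne (-c))
    (show sInf (V (-c)) < N (-c) + ε by show N (-c) < _; linarith)
  refine ⟨-l, L.neg_mem hl, fun z => ?_, ?_⟩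
  · have := hcl z
    simp only [ContinuousMap.neg_apply] at this ⊢
    linarith
  · rw [show ∫ z, (-l) z ∂π = -∫ z, l z ∂π from integral_neg _]
    linarith

variable {d : ℕ}

theorem isProbabilityMeasure_fst_of_mem_MT {μ ν : Measure (Eucl d)} {π : Measure (Eucl d × Eucl d)}
    (h : π ∈ MT μ ν) : IsProbabilityMeasure μ := by
  have := h.1
  rw [← h.2.1]
  infer_instance

/-- A plan with finite first moments is a martingale plan if the increment is orthogonal to all
test functions of the first variable. -/
theorem mem_MT_of_forall_integral_smul_eq_zero {σ : Measure (Eucl d × Eucl d)}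
    [IsProbabilityMeasure σ] (hx : Integrable (fun p => p.1) σ) (hy : Integrable (fun p => p.2) σ)
    (h : ∀ g : Eucl d → ℝ, Continuous g → HasCompactSupport g →
      ∫ p, g p.1 • (p.2 - p.1) ∂σ = 0) : σ ∈ MT σ.fst σ.snd := by
  refine ⟨inferInstance, rfl, rfl, σ.condKernel, inferInstance, σ.disintegrate _ |>.symm, ?_⟩
  have hyk := hy.condKernel_ae
  have hb : Integrable (fun x => ∫ y, (y - x) ∂(σ.condKernel x)) σ.fst :=
    (hy.sub hx).integral_condKernel
  have h0 : ∀ᵐ x ∂σ.fst, ∫ y, (y - x) ∂(σ.condKernel x) = 0 := by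
    refine ae_eq_zero_of_integral_contDiff_smul_eq_zero hb.locallyIntegrable fun g hg hgc => ?_
    have hgi : Integrable (fun p : Eucl d × Eucl d => g p.1 • (p.2 - p.1)) σ := by
      obtain ⟨C, hC⟩ := hgc.exists_bound_of_continuous hg.continuous
      exact (hy.sub hx).bdd_smul C ((hg.continuous.comp continuous_fst).aestronglyMeasurable)
        (Filter.Eventually.of_forall fun p => hC p.1)
    have h2 := h g hg.continuous hgc
    rw [← Measure.integral_condKernel hgi] at h2
    simpa [integral_smul] using h2
  filter_upwards [hyk, h0] with x hx1 hx2
  refine ⟨hx1, ?_⟩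
  rw [integral_sub hx1 (integrable_const _)] at hx2
  simpa [sub_eq_zero] using hx2

theorem integral_smul_eq_zero_of_mem_MT {μ ν : Measure (Eucl d)} {σ : Measure (Eucl d × Eucl d)}
    (hσ : σ ∈ MT μ ν) (hx : Integrable (fun p => p.1) σ) (hy : Integrable (fun p => p.2) σ)
    {g : Eucl d → ℝ} (hg : Measurable g) {C : ℝ} (hC : ∀ x, |g x| ≤ C) :
    ∫ p, g p.1 • (p.2 - p.1) ∂σ = 0 := by
  have := isProbabilityMeasure_fst_of_mem_MT hσ
  obtain ⟨_, -, -, k, hk, rfl, hbar⟩ := hσ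
  have hgi : Integrable (fun p : Eucl d × Eucl d => g p.1 • (p.2 - p.1)) (μ ⊗ₘ k) :=
    (hy.sub hx).bdd_smul C (hg.comp measurable_fst).aestronglyMeasurable
      (Filter.Eventually.of_forall fun p => hC p.1)
  rw [Measure.integral_compProd hgi]
  refine integral_eq_zero_of_ae ?_
  filter_upwards [hbar] with x hxb
  rw [integral_smul, integral_sub hxb.1 (integrable_const _), hxb.2]
  simp

theorem ConvexOrder.integrable_fst {μ ν : Measure (Eucl d)} (h : ConvexOrder μ ν)
    {σ : Measure (Eucl d × Eucl d)} (hσ : σ.fst = μ) : Integrable (fun p => p.1) σ := by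
  have := h.moment_left
  rw [← hσ, Measure.fst] at this
  exact this.comp_measurable measurable_fst

theorem ConvexOrder.integrable_snd {μ ν : Measure (Eucl d)} (h : ConvexOrder μ ν)
    {σ : Measure (Eucl d × Eucl d)} (hσ : σ.snd = ν) : Integrable (fun p => p.2) σ := by
  have := h.moment_right
  rw [← hσ, Measure.snd] at this
  exact this.comp_measurable measurable_snd

/-- For an optimal plan and a compact product set there are continuous admissible triples of
arbitrarily small total slack. -/
theorem IsOptimal.exists_small_slack {μ ν : Measure (Eucl d)} (hμν : ConvexOrder μ ν)
    {π : Measure (Eucl d × Eucl d)} {c : Eucl d × Eucl d → ℝ} (hc : Continuous c)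
    (hopt : IsOptimal .minimize c μ ν π) {Z : Set (Eucl d × Eucl d)} (hZ : IsCompact Z)
    {ε : ℝ} (hε : 0 < ε) :
    ∃ (α : C(Eucl d, ℝ)) (γ : C(Eucl d, Eucl d)) (β : C(Eucl d, ℝ)),
      (∀ p ∈ Z, β p.2 - α p.1 - inner ℝ (γ p.1) (p.2 - p.1) ≤ c p) ∧
      ∫ p in Z, c p ∂π - ε ≤ ∫ p in Z, (β p.2 - α p.1 - inner ℝ (γ p.1) (p.2 - p.1)) ∂π := by
  obtain ⟨hπ, hcπ, hopt⟩ := hopt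
  have := hπ.1
  have hZm : MeasurableSet Z := hZ.measurableSet
  have : CompactSpace Z := isCompact_iff_compactSpace.1 hZ
  let Λ : (C(Eucl d, ℝ) × C(Eucl d, Eucl d) × C(Eucl d, ℝ)) →ₗ[ℝ] C(Z, ℝ) :=
    { toFun := fun T => ⟨fun z => T.2.2 z.1.2 - T.1 z.1.1 - inner ℝ (T.2.1 z.1.1)
        (z.1.2 - z.1.1), by fun_prop⟩
      map_add' := fun T T' => by
        ext j
        simp only [Prod.fst_add, Prod.snd_add, ContinuousMap.add_apply, inner_add_left,
          ContinuousMap.coe_mk]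
        ring
      map_smul' := fun r T => by
        ext j
        simp only [Prod.smul_fst, Prod.smul_snd, ContinuousMap.smul_apply, inner_smul_left,
          smul_eq_mul, RingHom.id_apply, conj_trivial, ContinuousMap.coe_mk]
        ring }
  have hΛ : ∀ α γ β, ∀ z : Z, Λ (α, γ, β) z = β z.1.2 - α z.1.1 - inner ℝ (γ z.1.1)
    (z.1.2 - z.1.1) := fun _ _ _ _ => rfl
  have hemb : MeasurableEmbedding (Subtype.val : Z → Eucl d × Eucl d) :=
    MeasurableEmbedding.subtype_coe hZm
  have hfinZ : IsFiniteMeasure (π.comap (Subtype.val : Z → Eucl d × Eucl d)) :=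
    ⟨by rw [hemb.comap_apply]; exact measure_lt_top _ _⟩
  have hcomap : ∀ f : Eucl d × Eucl d → ℝ,
      ∫ z : Z, f z ∂(π.comap (Subtype.val : Z → Eucl d × Eucl d)) = ∫ p in Z, f p ∂π :=
    fun f => integral_subtype_comap hZm f
  obtain ⟨_, ⟨⟨α, γ, β⟩, rfl⟩, hle, hint⟩ := exists_le_integral_of_forall_measure
    (π.comap (Subtype.val : Z → Eucl d × Eucl d)) (LinearMap.range Λ)
    ⟨(0, 0, ContinuousMap.const _ 1), by ext z; simp [hΛ]⟩ ⟨fun z => c z, by fun_prop⟩ (by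
      intro ρ hρ hL
      have hL' : ∀ (α : C(Eucl d, ℝ)) (γ : C(Eucl d, Eucl d)) (β : C(Eucl d, ℝ)), ∫ z : Z, (β z.1.2 - α z.1.1 - inner ℝ (γ z.1.1)
          (z.1.2 - z.1.1)) ∂ρ = ∫ p in Z, (β p.2 - α p.1 - inner ℝ (γ p.1)
          (p.2 - p.1)) ∂π := by
        intro α γ β
        rw [← hcomap]
        exact hL (Λ (α, γ, β)) ⟨_, rfl⟩
      set ρ' := ρ.map (Subtype.val : Z → Eucl d × Eucl d) with hρ'
      have hρfin : IsFiniteMeasure ρ' := inferInstance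
      have hmap : ∀ f : Eucl d × Eucl d → ℝ, ∫ p, f p ∂ρ' = ∫ z : Z, f z ∂ρ :=
        fun f => hemb.integral_map f
      have hicont : ∀ {F : Type} [NormedAddCommGroup F] [SecondCountableTopology F]
          (f : Eucl d × Eucl d → F), Continuous f → Integrable f ρ' := by
        intro F _ _ f hf
        rw [hρ', hemb.integrable_map_iff]
        exact (hf.comp continuous_subtype_val).integrable_of_hasCompactSupport
          (HasCompactSupport.of_compactSpace _)
      set σ := π.restrict Zᶜ + ρ' with hσ
      have hsplit : π.restrict Zᶜ + π.restrict Z = π := by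
        rw [add_comm]; exact Measure.restrict_add_restrict_compl hZm
      have hsnd : σ.snd = ν := by
        have h1 : ρ'.snd = (π.restrict Z).snd := by
          refine ext_of_forall_integral_eq_of_IsFiniteMeasure fun f => ?_
          rw [Measure.snd, Measure.snd, integral_map measurable_snd.aemeasurable
            f.continuous.aestronglyMeasurable, integral_map measurable_snd.aemeasurable
            f.continuous.aestronglyMeasurable, hmap]
          simpa using hL' 0 0 f.toContinuousMap
        rw [Measure.snd, hσ, Measure.map_add _ _ measurable_snd, ← Measure.snd, ← Measure.snd, h1,
          Measure.snd, Measure.snd, ← Measure.map_add _ _ measurable_snd, hsplit, ← hπ.2.2.1,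
          Measure.snd]
      have hfst : σ.fst = μ := by
        have h1 : ρ'.fst = (π.restrict Z).fst := by
          refine ext_of_forall_integral_eq_of_IsFiniteMeasure fun f => ?_
          rw [Measure.fst, Measure.fst, integral_map measurable_fst.aemeasurable
            f.continuous.aestronglyMeasurable, integral_map measurable_fst.aemeasurable
            f.continuous.aestronglyMeasurable, hmap]
          have := hL' f.toContinuousMap 0 0
          simp only [ContinuousMap.zero_apply, inner_zero_left, sub_zero, zero_sub,
            integral_neg, neg_inj] at this
          exact this
        rw [Measure.fst, hσ, Measure.map_add _ _ measurable_fst, ← Measure.fst, ← Measure.fst, h1,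
          Measure.fst, Measure.fst, ← Measure.map_add _ _ measurable_fst, hsplit, ← hπ.2.1,
          Measure.fst]
      have hσp : IsProbabilityMeasure σ := by
        have := hμν.prob_right
        refine ⟨?_⟩
        rw [← Measure.snd_univ, hsnd, measure_univ]
      have hσMT : σ ∈ MT μ ν := by
        have := mem_MT_of_forall_integral_smul_eq_zero (hμν.integrable_fst hfst)
          (hμν.integrable_snd hsnd) (fun g hg hgc => ?_)
        · rwa [hfst, hsnd] at this
        obtain ⟨C, hC⟩ := hgc.exists_bound_of_continuous hg
        have hgi : Integrable (fun p : Eucl d × Eucl d => g p.1 • (p.2 - p.1)) π :=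
          ((hμν.integrable_snd hπ.2.2.1).sub (hμν.integrable_fst hπ.2.1)).bdd_smul C
            ((hg.comp continuous_fst).aestronglyMeasurable)
            (Filter.Eventually.of_forall fun p => hC p.1)
        have hgc : Continuous (fun p : Eucl d × Eucl d => g p.1 • (p.2 - p.1)) := by fun_prop
        have h0 := integral_smul_eq_zero_of_mem_MT hπ (hμν.integrable_fst hπ.2.1)
          (hμν.integrable_snd hπ.2.2.1) hg.measurable hC
        rw [hσ, integral_add_measure hgi.restrict (hicont _ hgc)]
        rw [← hsplit, integral_add_measure hgi.restrict hgi.restrict] at h0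
        rw [← h0]
        congr 1
        refine ext_inner_left ℝ fun v => ?_
        rw [← integral_inner (hicont _ hgc), ← integral_inner hgi.restrict, hmap]
        have := hL' 0 ⟨fun x => -(g x • v), by fun_prop⟩ 0
        simp only [ContinuousMap.zero_apply, inner_neg_left, sub_zero, zero_sub,
          neg_neg, ContinuousMap.coe_mk, inner_smul_left, conj_trivial] at this
        simp only [inner_smul_right]
        exact this
      have hopt' := hopt σ hσMT (hcπ.restrict.add_measure (hicont c hc))
      simp only [Goal.le] at hopt'
      rw [hσ, integral_add_measure hcπ.restrict (hicont c hc), hmap] at hopt'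
      have e : ∫ p, c p ∂π = ∫ p in Zᶜ, c p ∂π + ∫ p in Z, c p ∂π := by
        conv_lhs => rw [← hsplit]
        exact integral_add_measure hcπ.restrict hcπ.restrict
      rw [e] at hopt'
      have e2 := hcomap c
      simp only [ContinuousMap.coe_mk]
      rw [e2]
      linarith) hε
  refine ⟨α, γ, β, fun p hp => hle ⟨p, hp⟩, ?_⟩
  have e1 := hcomap c
  have e2 := hcomap (fun p => β p.2 - α p.1 - inner ℝ (γ p.1) (p.2 - p.1))
  rw [← e1, ← e2]
  exact hint

theorem IsOptimal.exists_tendsto_slack {μ ν : Measure (Eucl d)} (hμν : ConvexOrder μ ν)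
    {π : Measure (Eucl d × Eucl d)} {c : Eucl d × Eucl d → ℝ} (hc : Continuous c)
    (hopt : IsOptimal .minimize c μ ν π) {Z : Set (Eucl d × Eucl d)} (hZ : IsCompact Z) :
    ∃ (α : ℕ → Eucl d → ℝ) (γ : ℕ → Eucl d → Eucl d) (β : ℕ → Eucl d → ℝ),
      (∀ n, ∀ p ∈ Z, β n p.2 - α n p.1 - inner ℝ (γ n p.1) (p.2 - p.1) ≤ c p) ∧
      ∀ᵐ p ∂π, p ∈ Z → Filter.Tendsto
        (fun n => β n p.2 - α n p.1 - inner ℝ (γ n p.1) (p.2 - p.1)) Filter.atTop (nhds (c p)) := by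
  have := hopt.1.1
  have h := fun n : ℕ => hopt.exists_small_slack hμν hc hZ (ε := (1 / 2) ^ n) (by positivity)
  choose α γ β hle hint using h
  refine ⟨fun n => α n, fun n => γ n, fun n => β n, hle, ?_⟩
  rw [← ae_restrict_iff' hZ.measurableSet]
  set s : ℕ → Eucl d × Eucl d → ℝ := fun n p =>
    c p - (β n p.2 - α n p.1 - inner ℝ (γ n p.1) (p.2 - p.1)) with hs
  have hscont : ∀ n, Continuous (s n) := fun n => by fun_prop
  have hsint : ∀ n, ∫ p in Z, s n p ∂π ≤ (1 / 2) ^ n := by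
    intro n
    rw [hs, integral_sub (hc.continuousOn.integrableOn_compact hZ)
      (Continuous.continuousOn (by fun_prop) |>.integrableOn_compact hZ)]
    linarith [hint n]
  have hsum : ∑' n, ∫⁻ p in Z, ENNReal.ofReal (s n p) ∂π ≠ ⊤ := by
    refine ne_top_of_le_ne_top (b := ∑' n : ℕ, ENNReal.ofReal ((1 / 2) ^ n)) ?_
      (ENNReal.tsum_le_tsum fun n => ?_)
    · rw [← ENNReal.ofReal_tsum_of_nonneg (fun n => by positivity) summable_geometric_two]
      exact ENNReal.ofReal_ne_top
    · rw [← ofReal_integral_eq_lintegral_ofReal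
        ((hscont n).continuousOn.integrableOn_compact hZ)]
      · exact ENNReal.ofReal_le_ofReal (hsint n)
      · filter_upwards [ae_restrict_mem hZ.measurableSet] with p hp
        exact sub_nonneg.2 (hle n p hp)
  rw [← lintegral_tsum fun n => (hscont n).measurable.ennreal_ofReal.aemeasurable] at hsum
  filter_upwards [ae_lt_top (Measurable.tsum fun n =>
    (hscont n).measurable.ennreal_ofReal) hsum, ae_restrict_mem hZ.measurableSet] with p hp hpZ
  have h0 := ENNReal.tendsto_atTop_zero_of_tsum_ne_top hp.ne
  have h1 : Filter.Tendsto (fun n => s n p) Filter.atTop (nhds 0) := by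
    have := (ENNReal.tendsto_toReal ENNReal.zero_ne_top).comp h0
    refine this.congr fun n => ?_
    exact ENNReal.toReal_ofReal (sub_nonneg.2 (hle n p hpZ))
  have h2 := h1.const_sub (c p)
  rw [sub_zero] at h2
  refine h2.congr fun n => ?_
  simp only [hs]; ring

/-- An optimal plan for a continuous cost is concentrated on a finitely exposable set. -/
theorem IsOptimal.exists_finitelyExposable {μ ν : Measure (Eucl d)} (hμν : ConvexOrder μ ν)
    {π : Measure (Eucl d × Eucl d)} {g : Goal} {c : Eucl d × Eucl d → ℝ} (hc : Continuous c)
    (hopt : IsOptimal g c μ ν π) :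
    ∃ G, MeasurableSet G ∧ G ∈ ae π ∧ FinitelyExposable g c G := by
  rw [isOptimal_cost_iff] at hopt
  suffices ∃ G, MeasurableSet G ∧ G ∈ ae π ∧ FinitelyExposable .minimize (g.cost c) G by
    simpa only [← finitelyExposable_cost_iff] using this
  replace hc := g.continuous_cost hc
  generalize g.cost c = c at hopt hc
  let Z : ℕ → Set (Eucl d × Eucl d) := fun m =>
    Metric.closedBall 0 m ×ˢ Metric.closedBall 0 m
  have hZ : ∀ m, IsCompact (Z m) := fun m =>
    (isCompact_closedBall _ _).prod (isCompact_closedBall _ _)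
  choose α γ β hle hlim using fun m => hopt.exists_tendsto_slack hμν hc (hZ m)
  obtain ⟨G, hG, hGm, hGp⟩ := (ae_all_iff.2 hlim).exists_measurable_mem
  refine ⟨G, hGm, hG, fun H hH hfin hne => ?_⟩
  obtain ⟨R, hR⟩ := hfin.isBounded.subset_closedBall (0 : Eucl d × Eucl d)
  obtain ⟨m, hm⟩ := exists_nat_ge R
  have hb : ∀ p ∈ H, ‖p.1‖ ≤ m ∧ ‖p.2‖ ≤ m := fun p hp => by
    have := hR hp
    rw [mem_closedBall_zero_iff] at this
    exact ⟨(norm_fst_le p).trans (this.trans hm), (norm_snd_le p).trans (this.trans hm)⟩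
  refine isContactLayer_of_approx hfin hne (α m) (γ m) (β m) ?_ fun p hp => ?_
  · rintro n _ ⟨p, hp, rfl⟩ _ ⟨q, hq, rfl⟩
    exact hle m n (p.1, q.2) (by simp [Z, hb p hp, hb q hq])
  · exact hGp p (hH hp) m (by simp [Z, hb p hp])

/-- The barycenter of a probability measure lies in the relative interior of the convex hull of
every set of full measure contained in the support. -/
theorem mem_IC_of_barycenter {m : Measure (Eucl d)} [IsProbabilityMeasure m]
    (hint : Integrable (fun y => y) m) {x : Eucl d} (hx : ∫ y, y ∂m = x) {A : Set (Eucl d)}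
    (hA : A ∈ ae m) (hsupp : A ⊆ m.support) : x ∈ IC A := by
  set D := convexHull ℝ A with hD
  have hDc : Convex ℝ D := convex_convexHull ℝ A
  have hAD : A ⊆ D := subset_convexHull ℝ A
  set V := affineSpan ℝ D
  have hVc : IsClosed (V : Set (Eucl d)) := AffineSubspace.closed_of_finiteDimensional V
  have hxV : x ∈ V := by
    rw [← hx]
    exact V.convex.integral_mem hVc (Filter.mem_of_superset hA
      (hAD.trans (subset_affineSpan ℝ D))) hint
  have hAne : A.Nonempty := by
    by_contra h
    rw [not_nonempty_iff_eq_empty] at h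
    rw [h] at hA
    exact (ae_neBot.2 (IsProbabilityMeasure.ne_zero m)).ne (Filter.empty_mem_iff_bot.1 hA)
  obtain ⟨q, hq⟩ := Set.Nonempty.intrinsicInterior hDc (hAne.mono hAD)
  have hqV : q ∈ V := subset_affineSpan ℝ D (intrinsicInterior_subset hq)
  have hq' := mem_intrinsicInterior_iff_ball.1 hq
  obtain ⟨-, r, hr, hball⟩ := hq'
  let P := V.direction.starProjection
  have hPmem : ∀ z, x + P z ∈ V := fun z => by
    have := AffineSubspace.vadd_mem_of_mem_direction (V.direction.starProjection_apply_mem z) hxV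
    rwa [vadd_eq_add, add_comm] at this
  have hPeq : ∀ y ∈ V, P (y - x) = y - x := fun y hy =>
    Submodule.starProjection_eq_self_iff.2 (AffineSubspace.vsub_mem_direction hy hxV)
  set D' : Set (Eucl d) := {z | x + P z ∈ D} with hD'
  have hD'c : Convex ℝ D' := by
    intro z hz w hw a b ha hb hab
    have := hDc hz hw ha hb hab
    simp only [hD', mem_ofPred_eq, map_add, map_smul]
    convert this using 1
    obtain rfl : b = 1 - a := by linarith
    match_scalars <;> ring
  have hqD' : q - x ∈ interior D' := by
    rw [mem_interior_iff_mem_nhds, Metric.mem_nhds_iff]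
    refine ⟨r, hr, fun z hz => hball _ (hPmem z) ?_⟩
    rw [dist_eq_norm, show x + P z - q = P (z - (q - x)) by rw [map_sub, hPeq q hqV]; abel]
    rw [Metric.mem_ball, dist_eq_norm] at hz
    exact (Submodule.norm_starProjection_apply_le _ _).trans_lt hz
  by_contra hcon
  have h0 : (0 : Eucl d) ∉ interior D' := by
    intro h0
    rw [mem_interior_iff_mem_nhds, Metric.mem_nhds_iff] at h0
    obtain ⟨s, hs, h0⟩ := h0
    refine hcon (mem_intrinsicInterior_iff_ball.2 ⟨hxV, s, hs, fun y hy hys => ?_⟩)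
    have : y - x ∈ D' := h0 (by rwa [Metric.mem_ball, dist_zero_right, ← dist_eq_norm])
    simpa [hD', hPeq y hy] using this
  obtain ⟨f, hf⟩ := geometric_hahn_banach_open_point hD'c.interior isOpen_interior h0
  rw [map_zero] at hf
  have hfD : ∀ y ∈ D, f (y - x) ≤ 0 := by
    intro y hy
    have hyD' : y - x ∈ closure (interior D') := by
      rw [hD'c.closure_interior_eq_closure_of_nonempty_interior ⟨_, hqD'⟩]
      refine subset_closure ?_
      simpa [hD', hPeq y (subset_affineSpan ℝ D hy)] using hy
    exact closure_minimal (fun z hz => (hf z hz).le) (isClosed_le f.continuous continuous_const) hyD'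
  have hfint : Integrable (fun y => f (y - x)) m :=
    f.integrable_comp (hint.sub (integrable_const x))
  have hzero : ∫ y, -f (y - x) ∂m = 0 := by
    have h := f.integral_comp_comm (hint.sub (integrable_const x))
    simp only [Pi.sub_apply] at h
    rw [integral_neg, h, integral_sub hint (integrable_const x), hx]
    simp
  replace hzero := (integral_eq_zero_iff_of_nonneg_ae (f := fun y => -f (y - x)) (by
    filter_upwards [hA] with y hy
    simpa using hfD y (hAD hy)) hfint.neg).1 hzero
  have hS : m.support ⊆ {y | f (y - x) = 0} := by
    refine Measure.support_subset_of_isClosed (isClosed_eq (by fun_prop) continuous_const) ?_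
    filter_upwards [hzero] with y hy
    exact neg_eq_zero.1 hy
  have hD0 : D ⊆ {y | f (y - x) = 0} := by
    refine convexHull_min (hsupp.trans hS) ?_
    intro z hz w hw a b ha hb hab
    have : a • z + b • w - x = a • (z - x) + b • (w - x) := by
      obtain rfl : b = 1 - a := by linarith
      match_scalars <;> ring
    simp only [mem_ofPred_eq] at hz hw ⊢
    rw [this, map_add, map_smul, map_smul, hz, hw]
    simp
  exact (hf _ hqD').ne (hD0 (intrinsicInterior_subset hq))

theorem measurableSet_snd_mem_support (k : Kernel (Eucl d) (Eucl d)) [IsMarkovKernel k] :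
    MeasurableSet {p : Eucl d × Eucl d | p.2 ∈ (k p.1).support} := by
  have h : {p : Eucl d × Eucl d | p.2 ∈ (k p.1).support} =
      ⋂ n : ℕ, {p | 0 < k p.1 (Metric.ball p.2 (1 / (n + 1)))} := by
    ext p
    simp only [mem_iInter, mem_ofPred_eq]
    have := Metric.nhds_basis_ball_inv_nat_succ (x := p.2) |>.mem_measureSupport (μ := k p.1)
    simpa using this
  rw [h]
  refine MeasurableSet.iInter fun n => measurableSet_lt measurable_const ?_
  have hm : MeasurableSet {q : (Eucl d × Eucl d) × Eucl d | q.2 ∈ Metric.ball q.1.2 (1 / (n + 1))} :=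
    by
    simp only [Metric.mem_ball]
    exact measurableSet_lt (by fun_prop) measurable_const
  exact Kernel.measurable_kernel_prodMk_left (κ := k.comap Prod.fst measurable_fst) hm

/-- Every Borel set of full measure for a martingale plan contains a martingale supporting set of
full measure. -/
theorem exists_martingaleSupporting_subset {μ ν : Measure (Eucl d)} {π : Measure (Eucl d × Eucl d)}
    (hπ : π ∈ MT μ ν) {G : Set (Eucl d × Eucl d)} (hG : MeasurableSet G) (hGπ : G ∈ ae π) :
    ∃ Γ ⊆ G, MartingaleSupporting Γ ∧ π Γ = 1 := by
  have := isProbabilityMeasure_fst_of_mem_MT hπ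
  obtain ⟨hπp, -, -, k, hk, rfl, hbar⟩ := hπ
  obtain ⟨X, hX, hXm, hXp⟩ := (hbar.and (Measure.ae_ae_of_ae_compProd hGπ)).exists_measurable_mem
  set S := {p : Eucl d × Eucl d | p.2 ∈ (k p.1).support} with hS
  have hSm : MeasurableSet S := measurableSet_snd_mem_support k
  refine ⟨G ∩ (Prod.fst ⁻¹' X ∩ S), inter_subset_left, ⟨hG.inter
    ((measurable_fst hXm).inter hSm), ?_⟩, ?_⟩
  · rintro _ ⟨p, ⟨hpG, hpX, hpS⟩, rfl⟩
    obtain ⟨⟨hint, hx⟩, hfib⟩ := hXp p.1 hpX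
    have hfib_eq : fiber (G ∩ (Prod.fst ⁻¹' X ∩ S)) p.1 =
        {y | (p.1, y) ∈ G} ∩ (k p.1).support := by
      ext y
      simp only [fiber, mem_ofPred_eq, mem_inter_iff, mem_preimage, hS]
      exact ⟨fun h => ⟨h.1, h.2.2⟩, fun h => ⟨h.1, hpX, h.2⟩⟩
    rw [hfib_eq]
    exact mem_IC_of_barycenter hint hx (Filter.inter_mem hfib Measure.support_mem_ae)
      inter_subset_right
  · rw [← measure_univ (μ := μ ⊗ₘ k)]
    refine measure_congr (Filter.eventuallyEq_univ.2 (Filter.inter_mem hGπ ?_))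
    refine (Measure.ae_compProd_iff ((measurable_fst hXm).inter hSm)).2 ?_
    filter_upwards [hX] with x hx
    filter_upwards [Measure.support_mem_ae (μ := k x)] with y hy
    exact ⟨hx, hy⟩

/-- The concentration set of an optimal plan for a continuous cost can be chosen finitely
exposable, and off the diagonal if the marginals are mutually singular. -/
theorem IsOptimal.exists_concentration {μ ν : Measure (Eucl d)} (hμν : ConvexOrder μ ν)
    {π : Measure (Eucl d × Eucl d)} {g : Goal} {c : Eucl d × Eucl d → ℝ} (hc : Continuous c)
    (hopt : IsOptimal g c μ ν π) {Γ : Set (Eucl d × Eucl d)} (hΓ : MeasurableSet Γ)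
    (hπΓ : Γ ∈ ae π) :
    ∃ Γ' ⊆ Γ, MartingaleSupporting Γ' ∧ π Γ' = 1 ∧ FinitelyExposable g c Γ' ∧
      (μ ⟂ₘ ν → ∀ x, (x, x) ∉ Γ') := by
  obtain ⟨G, hGm, hGπ, hG⟩ := hopt.exists_finitelyExposable hμν hc
  by_cases hs : μ ⟂ₘ ν
  · obtain ⟨B, hB, hμB, hνB⟩ := hs
    have h1 : ∀ᵐ p ∂π, p.1 ∉ B := by
      have : ∀ᵐ x ∂μ, x ∉ B := measure_eq_zero_iff_ae_notMem.1 hμB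
      rw [← hopt.1.2.1] at this
      exact ae_of_ae_map measurable_fst.aemeasurable this
    have h2 : ∀ᵐ p ∂π, p.2 ∉ Bᶜ := by
      have : ∀ᵐ x ∂ν, x ∉ Bᶜ := measure_eq_zero_iff_ae_notMem.1 hνB
      rw [← hopt.1.2.2.1] at this
      exact ae_of_ae_map measurable_snd.aemeasurable this
    obtain ⟨Γ', hsub, hMS, h1'⟩ := exists_martingaleSupporting_subset hopt.1
      (G := (Γ ∩ G) ∩ (Prod.fst ⁻¹' Bᶜ ∩ Prod.snd ⁻¹' B))
      ((hΓ.inter hGm).inter ((measurable_fst hB.compl).inter (measurable_snd hB)))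
      (Filter.inter_mem (Filter.inter_mem hπΓ hGπ) (Filter.inter_mem h1
        (h2.mono fun p hp => not_not.1 hp)))
    exact ⟨Γ', fun p hp => (hsub hp).1.1, hMS, h1', hG.mono fun p hp => (hsub hp).1.2,
      fun _ x hx => (hsub hx).2.1 (hsub hx).2.2⟩
  · obtain ⟨Γ', hsub, hMS, h1⟩ := exists_martingaleSupporting_subset hopt.1
      (hΓ.inter hGm) (Filter.inter_mem hπΓ hGπ)
    exact ⟨Γ', fun p hp => (hsub hp).1, hMS, h1, hG.mono fun p hp => (hsub hp).2,
      fun h => absurd h hs⟩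

end MartingaleTransport

namespace MartingaleTransport

variable {d : ℕ}

section BoundedPotentials

variable {ι : Type*} (l : Filter ι)

/-- Eventually bounded above along a filter. -/
def BddAboveAlong (a : ι → ℝ) : Prop := ∃ M, ∀ᶠ i in l, a i ≤ M

/-- Eventually bounded along a filter. -/
def BddAlong (a : ι → ℝ) : Prop := BddAboveAlong l a ∧ BddAboveAlong l (fun i => -a i)

variable {l}

theorem BddAboveAlong.add {a b : ι → ℝ} (ha : BddAboveAlong l a) (hb : BddAboveAlong l b) :
    BddAboveAlong l (fun i => a i + b i) := by
  obtain ⟨M, hM⟩ := ha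
  obtain ⟨M', hM'⟩ := hb
  exact ⟨M + M', (hM.and hM').mono fun i hi => add_le_add hi.1 hi.2⟩

theorem BddAboveAlong.const_mul {a : ι → ℝ} (ha : BddAboveAlong l a) {t : ℝ} (ht : 0 ≤ t) :
    BddAboveAlong l (fun i => t * a i) := by
  obtain ⟨M, hM⟩ := ha
  exact ⟨t * M, hM.mono fun i hi => mul_le_mul_of_nonneg_left hi ht⟩

theorem BddAboveAlong.mono {a b : ι → ℝ} (ha : BddAboveAlong l a) (h : ∀ᶠ i in l, b i ≤ a i) :
    BddAboveAlong l b := by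
  obtain ⟨M, hM⟩ := ha
  exact ⟨M, (hM.and h).mono fun i hi => hi.2.trans hi.1⟩

theorem BddAboveAlong.const (M : ℝ) : BddAboveAlong l (fun _ => M) :=
  ⟨M, Filter.Eventually.of_forall fun _ => le_rfl⟩

theorem BddAlong.neg {a : ι → ℝ} (ha : BddAlong l a) : BddAlong l (fun i => -a i) :=
  ⟨ha.2, by simpa using ha.1⟩

theorem BddAlong.add {a b : ι → ℝ} (ha : BddAlong l a) (hb : BddAlong l b) :
    BddAlong l (fun i => a i + b i) :=
  ⟨ha.1.add hb.1, (ha.2.add hb.2).mono (Filter.Eventually.of_forall fun i => by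
    simp only [neg_add]; exact le_rfl)⟩

theorem BddAlong.const_mul {a : ι → ℝ} (ha : BddAlong l a) (t : ℝ) :
    BddAlong l (fun i => t * a i) := by
  rcases le_total 0 t with ht | ht
  · exact ⟨ha.1.const_mul ht, by simpa using ha.2.const_mul ht⟩
  · have ht' : 0 ≤ -t := by linarith
    exact ⟨by simpa using ha.2.const_mul ht', by simpa using ha.1.const_mul ht'⟩

theorem BddAlong.congr {a b : ι → ℝ} (ha : BddAlong l a) (h : ∀ᶠ i in l, b i = a i) :
    BddAlong l b :=
  ⟨ha.1.mono (h.mono fun _ hi => hi.le), ha.2.mono (h.mono fun _ hi => by rw [hi])⟩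

theorem BddAlong.const (M : ℝ) : BddAlong l (fun _ => M) := ⟨.const _, .const _⟩

/-- A net of functions of the first variable that is affine in the second. -/
structure AffineNet (ι : Type*) (d : ℕ) where
  toFun : ι → Eucl d → Eucl d → ℝ
  map_combo : ∀ i x p q r t, toFun i x (p + t • (q - r)) =
    toFun i x p + t * (toFun i x q - toFun i x r)

variable (l) in
/-- The compatibility of potentials `f i x` and `b i` with contact on `Γ` for the cost `c`. -/
def AffineNet.Compatible (f : AffineNet ι d) (Γ : Set (Eucl d × Eucl d))
    (c : Eucl d × Eucl d → ℝ) (b : ι → Eucl d → ℝ) : Prop :=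
  ∀ p ∈ Γ, (∀ᶠ i in l, b i p.2 = f.toFun i p.1 p.2 + c p) ∧
    ∀ x ∈ projX Γ, ∀ᶠ i in l, b i p.2 ≤ f.toFun i x p.2 + c (x, p.2)

namespace AffineNet

variable (f : AffineNet ι d) {Γ : Set (Eucl d × Eucl d)} {c : Eucl d × Eucl d → ℝ}
  {b : ι → Eucl d → ℝ}

theorem convex_bddAboveAlong (x x' : Eucl d) :
    Convex ℝ {p | BddAboveAlong l (fun i => f.toFun i x p - f.toFun i x' p)} := by
  intro p hp q hq s t hs ht hst
  obtain rfl : s = 1 - t := by linarith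
  have e : (1 - t) • p + t • q = p + t • (q - p) := by match_scalars <;> ring
  refine ((BddAboveAlong.const_mul hp hs).add (BddAboveAlong.const_mul hq ht)).mono
    (Filter.Eventually.of_forall fun i => le_of_eq ?_)
  rw [e, f.map_combo, f.map_combo]
  ring

variable (l) in
/-- A set of base points whose potentials differ by bounded amounts on the convex hull of the
relative interiors attached to them, this hull being relatively open. -/
def Good (Γ : Set (Eucl d × Eucl d)) (Z : Set (Eucl d)) : Prop :=
  Z ⊆ projX Γ ∧ Prolongable (convexHull ℝ (⋃ z ∈ Z, IC (fiber Γ z))) ∧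
    ∀ x ∈ Z, ∀ x' ∈ Z, ∀ p ∈ convexHull ℝ (⋃ z ∈ Z, IC (fiber Γ z)),
      BddAlong l (fun i => f.toFun i x p - f.toFun i x' p)

variable {f}

theorem bddAboveAlong_of_mem_IC (hf : f.Compatible l Γ c b) {z x' p : Eucl d}
    (hx' : x' ∈ projX Γ) (hp : p ∈ IC (fiber Γ z)) :
    BddAboveAlong l (fun i => f.toFun i z p - f.toFun i x' p) := by
  refine convexHull_min (s := fiber Γ z) ?_ (f.convex_bddAboveAlong z x')
    (IC_subset_convexHull _ hp)
  intro y hy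
  obtain ⟨h1, h2⟩ := hf (z, y) hy
  refine ⟨c (x', y) - c (z, y), ?_⟩
  filter_upwards [h1, h2 x' hx'] with i hi1 hi2
  change b i y = f.toFun i z y + c (z, y) at hi1
  change b i y ≤ f.toFun i x' y + c (x', y) at hi2
  linarith

theorem good_singleton {x : Eucl d} (hx : x ∈ projX Γ) : f.Good l Γ {x} := by
  refine ⟨by simpa using hx, ?_, ?_⟩
  · simpa [(convex_IC _).convexHull_eq] using prolongable_IC _
  · rintro _ rfl _ rfl p -
    simpa using BddAlong.const 0

theorem Good.bddAboveAlong {Z : Set (Eucl d)} (hZ : f.Good l Γ Z) (hf : f.Compatible l Γ c b)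
    {x x' p : Eucl d} (hx : x ∈ Z) (hx' : x' ∈ projX Γ)
    (hp : p ∈ convexHull ℝ (⋃ z ∈ Z, IC (fiber Γ z))) :
    BddAboveAlong l (fun i => f.toFun i x p - f.toFun i x' p) := by
  refine convexHull_min ?_ (f.convex_bddAboveAlong x x') hp
  refine iUnion₂_subset fun z hz q hq => ?_
  have h1 := (hZ.2.2 x hx z hz q (subset_convexHull ℝ _ (mem_biUnion hz hq))).1
  have h2 := bddAboveAlong_of_mem_IC hf hx' hq
  simpa using h1.add h2

theorem Good.bddAlong_of_bddAlong {Z : Set (Eucl d)} (hZ : f.Good l Γ Z)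
    (hf : f.Compatible l Γ c b) {x x' p q : Eucl d} (hx : x ∈ Z) (hx' : x' ∈ projX Γ)
    (hp : p ∈ convexHull ℝ (⋃ z ∈ Z, IC (fiber Γ z)))
    (hq : q ∈ convexHull ℝ (⋃ z ∈ Z, IC (fiber Γ z)))
    (h : BddAlong l (fun i => f.toFun i x q - f.toFun i x' q)) :
    BddAlong l (fun i => f.toFun i x p - f.toFun i x' p) := by
  refine ⟨hZ.bddAboveAlong hf hx hx' hp, ?_⟩
  obtain ⟨ε, hε, hr⟩ := hZ.2.1 q hq p hp
  have h3 := hZ.bddAboveAlong hf hx hx' hr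
  have e : q + ε • (q - p) = q + (-ε) • (p - q) := by match_scalars <;> ring
  refine ((h3.add (h.2.const_mul (t := 1 + ε) (by positivity))).const_mul
    (t := ε⁻¹) (by positivity)).mono (Filter.Eventually.of_forall fun i => le_of_eq ?_)
  rw [e, f.map_combo, f.map_combo]
  field_simp
  ring

theorem Good.union {Z Z' : Set (Eucl d)} (hZ : f.Good l Γ Z) (hZ' : f.Good l Γ Z')
    (hf : f.Compatible l Γ c b) (h : (convexHull ℝ (⋃ z ∈ Z, IC (fiber Γ z)) ∩
      convexHull ℝ (⋃ z ∈ Z', IC (fiber Γ z))).Nonempty) : f.Good l Γ (Z ∪ Z') := by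
  set D := convexHull ℝ (⋃ z ∈ Z, IC (fiber Γ z)) with hD
  set D' := convexHull ℝ (⋃ z ∈ Z', IC (fiber Γ z)) with hD'
  have hU : convexHull ℝ (⋃ z ∈ Z ∪ Z', IC (fiber Γ z)) = convexHull ℝ (D ∪ D') := by
    rw [biUnion_union, hD, hD', convexHull_convexHull_union_left,
      convexHull_convexHull_union_right]
  have hne : ∀ {W : Set (Eucl d)}, (convexHull ℝ (⋃ z ∈ W, IC (fiber Γ z))).Nonempty →
      W.Nonempty := by
    intro W hW
    obtain ⟨p, hp⟩ := convexHull_nonempty_iff.1 hW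
    simp only [mem_iUnion] at hp
    obtain ⟨z, hz, -⟩ := hp
    exact ⟨z, hz⟩
  obtain ⟨q, hqD, hqD'⟩ := h
  obtain ⟨z₀, hz₀⟩ := hne ⟨q, hqD⟩
  obtain ⟨z₁, hz₁⟩ := hne ⟨q, hqD'⟩
  have hcross : ∀ x ∈ Z, ∀ x' ∈ Z', ∀ p ∈ D ∪ D',
      BddAlong l (fun i => f.toFun i x p - f.toFun i x' p) := by
    intro x hx x' hx' p hp
    have hq : BddAlong l (fun i => f.toFun i x q - f.toFun i x' q) :=
      ⟨hZ.bddAboveAlong hf hx (hZ'.1 hx') hqD, by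
        simpa using hZ'.bddAboveAlong hf hx' (hZ.1 hx) hqD'⟩
    rcases hp with hp | hp
    · exact hZ.bddAlong_of_bddAlong hf hx (hZ'.1 hx') hp hqD hq
    · simpa using (hZ'.bddAlong_of_bddAlong hf hx' (hZ.1 hx) hp hqD' (by simpa using hq.neg)).neg
  have hall : ∀ x ∈ Z ∪ Z', ∀ x' ∈ Z ∪ Z', ∀ p ∈ D ∪ D',
      BddAlong l (fun i => f.toFun i x p - f.toFun i x' p) := by
    rintro x (hx | hx) x' (hx' | hx') p hp
    · simpa using (hcross x hx z₁ hz₁ p hp).add (hcross x' hx' z₁ hz₁ p hp).neg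
    · exact hcross x hx x' hx' p hp
    · simpa using (hcross x' hx' x hx p hp).neg
    · simpa using (hcross z₀ hz₀ x hx p hp).neg.add (hcross z₀ hz₀ x' hx' p hp)
  refine ⟨union_subset hZ.1 hZ'.1, ?_, fun x hx x' hx' p hp => ?_⟩
  · rw [hU]
    exact hZ.2.1.convexHull_union hZ'.2.1 ⟨q, hqD, hqD'⟩
  · rw [hU] at hp
    refine ⟨convexHull_min (fun q hq => (hall x hx x' hx' q hq).1)
      (f.convex_bddAboveAlong x x') hp, ?_⟩
    have h : BddAboveAlong l (fun i => f.toFun i x' p - f.toFun i x p) :=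
      convexHull_min (fun q hq => (hall x' hx' x hx q hq).1) (f.convex_bddAboveAlong x' x) hp
    exact h.mono (Filter.Eventually.of_forall fun i => (neg_sub _ _).le)

/-- The potentials of base points in the same component of an irreducible paving differ by bounded
amounts on this component. -/
theorem bddAlong_of_mem (hf : f.Compatible l Γ c b)
    (hΓ : ∀ x ∈ projX Γ, x ∈ IC (fiber Γ x)) {Φ : Set (Set (Eucl d))}
    (hΦ : IsIrreducibleConvexPaving Γ Φ) {C : Set (Eucl d)} (hC : C ∈ Φ) {x x' p : Eucl d}
    (hx : x ∈ projX Γ) (hxC : x ∈ C) (hx' : x' ∈ projX Γ) (hxC' : x' ∈ C) (hp : p ∈ C) :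
    BddAlong l (fun i => f.toFun i x p - f.toFun i x' p) := by
  have hself : ∀ {Z : Set (Eucl d)}, f.Good l Γ Z → ∀ {z}, z ∈ Z →
      z ∈ convexHull ℝ (⋃ z ∈ Z, IC (fiber Γ z)) := fun {Z} hZ {z} hz =>
    subset_convexHull ℝ _ (mem_biUnion hz (hΓ z (hZ.1 hz)))
  let P : Eucl d → Set (Eucl d) := fun x =>
    ⋃ Z ∈ {Z | f.Good l Γ Z ∧ x ∈ Z}, convexHull ℝ (⋃ z ∈ Z, IC (fiber Γ z))
  have hPmem : ∀ {x p}, p ∈ P x ↔ ∃ Z, (f.Good l Γ Z ∧ x ∈ Z) ∧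
      p ∈ convexHull ℝ (⋃ z ∈ Z, IC (fiber Γ z)) := by
    intro x p; simp [P]
  have hun : ∀ {x Z Z'}, f.Good l Γ Z → x ∈ Z → f.Good l Γ Z' → x ∈ Z' →
      f.Good l Γ (Z ∪ Z') := fun h h1 h' h1' => h.union h' hf ⟨_, hself h h1, hself h' h1'⟩
  have hmono : ∀ {Z Z' : Set (Eucl d)}, Z ⊆ Z' → convexHull ℝ (⋃ z ∈ Z, IC (fiber Γ z)) ⊆
      convexHull ℝ (⋃ z ∈ Z', IC (fiber Γ z)) := fun h =>
    convexHull_mono (biUnion_subset_biUnion_left h)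
  have hsub : ∀ {x y p}, p ∈ P x → p ∈ P y → P x ⊆ P y := by
    intro x y p hpx hpy q hq
    obtain ⟨Z, ⟨hZ, hxZ⟩, hpZ⟩ := hPmem.1 hpx
    obtain ⟨Z', ⟨hZ', hyZ⟩, hpZ'⟩ := hPmem.1 hpy
    obtain ⟨W, ⟨hW, hxW⟩, hqW⟩ := hPmem.1 hq
    have h1 := hZ.union hZ' hf ⟨p, hpZ, hpZ'⟩
    have h2 := hun h1 (Or.inl hxZ) hW hxW
    exact hPmem.2 ⟨_, ⟨h2, Or.inl (Or.inr hyZ)⟩, hmono subset_union_right hqW⟩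
  have hIC : ∀ x ∈ projX Γ, IC (fiber Γ x) ⊆ P x := fun x hx q hq =>
    hPmem.2 ⟨{x}, ⟨good_singleton hx, rfl⟩, subset_convexHull ℝ _ (by simpa using hq)⟩
  have key := hΦ.subset_of_partition hΓ (P := P) (fun x hx q hq r hr s t hs ht hst => by
      obtain ⟨Z, ⟨hZ, hxZ⟩, hqZ⟩ := hPmem.1 hq
      obtain ⟨Z', ⟨hZ', hxZ'⟩, hrZ'⟩ := hPmem.1 hr
      exact hPmem.2 ⟨Z ∪ Z', ⟨hun hZ hxZ hZ' hxZ', Or.inl hxZ⟩, convex_convexHull ℝ _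
        (hmono subset_union_left hqZ) (hmono subset_union_right hrZ') hs ht hst⟩)
    hIC (fun x hx y hy ⟨p, h1, h2⟩ => (hsub h1 h2).antisymm (hsub h2 h1)) hC hx hxC
  obtain ⟨Z, ⟨hZ, hxZ⟩, hpZ⟩ := hPmem.1 (key hp)
  obtain ⟨Z', ⟨hZ', hxZ'⟩, hx'Z'⟩ := hPmem.1 (key hxC')
  have h1 := hun hZ hxZ hZ' hxZ'
  have h2 := h1.union (good_singleton hx') hf ⟨x', hmono subset_union_right hx'Z',
    hself (good_singleton hx') rfl⟩
  exact h2.2.2 x (Or.inl (Or.inl hxZ)) x' (Or.inr rfl) p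
    (hmono (subset_union_left.trans subset_union_left) hpZ)

end AffineNet

theorem BddAlong.exists_tendsto {a : ι → ℝ} (ha : BddAlong l a) {U : Ultrafilter ι}
    (hU : (U : Filter ι) ≤ l) : ∃ L, Filter.Tendsto a U (nhds L) := by
  obtain ⟨⟨M, hM⟩, M', hM'⟩ := ha
  have h : ∀ᶠ i in (U : Filter ι), a i ∈ Icc (-M') M :=
    hU ((hM.and hM').mono fun i hi => ⟨by linarith [hi.2], hi.1⟩)
  obtain ⟨L, -, hL⟩ := isCompact_Icc.ultrafilter_le_nhds (U.map a)
    (Filter.le_principal_iff.2 h)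
  exact ⟨L, hL⟩

end BoundedPotentials

/-- On the components of the irreducible paving of a finitely exposable set, potentials exist. -/
theorem exists_potentials_of_finitelyExposable {c : Eucl d × Eucl d → ℝ}
    {Γ : Set (Eucl d × Eucl d)} (hΓ : ∀ x ∈ projX Γ, x ∈ IC (fiber Γ x))
    (hexp : FinitelyExposable .minimize c Γ) {Φ : Set (Set (Eucl d))}
    (hΦ : IsIrreducibleConvexPaving Γ Φ) {C : Set (Eucl d)} (hC : C ∈ Φ) :
    ∃ (α : Eucl d → ℝ) (γ : Eucl d → Eucl d) (β : Eucl d → ℝ),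
      (∀ x ∈ projX (restr Γ C), ∀ y ∈ projY (restr Γ C),
        β y - α x - inner ℝ (γ x) (y - x) ≤ c (x, y)) ∧
      ∀ x y, (x, y) ∈ restr Γ C → β y - α x - inner ℝ (γ x) (y - x) = c (x, y) := by
  classical
  have hT : ∀ H : Finset Γ, ∃ (α : Eucl d → ℝ) (γ : Eucl d → Eucl d) (β : Eucl d → ℝ),
      H.Nonempty → (∀ p ∈ H, ∀ q ∈ H, β q.1.2 - α p.1.1 - inner ℝ (γ p.1.1) (q.1.2 - p.1.1) ≤
        c (p.1.1, q.1.2)) ∧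
      ∀ p ∈ H, β p.1.2 - α p.1.1 - inner ℝ (γ p.1.1) (p.1.2 - p.1.1) = c p.1 := by
    intro H
    by_cases hH : H.Nonempty
    · obtain ⟨-, α, γ, β, hadm, heq⟩ := hexp (Subtype.val '' (H : Set Γ))
        (by rintro _ ⟨p, -, rfl⟩; exact p.2) (H.finite_toSet.image _)
        ((Finset.coe_nonempty.2 hH).image _)
      refine ⟨α, γ, β, fun _ => ⟨fun p hp q hq => ?_, fun p hp => ?_⟩⟩
      · exact hadm.ineq _ ⟨_, ⟨p, hp, rfl⟩, rfl⟩ _ ⟨_, ⟨q, hq, rfl⟩, rfl⟩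
      · exact heq _ _ ⟨p, hp, rfl⟩
    · exact ⟨0, 0, 0, fun h => absurd h hH⟩
  choose α γ β hT using hT
  let f : AffineNet (Finset Γ) d :=
    { toFun := fun H x p => α H x + inner ℝ (γ H x) (p - x)
      map_combo := fun H x p q r t => by
        have e : p + t • (q - r) - x = (p - x) + t • ((q - x) - (r - x)) := by
          match_scalars <;> ring
        rw [e]
        simp only [inner_add_right, inner_smul_right, inner_sub_right]
        ring }
  have hf : f.Compatible Filter.atTop Γ c β := by
    intro p hp
    constructor
    · filter_upwards [Filter.eventually_ge_atTop {(⟨p, hp⟩ : Γ)}] with H hH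
      have hpH : (⟨p, hp⟩ : Γ) ∈ H := Finset.singleton_subset_iff.1 hH
      have := (hT H ⟨_, hpH⟩).2 _ hpH
      simp only [f]
      linarith
    · rintro _ ⟨q, hq, rfl⟩
      filter_upwards [Filter.eventually_ge_atTop {(⟨p, hp⟩ : Γ)},
        Filter.eventually_ge_atTop {(⟨q, hq⟩ : Γ)}] with H hH hH'
      have hpH : (⟨p, hp⟩ : Γ) ∈ H := Finset.singleton_subset_iff.1 hH
      have hqH : (⟨q, hq⟩ : Γ) ∈ H := Finset.singleton_subset_iff.1 hH'
      have := (hT H ⟨_, hpH⟩).1 _ hqH _ hpH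
      simp only [f] at this ⊢
      linarith
  obtain ⟨x₀, hx₀, hx₀C⟩ := hΦ.1.meets C hC
  set V := affineSpan ℝ C
  have hCV : C ⊆ V := subset_affineSpan ℝ C
  have hbdd : ∀ x ∈ projX Γ ∩ C, ∀ p ∈ V,
      BddAlong Filter.atTop (fun H => f.toFun H x p - f.toFun H x₀ p) := by
    intro x hx p hp
    refine affineSpan_induction (p := fun p => BddAlong Filter.atTop
      (fun H => f.toFun H x p - f.toFun H x₀ p)) hp
      (fun p hp => AffineNet.bddAlong_of_mem hf hΓ hΦ hC hx.1 hx.2 hx₀ hx₀C hp) ?_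
    · intro t u v w hu hv hw
      refine (hw.add ((hu.add hv.neg).const_mul t)).congr (Filter.Eventually.of_forall fun H => ?_)
      rw [vsub_eq_sub, vadd_eq_add, add_comm, f.map_combo, f.map_combo]
      ring
  obtain ⟨U, hU⟩ := Ultrafilter.exists_le (Filter.atTop : Filter (Finset Γ))
  have hlim : ∀ x p, ∃ L, x ∈ projX Γ ∩ C → p ∈ V →
      Filter.Tendsto (fun H => f.toFun H x p - f.toFun H x₀ p) U (nhds L) := by
    intro x p
    by_cases h : x ∈ projX Γ ∩ C ∧ p ∈ V
    · obtain ⟨L, hL⟩ := (hbdd x h.1 p h.2).exists_tendsto hU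
      exact ⟨L, fun _ _ => hL⟩
    · exact ⟨0, fun h1 h2 => absurd ⟨h1, h2⟩ h⟩
  choose L hL using hlim
  have hLaff : ∀ x ∈ projX Γ ∩ C, ∀ p ∈ V, ∀ q ∈ V, ∀ r ∈ V, ∀ t : ℝ,
      L x (p + t • (q - r)) = L x p + t * (L x q - L x r) := by
    intro x hx p hp q hq r hr t
    refine tendsto_nhds_unique (hL x _ hx (add_smul_sub_mem_affineSpan hp hq hr t))
      (((hL x p hx hp).add (((hL x q hx hq).sub (hL x r hx hr)).const_mul t)).congr fun H => ?_)
    rw [f.map_combo, f.map_combo]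
    ring
  have hgrad : ∀ x, ∃ g : Eucl d, x ∈ projX Γ ∩ C → ∀ p ∈ V,
      L x p = L x x + inner ℝ g (p - x) := by
    intro x
    by_cases hx : x ∈ projX Γ ∩ C
    · have hxV := hCV hx.2
      let P := V.direction.starProjection
      have hPmem : ∀ z, x + P z ∈ V := fun z => by
        have := AffineSubspace.vadd_mem_of_mem_direction
          (V.direction.starProjection_apply_mem z) hxV
        rwa [vadd_eq_add, add_comm] at this
      let φ : Eucl d →ₗ[ℝ] ℝ :=
        { toFun := fun v => L x (x + P v) - L x x
          map_add' := fun v w => by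
            have e : x + P (v + w) = (x + P v) + (1 : ℝ) • ((x + P w) - x) := by
              rw [map_add]; match_scalars <;> ring
            rw [e, hLaff x hx _ (hPmem v) _ (hPmem w) _ hxV]
            ring
          map_smul' := fun t v => by
            have e : x + P (t • v) = x + t • ((x + P v) - x) := by
              rw [map_smul]; match_scalars <;> ring
            rw [e, hLaff x hx _ hxV _ (hPmem v) _ hxV]
            simp }
      refine ⟨(InnerProductSpace.toDual ℝ (Eucl d)).symm φ.toContinuousLinearMap, fun _ p hp => ?_⟩
      rw [InnerProductSpace.toDual_symm_apply]
      have hPp : P (p - x) = p - x := Submodule.starProjection_eq_self_iff.2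
        (AffineSubspace.vsub_mem_direction hp hxV)
      change L x p = L x x + (L x (x + P (p - x)) - L x x)
      rw [hPp]
      simp
    · exact ⟨0, fun h => absurd h hx⟩
  choose g hg using hgrad
  have hX : ∀ {x}, x ∈ projX (restr Γ C) → x ∈ projX Γ ∩ C := by
    rintro _ ⟨p, hp, rfl⟩
    exact ⟨⟨p, hp.1, rfl⟩, hp.2.1⟩
  have hfibV : ∀ p ∈ restr Γ C, p.2 ∈ V := fun p hp =>
    subset_affineSpan_of_IC_subset (hΓ p.1 ⟨p, hp.1, rfl⟩)
      (hΦ.1.IC_subset hΓ hC ⟨p, hp.1, rfl⟩ hp.2.1) (show p.2 ∈ fiber Γ p.1 from hp.1)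
  have hβ : ∀ p ∈ restr Γ C, Filter.Tendsto (fun H => β H p.2 - f.toFun H x₀ p.2) U
      (nhds (L p.1 p.2 + c p)) := by
    intro p hp
    refine ((hL p.1 p.2 (hX ⟨p, hp, rfl⟩) (hfibV p hp)).add_const (c p)).congr' ?_
    filter_upwards [hU (hf p hp.1).1] with H hH
    rw [hH]; ring
  have hβ' : ∀ y, ∃ B, y ∈ projY (restr Γ C) →
      Filter.Tendsto (fun H => β H y - f.toFun H x₀ y) U (nhds B) := by
    intro y
    by_cases hy : y ∈ projY (restr Γ C)
    · obtain ⟨p, hp, rfl⟩ := hy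
      exact ⟨_, fun _ => hβ p hp⟩
    · exact ⟨0, fun h => absurd h hy⟩
  choose B hB using hβ'
  refine ⟨fun x => L x x, g, B, ?_, ?_⟩
  · rintro x hx _ ⟨p, hp, rfl⟩
    have h1 := hg x (hX hx) p.2 (hfibV p hp)
    have h2 := hB p.2 ⟨p, hp, rfl⟩
    have h3 := hL x p.2 (hX hx) (hfibV p hp)
    have := le_of_tendsto_of_tendsto h2 (h3.add_const (c (x, p.2))) (by
      filter_upwards [hU ((hf p hp.1).2 x (hX hx).1)] with H hH
      linarith)
    linarith
  · intro x y hxy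
    have h1 := hg x (hX ⟨_, hxy, rfl⟩) y (hfibV _ hxy)
    have h2 := tendsto_nhds_unique (hB y ⟨_, hxy, rfl⟩) (hβ _ hxy)
    simp only at h2
    linarith

end MartingaleTransport

namespace MartingaleTransport

variable {d : ℕ}

theorem IsClosed.exists_mem_isCompact {X Y : Type*} [TopologicalSpace X] [TopologicalSpace Y]
    {S : Set (X × Y)} (hS : IsClosed S) {K : Set Y} (hK : IsCompact K) :
    IsClosed {x | ∃ y ∈ K, (x, y) ∈ S} := by
  have : CompactSpace K := isCompact_iff_compactSpace.1 hK
  have h1 : IsClosed ((fun p : X × K => (p.1, (p.2 : Y))) ⁻¹' S) := hS.preimage (by fun_prop)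
  have h2 := isClosedMap_fst_of_compactSpace _ h1
  convert h2 using 1
  ext x
  simp

/-- A closed convex valued multifunction that hits compact sets measurably has a measurable
selection. -/
theorem exists_measurable_selection_of_convex {Ω : Type*} [MeasurableSpace Ω]
    (G : Ω → Set (Eucl d)) (hcl : ∀ ω, IsClosed (G ω)) (hconv : ∀ ω, Convex ℝ (G ω))
    (hhit : ∀ K : Set (Eucl d), IsCompact K → MeasurableSet {ω | ∃ g ∈ K, g ∈ G ω}) :
    ∃ s : Ω → Eucl d, Measurable s ∧ ∀ ω, (G ω).Nonempty → s ω ∈ G ω := by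
  classical
  have hmin : ∀ ω, ∃ g, (G ω).Nonempty → g ∈ G ω ∧ ∀ g' ∈ G ω, ‖g‖ ≤ ‖g'‖ := by
    intro ω
    by_cases h : (G ω).Nonempty
    · obtain ⟨g, hg, hg'⟩ := (hcl ω).exists_infDist_eq_dist h 0
      refine ⟨g, fun _ => ⟨hg, fun g' hg'' => ?_⟩⟩
      have := Metric.infDist_le_dist_of_mem (x := 0) hg''
      rwa [hg', dist_zero_left, dist_zero_left] at this
    · exact ⟨0, fun h' => absurd h' h⟩
  choose m hm using hmin
  have huniq : ∀ ω, ∀ g ∈ G ω, ‖g‖ ≤ ‖m ω‖ → g = m ω := by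
    intro ω g hg hle
    obtain ⟨h1, h2⟩ := hm ω ⟨g, hg⟩
    have hmid := h2 _ (hconv ω hg h1 (a := 2⁻¹) (b := 2⁻¹) (by norm_num) (by norm_num)
      (by norm_num))
    rw [← smul_add, norm_smul] at hmid
    norm_num at hmid
    have hp := parallelogram_law_with_norm ℝ g (m ω)
    have h3 := norm_nonneg (m ω)
    have h4 := norm_nonneg g
    have : ‖g - m ω‖ * ‖g - m ω‖ ≤ 0 := by nlinarith
    have h0 : ‖g - m ω‖ = 0 := by nlinarith [norm_nonneg (g - m ω)]
    exact sub_eq_zero.1 (norm_eq_zero.1 h0)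
  have hdom : MeasurableSet {ω | (G ω).Nonempty} := by
    have : {ω | (G ω).Nonempty} = ⋃ n : ℕ, {ω | ∃ g ∈ Metric.closedBall (0 : Eucl d) n, g ∈ G ω} := by
      ext ω
      simp only [mem_ofPred_eq, mem_iUnion]
      constructor
      · rintro ⟨g, hg⟩
        obtain ⟨n, hn⟩ := exists_nat_ge ‖g‖
        exact ⟨n, g, by simpa using hn, hg⟩
      · rintro ⟨n, g, -, hg⟩
        exact ⟨g, hg⟩
    rw [this]
    exact MeasurableSet.iUnion fun n => hhit _ (isCompact_closedBall _ _)
  refine ⟨fun ω => if (G ω).Nonempty then m ω else 0, ?_, fun ω h => by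
    simpa [h] using (hm ω h).1⟩
  refine measurable_of_isClosed fun K hK => ?_
  have hset : {ω | (G ω).Nonempty} ∩ m ⁻¹' K = {ω | (G ω).Nonempty} ∩ ⋂ r : ℚ,
      ({ω | ∃ g ∈ Metric.closedBall (0 : Eucl d) r, g ∈ G ω}ᶜ ∪
        {ω | ∃ g ∈ Metric.closedBall (0 : Eucl d) r ∩ K, g ∈ G ω}) := by
    ext ω
    refine and_congr_right fun h => ?_
    obtain ⟨h1, h2⟩ := hm ω h
    simp only [mem_preimage, mem_iInter, mem_union, mem_compl_iff, mem_ofPred_eq]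
    constructor
    · intro hmK r
      by_cases hr : ∃ g ∈ Metric.closedBall (0 : Eucl d) r, g ∈ G ω
      · obtain ⟨g, hg, hgG⟩ := hr
        refine Or.inr ⟨m ω, ⟨?_, hmK⟩, h1⟩
        rw [mem_closedBall_zero_iff] at hg ⊢
        exact (h2 g hgG).trans hg
      · exact Or.inl hr
    · intro hall
      have hex : ∀ r : ℚ, ‖m ω‖ < r →
          ∃ g ∈ Metric.closedBall (0 : Eucl d) r ∩ K, g ∈ G ω := fun r hr =>
        (hall r).resolve_left fun h' => h' ⟨m ω, by simpa using hr.le, h1⟩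
      obtain ⟨r₀, hr₀⟩ := exists_rat_gt ‖m ω‖
      have hcomp : IsCompact (Metric.closedBall (0 : Eucl d) r₀ ∩ K ∩ G ω) :=
        ((isCompact_closedBall _ _).inter_right hK).inter_right (hcl ω)
      obtain ⟨g₀, hg₀, hg₀'⟩ := hex r₀ hr₀
      obtain ⟨g, ⟨⟨hgr, hgK⟩, hgG⟩, hgmin⟩ := hcomp.exists_isMinOn ⟨g₀, hg₀, hg₀'⟩
        continuous_norm.continuousOn
      rw [mem_closedBall_zero_iff] at hgr
      have : ‖g‖ ≤ ‖m ω‖ := by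
        by_contra hlt
        rw [not_le] at hlt
        obtain ⟨r, hr1, hr2⟩ := exists_rat_btwn hlt
        obtain ⟨g', ⟨hg'r, hg'K⟩, hg'G⟩ := hex r hr1
        rw [mem_closedBall_zero_iff] at hg'r
        have := hgmin ⟨⟨mem_closedBall_zero_iff.2 (by linarith), hg'K⟩, hg'G⟩
        simp only [mem_ofPred_eq] at this
        linarith
      rw [← huniq ω g hgG this]
      exact hgK
  have hsplit : (fun ω => if (G ω).Nonempty then m ω else 0) ⁻¹' K =
      ({ω | (G ω).Nonempty} ∩ m ⁻¹' K) ∪ ({ω | (G ω).Nonempty}ᶜ ∩ {_ω | (0 : Eucl d) ∈ K}) := by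
    ext ω
    by_cases h : (G ω).Nonempty <;> simp [h]
  rw [hsplit, hset]
  refine (hdom.inter (MeasurableSet.iInter fun r => ?_)).union
    (hdom.compl.inter (MeasurableSet.const _))
  exact (hhit _ (isCompact_closedBall _ _)).compl.union
    (hhit _ ((isCompact_closedBall _ _).inter_right hK))

theorem nonneg_of_forall_mem_fiber {A : Set (Eucl d)} {x v : Eucl d} {s : ℝ} (hx : x ∈ IC A)
    (h : ∀ y ∈ A, 0 ≤ s + inner ℝ v (y - x)) : 0 ≤ s ∧ (s = 0 → ∀ y ∈ A, inner ℝ v (y - x) = 0) := by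
  have hconv : convexHull ℝ A ⊆ {y | 0 ≤ s + inner ℝ v (y - x)} := by
    refine convexHull_min h ?_
    intro p hp q hq a b ha hb hab
    obtain rfl : a = 1 - b := by linarith
    have e : (1 - b) • p + b • q - x = (1 - b) • (p - x) + b • (q - x) := by
      match_scalars <;> ring
    simp only [mem_ofPred_eq] at hp hq ⊢
    rw [e, inner_add_right, inner_smul_right, inner_smul_right]
    nlinarith
  obtain ⟨hxA, hext⟩ := (Convex.mem_intrinsicInterior_iff (convex_convexHull ℝ A)).1 hx
  refine ⟨by simpa using hconv hxA, ?_⟩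
  rintro rfl y hy
  obtain ⟨ε, hε, hz⟩ := hext y (subset_convexHull ℝ A hy)
  have h1 := hconv hz
  have h2 := h y hy
  simp only [mem_ofPred_eq] at h1
  rw [zero_add, add_sub_cancel_left, inner_smul_right, ← neg_sub, inner_neg_right] at h1
  rw [zero_add] at h2
  nlinarith

/-- Pointwise potentials for a continuous cost can be chosen Borel measurable. -/
theorem isContactLayer_of_potentials {c : Eucl d × Eucl d → ℝ} (hc : Continuous c)
    {G : Set (Eucl d × Eucl d)} (hne : G.Nonempty) (hG : ∀ x ∈ projX G, x ∈ IC (fiber G x))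
    {α : Eucl d → ℝ} {γ : Eucl d → Eucl d} {β : Eucl d → ℝ}
    (hle : ∀ x ∈ projX G, ∀ y ∈ projY G, β y - α x - inner ℝ (γ x) (y - x) ≤ c (x, y))
    (heq : ∀ x y, (x, y) ∈ G → β y - α x - inner ℝ (γ x) (y - x) = c (x, y)) :
    IsContactLayer .minimize c G := by
  classical
  -- a Borel version of `β`
  obtain ⟨β', hβ'm, hβ'⟩ : ∃ β' : Eucl d → ℝ, Measurable β' ∧ ∀ y ∈ projY G, β' y = β y := by
    let b : Eucl d → EReal := fun y => ⨅ x ∈ projX G,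
      ((c (x, y) + α x + inner ℝ (γ x) (y - x) : ℝ) : EReal)
    have hb : UpperSemicontinuous b := upperSemicontinuous_biInf fun x _ =>
      (continuous_coe_real_ereal.comp (by fun_prop)).upperSemicontinuous
    refine ⟨fun y => (b y).toReal, hb.measurable.ereal_toReal, ?_⟩
    rintro _ ⟨p, hp, rfl⟩
    have : b p.2 = (β p.2 : EReal) := by
      refine le_antisymm ((iInf₂_le p.1 ⟨p, hp, rfl⟩).trans ?_) (le_iInf₂ fun x hx => ?_)
      · have := heq p.1 p.2 hp
        exact EReal.coe_le_coe_iff.2 (by linarith)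
      · have := hle x hx p.2 ⟨p, hp, rfl⟩
        exact EReal.coe_le_coe_iff.2 (by linarith)
    simp [this]
  -- a countable set of points carrying all the constraints
  obtain ⟨D, hDS, hDc, hDd⟩ := (TopologicalSpace.IsSeparable.of_separableSpace
    ((fun y => (y, β y)) '' projY G)).exists_countable_dense_subset
  have hSne : ((fun y => (y, β y)) '' projY G).Nonempty := (hne.image _).image _
  have hDne : D.Nonempty := by
    rw [← closure_nonempty_iff]; exact hSne.mono hDd
  obtain ⟨e, rfl⟩ := hDc.exists_eq_range hDne
  have he : ∀ n, (e n).1 ∈ projY G ∧ (e n).2 = β (e n).1 := by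
    intro n
    obtain ⟨y, hy, h⟩ := hDS ⟨n, rfl⟩
    rw [← h]
    exact ⟨hy, rfl⟩
  have hdense : ∀ (x g : Eucl d) (a : ℝ),
      (∀ n, (e n).2 - c (x, (e n).1) - inner ℝ g ((e n).1 - x) ≤ a) →
      ∀ y ∈ projY G, β y - c (x, y) - inner ℝ g (y - x) ≤ a := by
    intro x g a h y hy
    have hcl : IsClosed {p : Eucl d × ℝ | p.2 - c (x, p.1) - inner ℝ g (p.1 - x) ≤ a} :=
      isClosed_le (by fun_prop) continuous_const
    have hsub := closure_minimal (s := range e) (by rintro _ ⟨n, rfl⟩; exact h n) hcl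
    exact hsub (hDd ⟨y, hy, rfl⟩)
  let S : Set ((Eucl d × ℝ) × Eucl d) :=
    {q | ∀ n, (e n).2 - c (q.1.1, (e n).1) - inner ℝ q.2 ((e n).1 - q.1.1) ≤ q.1.2}
  have hS : IsClosed S := by
    simp only [S, ofPred_forall]
    exact isClosed_iInter fun n => isClosed_le (by fun_prop) (by fun_prop)
  have hSγ : ∀ x ∈ projX G, ((x, α x), γ x) ∈ S := fun x hx n => by
    have := hle x hx _ (he n).1
    rw [← (he n).2] at this
    simp only
    linarith
  have hSmin : ∀ x ∈ projX G, ∀ a g, ((x, a), g) ∈ S → α x ≤ a := by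
    intro x hx a g hg
    have h1 := hdense x g a hg
    have := (nonneg_of_forall_mem_fiber (s := a - α x) (v := g - γ x) (hG x hx) fun y hy => ?_).1
    · linarith
    · have h2 := h1 y ⟨_, hy, rfl⟩
      have h3 := heq x y hy
      rw [inner_sub_left]
      linarith
  let T : ℕ → Set (Eucl d × ℝ) := fun R => {q | ∃ g ∈ Metric.closedBall (0 : Eucl d) R, (q, g) ∈ S}
  have hT : ∀ R, IsClosed (T R) := fun R =>
    IsClosed.exists_mem_isCompact hS (isCompact_closedBall _ _)
  -- a Borel version of `α`
  obtain ⟨α', hα'm, hα'⟩ : ∃ α' : Eucl d → ℝ, Measurable α' ∧ ∀ x ∈ projX G, α' x = α x := by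
    let a : Eucl d → EReal := fun x => ⨅ R : ℕ, ⨅ q : ℚ,
      if (x, (q : ℝ)) ∈ T R then ((q : ℝ) : EReal) else ⊤
    have ham : Measurable a := Measurable.iInf fun R => Measurable.iInf fun q =>
      Measurable.ite ((hT R).preimage (by fun_prop : Continuous fun x : Eucl d =>
        (x, (q : ℝ)))).measurableSet measurable_const measurable_const
    refine ⟨fun x => (a x).toReal, ham.ereal_toReal, fun x hx => ?_⟩
    have : a x = (α x : EReal) := by
      refine le_antisymm ?_ (le_iInf fun R => le_iInf fun q => ?_)
      · refine le_of_forall_gt_imp_ge_of_dense fun z hz => ?_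
        obtain ⟨q, hq1, hq2⟩ := EReal.lt_iff_exists_rat_btwn.1 hz
        have hq1 : α x < q := by exact_mod_cast hq1
        obtain ⟨R, hR⟩ := exists_nat_ge ‖γ x‖
        refine (iInf₂_le R q).trans ?_
        rw [if_pos]
        · exact_mod_cast hq2.le
        · exact ⟨γ x, by simpa using hR, fun n => (hSγ x hx n).trans hq1.le⟩
      · split_ifs with h
        · obtain ⟨g, -, hg⟩ := h
          exact EReal.coe_le_coe_iff.2 (hSmin x hx _ g hg)
        · exact le_top
    simp [this]
  -- a Borel version of `γ`
  obtain ⟨γ', hγ'm, hγ'⟩ := exists_measurable_selection_of_convex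
    (fun x => {g | ((x, α' x), g) ∈ S})
    (fun x => hS.preimage (by fun_prop)) (fun x g hg g' hg' s t hs ht hst n => by
      have h1 := hg n
      have h2 := hg' n
      obtain rfl : s = 1 - t := by linarith
      simp only [inner_add_left, inner_smul_left, conj_trivial] at h1 h2 ⊢
      nlinarith)
    (fun K hK => (IsClosed.exists_mem_isCompact hS hK).measurableSet.preimage
      (measurable_id.prodMk hα'm))
  have hγ'S : ∀ x ∈ projX G, ((x, α x), γ' x) ∈ S := fun x hx => by
    have := hγ' x ⟨γ x, by simpa [hα' x hx] using hSγ x hx⟩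
    simpa only [mem_ofPred_eq, hα' x hx] using this
  have hle' : ∀ x ∈ projX G, ∀ y ∈ projY G, β y - α x - inner ℝ (γ' x) (y - x) ≤ c (x, y) :=
    fun x hx y hy => by linarith [hdense x (γ' x) (α x) (hγ'S x hx) y hy]
  refine ⟨hne, α', γ', β', ⟨hα'm, hγ'm, hβ'm, fun x hx y hy => ?_⟩, fun x y hxy => ?_⟩
  · rw [hα' x hx, hβ' y hy]
    exact hle' x hx y hy
  · have hx : x ∈ projX G := ⟨_, hxy, rfl⟩
    rw [hα' x hx, hβ' y ⟨_, hxy, rfl⟩]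
    have := (nonneg_of_forall_mem_fiber (s := 0) (v := γ' x - γ x) (hG x hx) fun z hz => ?_).2 rfl
      y hxy
    · rw [inner_sub_left] at this
      linarith [heq x y hxy]
    · have h2 := hle' x hx z ⟨_, hz, rfl⟩
      have h3 := heq x z hz
      rw [inner_sub_left]
      linarith

theorem fiber_restr {Γ : Set (Eucl d × Eucl d)} {C : Set (Eucl d)} {x : Eucl d} (hx : x ∈ C) :
    fiber (restr Γ C) x = fiber Γ x := by
  ext y
  simp [fiber, restr, hx]

theorem projX_restr (Γ : Set (Eucl d × Eucl d)) (C : Set (Eucl d)) :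
    projX (restr Γ C) = projX Γ ∩ C := by
  ext x
  constructor
  · rintro ⟨p, hp, rfl⟩
    exact ⟨⟨p, hp.1, rfl⟩, hp.2.1⟩
  · rintro ⟨⟨p, hp, rfl⟩, hx⟩
    exact ⟨p, ⟨hp, hx, trivial⟩, rfl⟩

/-- Finitely exposable sets decompose into contact layers along the irreducible paving. -/
theorem FinitelyExposable.isContactLayer_restr {g : Goal} {c : Eucl d × Eucl d → ℝ}
    (hc : Continuous c) {Γ : Set (Eucl d × Eucl d)} (hΓ : ∀ x ∈ projX Γ, x ∈ IC (fiber Γ x))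
    (hexp : FinitelyExposable g c Γ) {Φ : Set (Set (Eucl d))}
    (hΦ : IsIrreducibleConvexPaving Γ Φ) {C : Set (Eucl d)} (hC : C ∈ Φ) :
    IsContactLayer g c (restr Γ C) := by
  rw [finitelyExposable_cost_iff] at hexp
  rw [isContactLayer_cost_iff]
  obtain ⟨α, γ, β, hle, heq⟩ := exists_potentials_of_finitelyExposable hΓ hexp hΦ hC
  refine isContactLayer_of_potentials (g.continuous_cost hc) ?_ (fun x hx => ?_) hle heq
  · obtain ⟨_, ⟨p, hp, rfl⟩, hxC⟩ := hΦ.1.meets C hC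
    exact ⟨p, hp, hxC, trivial⟩
  · rw [projX_restr] at hx
    rw [fiber_restr hx.2]
    exact hΓ x hx.1

end MartingaleTransport

namespace MartingaleTransport

variable {d : ℕ}

/-- The marginals of a martingale plan with finite first moments are in convex order. -/
theorem convexOrder_of_mem_MT {μ ν : Measure (Eucl d)} {σ : Measure (Eucl d × Eucl d)}
    (hσ : σ ∈ MT μ ν) (hx : Integrable (fun p => p.1) σ) (hy : Integrable (fun p => p.2) σ) :
    ConvexOrder μ ν := by
  have hμ := isProbabilityMeasure_fst_of_mem_MT hσ
  obtain ⟨hσp, hfst, rfl, k, hk, rfl, hbar⟩ := hσ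
  have hx' : Integrable (fun x => x) μ := by
    rw [← hfst, Measure.fst, integrable_map_measure (by fun_prop) (by fun_prop)]
    exact hx
  have hy' : Integrable (fun y => y) (μ ⊗ₘ k).snd := by
    rw [Measure.snd, integrable_map_measure (by fun_prop) (by fun_prop)]
    exact hy
  refine ⟨hμ, inferInstance, hx', hy', fun φ hφ hφi => ?_⟩
  have hφc : Continuous φ := hφ.locallyLipschitz.continuous
  have hφ' : Integrable (fun p : Eucl d × Eucl d => φ p.2) (μ ⊗ₘ k) := by
    rw [Measure.snd, integrable_map_measure (by fun_prop) (by fun_prop)] at hφi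
    exact hφi
  have hk1 := ((Measure.integrable_compProd_iff hφ'.aestronglyMeasurable).1 hφ').1
  have hk2 : Integrable (fun x => ∫ y, φ y ∂(k x)) μ := hφ'.integral_compProd
  have hle : ∀ᵐ x ∂μ, φ x ≤ ∫ y, φ y ∂(k x) := by
    filter_upwards [hbar, hk1] with x h1 h2
    have := hφ.map_integral_le (μ := k x) (f := fun y => y) hφc.continuousOn isClosed_univ
      (Filter.Eventually.of_forall fun _ => mem_univ _) h1.1 h2
    rwa [h1.2] at this
  obtain ⟨l, c, hl, -⟩ := hφ.exists_affine_le_of_lt (𝕜 := ℝ) (mem_univ (0 : Eucl d))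
    (sub_one_lt (φ 0)) isClosed_univ (hφc.lowerSemicontinuous.lowerSemicontinuousOn _)
  have hl' : ∀ x, l x + c ≤ φ x := fun x => by simpa using hl ⟨x, mem_univ x⟩
  have hφμ : Integrable φ μ := integrable_of_le_of_le hφc.aestronglyMeasurable
    (Filter.Eventually.of_forall hl') hle ((l.integrable_comp hx').add (integrable_const c)) hk2
  refine ⟨hφμ, (integral_mono_ae hφμ hk2 hle).trans_eq ?_⟩
  rw [Measure.snd, integral_map (by fun_prop) hφc.aestronglyMeasurable,
    Measure.integral_compProd hφ']

theorem ae_mem_image_of_ae_mem {σ : Measure (Eucl d × Eucl d)} [IsFiniteMeasure σ]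
    {A : Set (Eucl d × Eucl d)} (hA : MeasurableSet A) (hσ : ∀ᵐ p ∂σ, p ∈ A) :
    ∀ᵐ y ∂σ.snd, y ∈ projY A := by
  rw [ae_iff]
  refine le_antisymm (le_of_forall_gt_imp_ge_of_dense fun ε hε => ?_) bot_le
  obtain ⟨K, hKA, hK, hlt⟩ := hA.exists_isCompact_sdiff_lt (measure_ne_top σ A) hε.ne'
  have h1 : {y | y ∉ projY A} ⊆ (Prod.snd '' K)ᶜ := fun y hy hyK => hy (image_mono hKA hyK)
  refine (measure_mono h1).trans ?_
  rw [Measure.snd_apply (hK.image continuous_snd).measurableSet.compl]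
  refine le_trans ?_ hlt.le
  refine measure_mono_ae ?_
  filter_upwards [hσ] with p hp hpK
  exact ⟨hp, fun h => hpK ⟨p, h, rfl⟩⟩

/-- A contact layer on which a martingale plan is concentrated yields a dual optimizer. -/
theorem dualityAttained_of_isContactLayer {g : Goal} {c : Eucl d × Eucl d → ℝ}
    {G : Set (Eucl d × Eucl d)} (hG : IsContactLayer g c G) {μ ν : Measure (Eucl d)}
    {σ : Measure (Eucl d × Eucl d)} (hσ : σ ∈ MT μ ν) (hσG : ∀ᵐ p ∂σ, p ∈ G)
    (hc : Integrable c σ) : DualityAttained g c (projX G) (projY G) σ := by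
  have hμ := isProbabilityMeasure_fst_of_mem_MT hσ
  obtain ⟨hσp, rfl, -, k, hk, hσk, hbar⟩ := hσ
  obtain ⟨-, α, γ, β, hadm, heq⟩ := hG
  have heq' : ∀ᵐ p ∂σ, β p.2 - α p.1 - inner ℝ (γ p.1) (p.2 - p.1) = c p :=
    hσG.mono fun p hp => heq p.1 p.2 hp
  rw [hσk] at hc heq'
  have hcx := ((Measure.integrable_compProd_iff hc.aestronglyMeasurable).1 hc).1
  have hkey : ∀ᵐ x ∂σ.fst, Integrable β (k x) ∧
      ∫ y, β y ∂(k x) - α x = ∫ y, c (x, y) ∂(k x) := by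
    filter_upwards [hcx, hbar, Measure.ae_ae_of_ae_compProd heq'] with x h1 h2 h3
    have hin : Integrable (fun y => inner ℝ (γ x) (y - x)) (k x) :=
      (h2.1.sub (integrable_const x)).const_inner (γ x)
    have hin0 : ∫ y, inner ℝ (γ x) (y - x) ∂(k x) = 0 := by
      have := integral_inner (𝕜 := ℝ) (h2.1.sub (integrable_const x)) (γ x)
      simp only [Pi.sub_apply] at this
      rw [this, integral_sub h2.1 (integrable_const x),
        h2.2]
      simp
    have hβ : β =ᵐ[k x] fun y => c (x, y) + α x + inner ℝ (γ x) (y - x) := by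
      filter_upwards [h3] with y hy
      linarith
    refine ⟨((h1.add (integrable_const _)).add hin).congr hβ.symm, ?_⟩
    rw [integral_congr_ae hβ, integral_add (f := fun y => c (x, y) + α x)
      (h1.add (integrable_const _)) hin, hin0, integral_add h1 (integrable_const _)]
    simp
  refine ⟨α, γ, β, hadm, by rw [hσk]; exact heq', k, hk, hσk, hkey.mono fun x hx => hx.1, ?_, ?_⟩
  · exact hc.integral_compProd.congr (hkey.mono fun x hx => hx.2.symm)
  · conv_rhs => rw [hσk]
    rw [Measure.integral_compProd hc]
    exact integral_congr_ae (hkey.mono fun x hx => hx.2)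

namespace ClosedConvex

theorem measurable_infDist (x : Eucl d) :
    Measurable fun K : ClosedConvex d => Metric.infDist x K.carrier :=
  measurable_iff_comap_le.2 (le_iSup (fun x : Eucl d => MeasurableSpace.comap
    (fun K : ClosedConvex d => Metric.infDist x K.carrier) inferInstance) x)

/-- The distance functions from a dense sequence of points determine a closed convex set. -/
theorem exists_measurable_injective :
    ∃ θ : ClosedConvex d → ℕ → ℝ, Measurable θ ∧ Function.Injective θ := by
  refine ⟨fun K n => Metric.infDist (TopologicalSpace.denseSeq (Eucl d) n) K.carrier,
    measurable_pi_iff.2 fun n => measurable_infDist _, fun K L h => ?_⟩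
  have h1 : (fun x => Metric.infDist x K.carrier) = fun x => Metric.infDist x L.carrier := by
    refine (TopologicalSpace.denseRange_denseSeq (Eucl d)).equalizer
      (Metric.continuous_infDist_pt _) (Metric.continuous_infDist_pt _) ?_
    exact h
  have h2 : K.carrier = L.carrier := by
    ext x
    rw [K.isClosed.mem_iff_infDist_zero K.nonempty, L.isClosed.mem_iff_infDist_zero L.nonempty]
    rw [congrFun h1 x]
  cases K
  cases L
  congr

end ClosedConvex

variable {Γ : Set (Eucl d × Eucl d)} {Φ : Set (Set (Eucl d))}

/-- Disintegration of the first marginal of a plan along a convex paving with measurable closure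
map. -/
theorem IsConvexPaving.exists_disintegration (h : IsConvexPaving Γ Φ) (hΓ : MeasurableSet Γ)
    (hm : Measurable (closureMap h)) {μ : Measure (Eucl d)} [IsProbabilityMeasure μ]
    {k : Kernel (Eucl d) (Eucl d)} [IsMarkovKernel k] (hπΓ : ∀ᵐ p ∂(μ ⊗ₘ k), p ∈ Γ) :
    IsProbabilityMeasure (closureLaw h (μ ⊗ₘ k)) ∧
    ∃ κ : Kernel (ClosedConvex d) (Eucl d × Eucl d), IsMarkovKernel κ ∧
      κ ∘ₘ closureLaw h (μ ⊗ₘ k) = μ ⊗ₘ k ∧ (∀ K, κ K = (κ K).fst ⊗ₘ k) ∧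
      ∀ᵐ K ∂(closureLaw h (μ ⊗ₘ k)), ∃ C ∈ Φ, K.carrier = closure C ∧
        ∀ᵐ p ∂(κ K), p ∈ restr Γ C := by
  obtain ⟨p₀, hp₀⟩ := (hπΓ.exists)
  obtain ⟨Ξ, hΞ, hΞ'⟩ := (MeasurableEmbedding.subtype_coe hΓ).exists_measurable_extend hm
    (fun _ => ⟨closureMap h ⟨p₀, hp₀⟩⟩)
  have hΞΓ : ∀ p (hp : p ∈ Γ), Ξ p = closureMap h ⟨p, hp⟩ := fun p hp => congrFun hΞ' ⟨p, hp⟩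
  have hlaw : closureLaw h (μ ⊗ₘ k) = (μ ⊗ₘ k).map Ξ := by
    rw [closureLaw, ← hΞ', ← Measure.map_map hΞ measurable_subtype_coe, map_comap_subtype_coe hΓ,
      Measure.restrict_eq_self_of_ae_mem hπΓ]
  rw [hlaw]
  have hprob : IsProbabilityMeasure ((μ ⊗ₘ k).map Ξ) :=
    Measure.isProbabilityMeasure_map hΞ.aemeasurable
  refine ⟨hprob, ?_⟩
  set π := μ ⊗ₘ k with hπ
  set m := condDistrib (Prod.fst : Eucl d × Eucl d → Eucl d) Ξ π with hmdef
  have hmj : π.map Ξ ⊗ₘ m = π.map fun p => (Ξ p, p.1) :=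
    compProd_map_condDistrib measurable_fst.aemeasurable
  let κ : Kernel (ClosedConvex d) (Eucl d × Eucl d) := m ⊗ₖ Kernel.prodMkLeft _ k
  have hκ : ∀ K, κ K = m K ⊗ₘ k := fun K => by
    rw [Kernel.compProd_apply_eq_compProd_sectR, Kernel.sectR_prodMkLeft]
  refine ⟨κ, inferInstance, ?_, fun K => by rw [hκ, Measure.fst_compProd], ?_⟩
  · ext S hS
    rw [Measure.bind_apply hS κ.measurable.aemeasurable]
    have h1 : ∀ K, κ K S = ∫⁻ x, k x (Prod.mk x ⁻¹' S) ∂(m K) := fun K => by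
      rw [hκ, Measure.compProd_apply hS]
    have hkm : Measurable fun x => k x (Prod.mk x ⁻¹' S) := Kernel.measurable_kernel_prodMk_left hS
    simp_rw [h1]
    rw [← Measure.lintegral_compProd (f := fun q => k q.2 (Prod.mk q.2 ⁻¹' S))
      (hkm.comp measurable_snd), hmj, lintegral_map (f := fun q : ClosedConvex d × Eucl d => k q.2 (Prod.mk q.2 ⁻¹' S))
      (hkm.comp measurable_snd) (hΞ.prodMk measurable_fst)]
    have h2 : π.map Prod.fst = μ := by
      rw [← Measure.fst, hπ, Measure.fst_compProd]
    rw [hπ, Measure.compProd_apply hS]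
    conv_rhs => rw [← h2]
    rw [lintegral_map hkm measurable_fst]
  · obtain ⟨θ, hθ, hθi⟩ := ClosedConvex.exists_measurable_injective (d := d)
    let D : Set ((ClosedConvex d × Eucl d) × Eucl d) :=
      {q | (q.1.2, q.2) ∉ Γ ∨ θ (Ξ (q.1.2, q.2)) ≠ θ q.1.1}
    have hD : MeasurableSet D := by
      refine MeasurableSet.union ((measurable_fst.snd.prodMk measurable_snd) hΓ.compl) ?_
      exact (measurableSet_eq_fun (hθ.comp (hΞ.comp (measurable_fst.snd.prodMk measurable_snd)))
        (hθ.comp measurable_fst.fst)).compl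
    let B : Set (ClosedConvex d × Eucl d) := {q | k q.2 (Prod.mk q ⁻¹' D) = 0}
    have hB : MeasurableSet B := (Kernel.measurable_kernel_prodMk_left
      (κ := k.comap Prod.snd measurable_snd) hD) (measurableSet_singleton 0)
    have hae : ∀ᵐ q ∂(π.map Ξ ⊗ₘ m), q ∈ B := by
      rw [hmj, ae_map_iff (p := (· ∈ B)) (hΞ.prodMk measurable_fst).aemeasurable hB]
      have h3 : ∀ᵐ p ∂π, ∀ᵐ y ∂(k p.1), (p.1, y) ∈ Γ := by
        have := Measure.ae_ae_of_ae_compProd hπΓ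
        rw [← Measure.fst_compProd μ k] at this
        exact ae_of_ae_map measurable_fst.aemeasurable this
      filter_upwards [hπΓ, h3] with p hp hp'
      refine measure_eq_zero_iff_ae_notMem.2 ?_
      filter_upwards [hp'] with y hy hyD
      refine hyD.elim (fun h' => h' hy) fun h' => h' ?_
      change θ (Ξ (p.1, y)) = θ (Ξ p)
      rw [hΞΓ _ hy, hΞΓ _ hp]
      rfl
    filter_upwards [Measure.ae_ae_of_ae_compProd hae] with K hK
    have hKp : ∀ᵐ x ∂(m K), ∀ᵐ y ∂(k x), ∃ hp : (x, y) ∈ Γ, closureMap h ⟨(x, y), hp⟩ = K := by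
      filter_upwards [hK] with x hx
      have hx' : ∀ᵐ y ∂(k x), y ∉ Prod.mk (K, x) ⁻¹' D :=
        measure_eq_zero_iff_ae_notMem.1 hx
      filter_upwards [hx'] with y hy
      have h4 : (x, y) ∈ Γ := by
        by_contra h'
        exact hy (Or.inl h')
      refine ⟨h4, hθi ?_⟩
      by_contra h'
      exact hy (Or.inr (by rwa [← hΞΓ _ h4] at h'))
    obtain ⟨x₀, hx₀⟩ := hKp.exists
    obtain ⟨y₀, hy₀, hK₀⟩ := hx₀.exists
    have hC := h.component_mem ⟨_, hy₀, rfl⟩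
    refine ⟨component Φ x₀, hC.1, by rw [← hK₀]; rfl, ?_⟩
    rw [hκ]
    refine (Measure.ae_compProd_iff (hΓ.inter ((h.measurableSet hC.1).prod MeasurableSet.univ))).2 ?_
    filter_upwards [hKp] with x hx
    filter_upwards [hx] with y hy
    obtain ⟨hy, hyK⟩ := hy
    refine ⟨hy, ?_, trivial⟩
    have hC' := h.component_mem ⟨_, hy, rfl⟩
    have : component Φ x = component Φ x₀ := by
      refine h.eq_of_closure_eq hC'.1 hC.1 ?_
      exact congrArg ClosedConvex.carrier (hyK.trans hK₀.symm)
    rw [← this]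
    exact hC'.2

end MartingaleTransport

namespace MartingaleTransport

open Filter Topology

/-- A continuous injection of the Baire space into the real line. -/
theorem exists_continuous_injective_baire :
    ∃ t : (ℕ → ℕ) → ℝ, Continuous t ∧ Function.Injective t := by
  let b : (ℕ → ℕ) → ℕ → Bool := fun z m => decide (z m.unpair.1 = m.unpair.2)
  refine ⟨fun z => Cardinal.cantorFunction (1 / 3) (b z), ?_, ?_⟩
  · refine continuous_tsum (u := fun n => (1 / 3 : ℝ) ^ n) (fun n => ?_)
      (summable_geometric_of_lt_one (by norm_num) (by norm_num)) fun n z => ?_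
    · exact (continuous_of_discreteTopology (f := fun a : ℕ =>
        cond (decide (a = n.unpair.2)) ((1 / 3 : ℝ) ^ n) 0)).comp (continuous_apply n.unpair.1)
    · rw [Cardinal.cantorFunctionAux]
      cases b z n <;> simp
  · refine (Cardinal.cantorFunction_injective (by norm_num) (by norm_num)).comp fun z w h => ?_
    ext i
    have := congrFun h (Nat.pair i (z i))
    simp only [b, Nat.unpair_pair, decide_true] at this
    exact (of_decide_eq_true this.symm).symm

/-- A continuous map on a compact subset of the Baire space has a measurable right inverse. -/
theorem exists_measurable_rightInverse_baire {X : Type*} [TopologicalSpace X] [T2Space X]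
    [MeasurableSpace X] [BorelSpace X] {K : Set (ℕ → ℕ)} (hK : IsCompact K) {f : (ℕ → ℕ) → X}
    (hf : Continuous f) :
    ∃ s : X → ℕ → ℕ, Measurable s ∧ ∀ x ∈ f '' K, s x ∈ K ∧ f (s x) = x := by
  obtain ⟨t, ht, hti⟩ := exists_continuous_injective_baire
  obtain ⟨g, hg, hgt⟩ := (ht.measurableEmbedding hti).exists_measurable_extend
    (g := (id : (ℕ → ℕ) → ℕ → ℕ)) measurable_id (fun _ => inferInstance)
  let m : X → ℝ := fun x => sInf (t '' (K ∩ f ⁻¹' {x}))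
  have hmin : ∀ x ∈ f '' K, ∃ z ∈ K, f z = x ∧ t z = m x ∧ ∀ w ∈ K, f w = x → m x ≤ t w := by
    rintro x ⟨z₀, hz₀, hx⟩
    have hc : IsCompact (K ∩ f ⁻¹' {x}) := hK.inter_right (isClosed_singleton.preimage hf)
    obtain ⟨z, hz, hzm⟩ := (hc.image ht).sInf_mem ⟨_, z₀, ⟨hz₀, hx⟩, rfl⟩
    exact ⟨z, hz.1, hz.2, hzm, fun w hw hwx =>
      csInf_le (hc.image ht).bddBelow ⟨w, ⟨hw, hwx⟩, rfl⟩⟩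
  have hm : Measurable m := by
    refine measurable_of_Iic fun a => ?_
    have : m ⁻¹' Iic a = f '' (K ∩ t ⁻¹' Iic a) ∪ ((f '' K)ᶜ ∩ {_x | (0 : ℝ) ≤ a}) := by
      ext x
      by_cases hx : x ∈ f '' K
      · obtain ⟨z, hz, hzx, hzm, hle⟩ := hmin x hx
        simp only [mem_preimage, mem_Iic, mem_union, mem_inter_iff, mem_compl_iff, hx,
          not_true_eq_false, false_and, or_false]
        constructor
        · exact fun h => ⟨z, ⟨hz, by simpa [hzm] using h⟩, hzx⟩
        · rintro ⟨w, ⟨hw, hwa⟩, hwx⟩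
          exact (hle w hw hwx).trans hwa
      · have h1 : K ∩ f ⁻¹' {x} = ∅ := by
          ext z
          simp only [mem_inter_iff, mem_preimage, mem_singleton_iff, mem_empty_iff_false, iff_false,
            not_and]
          exact fun hz hzx => hx ⟨z, hz, hzx⟩
        have h2 : x ∉ f '' (K ∩ t ⁻¹' Iic a) := fun h => hx (image_mono inter_subset_left h)
        simp [m, h1, h2, hx]
    rw [this]
    exact ((hK.inter_right (isClosed_Iic.preimage ht)).image hf).measurableSet.union
      ((hK.image hf).measurableSet.compl.inter (MeasurableSet.const _))
  refine ⟨g ∘ m, hg.comp hm, fun x hx => ?_⟩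
  obtain ⟨z, hz, hzx, hzm, -⟩ := hmin x hx
  have : (g ∘ m) x = z := by
    rw [Function.comp_apply, ← hzm]
    exact congrFun hgt z
  rw [this]
  exact ⟨hz, hzx⟩

/-- A continuous image of the Baire space of positive measure contains the image of a compact set
of positive measure. -/
theorem exists_isCompact_image_pos {X : Type*} [TopologicalSpace X] [T2Space X]
    [MeasurableSpace X] [BorelSpace X] (l : Measure X) [IsFiniteMeasure l] [l.OuterRegular]
    {f : (ℕ → ℕ) → X} (hf : Continuous f) (hpos : l (range f) ≠ 0) :
    ∃ K : Set (ℕ → ℕ), IsCompact K ∧ l (f '' K) ≠ 0 := by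
  obtain ⟨r, hr0, hr⟩ := exists_between (pos_iff_ne_zero.2 hpos)
  let C : (ℕ → ℕ) → ℕ → Set (ℕ → ℕ) := fun n k => {z | ∀ i < k, z i ≤ n i}
  have hstep : ∀ k n, r < l (f '' C n k) → ∃ a, r < l (f '' C (Function.update n k a) (k + 1)) := by
    intro k n h
    have hmono : Monotone fun a => f '' C (Function.update n k a) (k + 1) := by
      intro a b hab
      refine image_mono fun z hz i hi => (hz i hi).trans ?_
      rcases eq_or_ne i k with rfl | hik
      · simpa using hab
      · simp [hik]
    have hU : (⋃ a, f '' C (Function.update n k a) (k + 1)) = f '' C n k := by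
      rw [← image_iUnion]
      congr 1
      ext z
      simp only [C, mem_iUnion, mem_ofPred_eq]
      constructor
      · rintro ⟨a, ha⟩ i hi
        have := ha i (by omega)
        rwa [Function.update_of_ne (by omega)] at this
      · intro hz
        refine ⟨z k, fun i hi => ?_⟩
        rcases eq_or_ne i k with rfl | hik
        · simp
        · rw [Function.update_of_ne hik]
          exact hz i (by omega)
    rw [← hU, hmono.measure_iUnion] at h
    exact lt_iSup_iff.1 h
  choose! a ha using hstep
  let N : ℕ → ℕ → ℕ := fun k => Nat.rec (fun _ => 0) (fun k n => Function.update n k (a k n)) k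
  have hNs : ∀ k, N (k + 1) = Function.update (N k) k (a k (N k)) := fun k => rfl
  have hN : ∀ k, r < l (f '' C (N k) k) := by
    intro k
    induction k with
    | zero => simpa [C] using hr
    | succ k ih =>
      rw [hNs]
      exact ha k _ ih
  have hstab : ∀ i k, i < k → N k i = N (i + 1) i := by
    intro i k hik
    induction k, hik using Nat.le_induction with
    | base => rfl
    | succ k hk ih => rw [hNs, Function.update_of_ne (by omega), ih]
  let n : ℕ → ℕ := fun i => N (i + 1) i
  have hCn : ∀ k, C (N k) k = C n k := by
    intro k
    ext z
    refine forall₂_congr fun i hi => ?_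
    rw [hstab i k hi]
  let K : Set (ℕ → ℕ) := univ.pi fun i => Iic (n i)
  have hK : IsCompact K := isCompact_univ_pi fun i => (finite_Iic (n i)).isCompact
  refine ⟨K, hK, ?_⟩
  have hle : r ≤ l (f '' K) := by
    rw [(f '' K).measure_eq_iInf_isOpen l]
    refine le_iInf₂ fun U hU => le_iInf fun hUo => ?_
    obtain ⟨k, hk⟩ : ∃ k, C n k ⊆ f ⁻¹' U := by
      by_contra! hcon
      simp only [not_subset] at hcon
      choose z hzC hzU using hcon
      let M : ℕ → ℕ := fun i => n i + ∑ j ∈ Finset.range (i + 1), z j i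
      have hMc : IsCompact (univ.pi fun i => Iic (M i)) :=
        isCompact_univ_pi fun i => (finite_Iic (M i)).isCompact
      have hzM : ∀ k, z k ∈ univ.pi fun i => Iic (M i) := by
        intro k i _
        rcases lt_or_ge i k with hik | hik
        · exact (hzC k i hik).trans (Nat.le_add_right _ _)
        · exact (Finset.single_le_sum (f := fun j => z j i) (fun _ _ => Nat.zero_le _)
            (Finset.mem_range.2 (Nat.lt_succ_of_le hik))).trans (Nat.le_add_left _ _)
      obtain ⟨w, -, φ, hφ, hw⟩ := hMc.tendsto_subseq hzM
      have hwK : w ∈ K := by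
        intro i _
        have h1 := (tendsto_pi_nhds.1 hw) i
        refine isClosed_Iic.mem_of_tendsto h1 ?_
        filter_upwards [eventually_gt_atTop i] with j hj
        exact hzC _ i (hj.trans_le (hφ.id_le j))
      have hwU : w ∈ (f ⁻¹' U)ᶜ := (hUo.preimage hf).isClosed_compl.mem_of_tendsto hw
        (Eventually.of_forall fun j => hzU _)
      exact hwU (hU ⟨w, hwK, rfl⟩)
    have h2 := hN k
    rw [hCn] at h2
    exact h2.le.trans (measure_mono (image_subset_iff.2 hk))
  exact (hr0.trans_le hle).ne'

/-- A Borel set in a product whose projection has positive outer measure admits a measurable selector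
over a set of positive measure. -/
theorem exists_measurable_section {X Y : Type*} [TopologicalSpace X] [PolishSpace X]
    [MeasurableSpace X] [BorelSpace X] [TopologicalSpace Y] [PolishSpace Y] [MeasurableSpace Y]
    [BorelSpace Y] (l : Measure X) [IsFiniteMeasure l] {B : Set (X × Y)} (hB : MeasurableSet B)
    (hpos : l (Prod.fst '' B) ≠ 0) :
    ∃ (E : Set X) (s : X → Y), MeasurableSet E ∧ l E ≠ 0 ∧ Measurable s ∧ ∀ x ∈ E, (x, s x) ∈ B := by
  have hBa := hB.analyticSet
  rw [AnalyticSet] at hBa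
  rcases hBa with rfl | ⟨f, hf, rfl⟩
  · simp at hpos
  rw [← range_comp] at hpos
  let _ := TopologicalSpace.upgradeIsCompletelyMetrizable X
  obtain ⟨K, hK, hKl⟩ := exists_isCompact_image_pos l (continuous_fst.comp hf) hpos
  obtain ⟨s, hs, hsK⟩ := exists_measurable_rightInverse_baire hK (continuous_fst.comp hf)
  refine ⟨_, fun x => (f (s x)).2, (hK.image (continuous_fst.comp hf)).measurableSet, hKl,
    (hf.measurable.comp hs).snd, fun x hx => ⟨s x, ?_⟩⟩
  exact Prod.ext (hsK x hx).2 rfl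

/-- The probability measures on a standard Borel space are parametrized by a Markov kernel. -/
theorem exists_kernel_parametrization (Ω : Type*) [MeasurableSpace Ω] [StandardBorelSpace Ω]
    [Nonempty Ω] :
    ∃ (N : Kernel (ℚ → ℝ) Ω) (T : Measure Ω → ℚ → ℝ), IsMarkovKernel N ∧ Measurable T ∧
      ∀ ρ : Measure Ω, IsProbabilityMeasure ρ → N (T ρ) = ρ := by
  obtain ⟨g, hg, hge⟩ := (measurableEmbedding_embeddingReal Ω).exists_measurable_extend
    (g := (id : Ω → Ω)) measurable_id (fun _ => inferInstance)
  have he := (measurableEmbedding_embeddingReal Ω).measurable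
  let N₀ : Kernel (ℚ → ℝ) ℝ := ⟨fun t => (stieltjesOfMeasurableRat id measurable_id t).measure,
    measurable_measure_stieltjesOfMeasurableRat measurable_id⟩
  have hN₀ : IsMarkovKernel N₀ :=
    ⟨fun t => instIsProbabilityMeasure_stieltjesOfMeasurableRat measurable_id t⟩
  let T : Measure Ω → ℚ → ℝ := fun ρ q => (ρ (embeddingReal Ω ⁻¹' Iic (q : ℝ))).toReal
  refine ⟨N₀.map g, T, Kernel.IsMarkovKernel.map _ hg, ?_, fun ρ hρ => ?_⟩
  · exact measurable_pi_iff.2 fun q => (Measure.measurable_coe (he measurableSet_Iic)).ennreal_toReal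
  · set ρ' := ρ.map (embeddingReal Ω) with hρ'
    have hprob : IsProbabilityMeasure ρ' := Measure.isProbabilityMeasure_map he.aemeasurable
    have hT : ∀ q : ℚ, T ρ q = cdf ρ' q := fun q => by
      rw [cdf_eq_real, measureReal_def, hρ', Measure.map_apply he measurableSet_Iic]
    have hpt : IsRatStieltjesPoint id (T ρ) := by
      refine ⟨fun p q hpq => ?_, ?_, ?_, fun q => ?_⟩
      · rw [id, hT, hT]
        exact monotone_cdf ρ' (by exact_mod_cast hpq)
      · have := (tendsto_cdf_atTop ρ').comp (tendsto_ratCast_atTop_iff.2 tendsto_id)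
        exact this.congr fun q => (hT q).symm
      · have := (tendsto_cdf_atBot ρ').comp (tendsto_ratCast_atBot_iff.2 tendsto_id)
        exact this.congr fun q => (hT q).symm
      · simp only [id, hT]
        rw [← (cdf ρ').iInf_rat_gt_eq q]
        exact Equiv.iInf_congr (Equiv.subtypeEquivRight fun r => Rat.cast_lt.symm) fun r => rfl
    have hN : N₀ (T ρ) = ρ' := by
      have : stieltjesOfMeasurableRat id measurable_id (T ρ) = cdf ρ' := by
        ext x
        rw [← StieltjesFunction.iInf_rat_gt_eq, ← (cdf ρ').iInf_rat_gt_eq]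
        refine iInf_congr fun r => ?_
        rw [stieltjesOfMeasurableRat_eq, toRatCDF_of_isRatStieltjesPoint hpt]
        exact hT r
      rw [← measure_cdf ρ', ← this]
      rfl
    rw [Kernel.map_apply _ hg, hN, hρ', Measure.map_map hg he, hge, Measure.map_id]

end MartingaleTransport

namespace MartingaleTransport

open Filter

variable {d : ℕ}

theorem integral_bind_kernel {X Y F : Type*} [MeasurableSpace X] [MeasurableSpace Y]
    [NormedAddCommGroup F] [NormedSpace ℝ F] {θ : Measure X} [SFinite θ] {κ : Kernel X Y}
    [IsSFiniteKernel κ] {f : Y → F} (hf : Integrable f (κ ∘ₘ θ)) :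
    ∫ y, f y ∂(κ ∘ₘ θ) = ∫ x, ∫ y, f y ∂(κ x) ∂θ := by
  have h1 : (κ ∘ₖ Kernel.const Unit θ) () = κ ∘ₘ θ := by
    rw [Kernel.comp_apply, Kernel.const_apply]
  have := Kernel.integral_comp (η := κ) (κ := Kernel.const Unit θ) (a := ()) (f := f)
    (by rwa [h1])
  rwa [h1, Kernel.const_apply] at this

theorem integrable_integral_of_bind {X Y F : Type*} [MeasurableSpace X] [MeasurableSpace Y]
    [NormedAddCommGroup F] [NormedSpace ℝ F] {θ : Measure X} [SFinite θ] {κ : Kernel X Y}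
    [IsSFiniteKernel κ] {f : Y → F} (hf : Integrable f (κ ∘ₘ θ)) :
    Integrable (fun x => ∫ y, f y ∂(κ x)) θ := by
  have h1 : (κ ∘ₖ Kernel.const Unit θ) () = κ ∘ₘ θ := by
    rw [Kernel.comp_apply, Kernel.const_apply]
  have := Integrable.integral_comp (η := κ) (κ := Kernel.const Unit θ) (a := ()) (f := f)
    (by rwa [h1])
  rwa [Kernel.const_apply] at this

/-- The martingale plans in a measurable family form a measurable set. -/
theorem exists_measurableSet_iff_mem_MT {S : Type*} [MeasurableSpace S]
    [MeasurableSpace.CountablyGenerated S] (N : Kernel S (Eucl d × Eucl d)) [IsMarkovKernel N] :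
    ∃ M : Set S, MeasurableSet M ∧ ∀ s, s ∈ M ↔ N s ∈ MT (N s).fst (N s).snd := by
  set η := N.condKernel
  have hN : ∀ s, N s = (N s).fst ⊗ₘ η.sectR s := fun s => by
    conv_lhs => rw [← N.disintegrate η]
    rw [Kernel.compProd_apply_eq_compProd_sectR, Kernel.fst_apply, Measure.fst]
  let G : Set (S × Eucl d) := {q | Integrable (fun y => y) (η q) ∧ ∫ y, y ∂(η q) = q.2}
  have hG : MeasurableSet G := by
    refine MeasurableSet.inter ?_ ?_
    · exact measurableSet_kernel_integrable (f := fun _ y => y) measurable_snd.stronglyMeasurable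
    · exact measurableSet_eq_fun
        (StronglyMeasurable.integral_kernel (f := fun y : Eucl d => y)
          stronglyMeasurable_id).measurable measurable_snd
  refine ⟨{s | N.fst s (Prod.mk s ⁻¹' Gᶜ) = 0},
    (Kernel.measurable_kernel_prodMk_left hG.compl) (measurableSet_singleton 0), fun s => ?_⟩
  have hiff : N.fst s (Prod.mk s ⁻¹' Gᶜ) = 0 ↔ ∀ᵐ x ∂(N s).fst, (s, x) ∈ G := by
    rw [Kernel.fst_apply]
    rfl
  rw [mem_ofPred_eq, hiff]
  constructor
  · intro h
    exact ⟨inferInstance, rfl, rfl, η.sectR s, inferInstance, hN s, h⟩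
  · rintro ⟨-, -, -, k, hk, hNk, hbar⟩
    filter_upwards [eq_condKernel_of_measure_eq_compProd k hNk,
      eq_condKernel_of_measure_eq_compProd (η.sectR s) (hN s), hbar] with x h1 h2 h3
    rw [← h2, Kernel.sectR_apply] at h1
    rw [h1] at h3
    exact h3

section Gluing

variable {𝒦 : Type*} [MeasurableSpace 𝒦] {θ : Measure 𝒦} {κ κ' : Kernel 𝒦 (Eucl d × Eucl d)}

theorem fst_comp_congr (h : ∀ᵐ K ∂θ, (κ' K).fst = (κ K).fst) : (κ' ∘ₘ θ).fst = (κ ∘ₘ θ).fst := by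
  ext S hS
  rw [Measure.fst_apply hS, Measure.fst_apply hS,
    Measure.bind_apply (measurable_fst hS) κ'.measurable.aemeasurable,
    Measure.bind_apply (measurable_fst hS) κ.measurable.aemeasurable]
  refine lintegral_congr_ae (h.mono fun K hK => ?_)
  simp only
  rw [← Measure.fst_apply hS, hK, Measure.fst_apply hS]

theorem snd_comp_congr (h : ∀ᵐ K ∂θ, (κ' K).snd = (κ K).snd) : (κ' ∘ₘ θ).snd = (κ ∘ₘ θ).snd := by
  ext S hS
  rw [Measure.snd_apply hS, Measure.snd_apply hS,
    Measure.bind_apply (measurable_snd hS) κ'.measurable.aemeasurable,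
    Measure.bind_apply (measurable_snd hS) κ.measurable.aemeasurable]
  refine lintegral_congr_ae (h.mono fun K hK => ?_)
  simp only
  rw [← Measure.snd_apply hS, hK, Measure.snd_apply hS]

variable [IsProbabilityMeasure θ] [IsMarkovKernel κ]

/-- Mixtures of martingale plans are martingale plans. -/
theorem comp_mem_MT {σ : Measure (Eucl d × Eucl d)} (hσ : κ ∘ₘ θ = σ)
    (hx : Integrable (fun p => p.1) σ) (hy : Integrable (fun p => p.2) σ)
    (h : ∀ᵐ K ∂θ, κ K ∈ MT (κ K).fst (κ K).snd) : σ ∈ MT σ.fst σ.snd := by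
  have hprob : IsProbabilityMeasure σ := by
    rw [← hσ]
    infer_instance
  refine mem_MT_of_forall_integral_smul_eq_zero hx hy fun g hg hgc => ?_
  obtain ⟨C, hC⟩ := hgc.exists_bound_of_continuous hg
  have hgi : Integrable (fun p : Eucl d × Eucl d => g p.1 • (p.2 - p.1)) σ :=
    (hy.sub hx).bdd_smul C (hg.comp continuous_fst).aestronglyMeasurable
      (Eventually.of_forall fun p => hC p.1)
  rw [← hσ] at hx hy hgi ⊢
  rw [integral_bind_kernel hgi]
  refine integral_eq_zero_of_ae ?_
  filter_upwards [h, Measure.ae_integrable_of_integrable_comp hx,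
    Measure.ae_integrable_of_integrable_comp hy] with K h1 h2 h3
  exact integral_smul_eq_zero_of_mem_MT h1 h2 h3 hg.measurable hC

/-- Almost all components of a minimizing mixture are minimizers. -/
theorem ae_isOptimal_minimize_of_comp {c : Eucl d × Eucl d → ℝ} (hc : Measurable c)
    {μ ν : Measure (Eucl d)} (hopt : IsOptimal .minimize c μ ν (κ ∘ₘ θ))
    (hx : Integrable (fun p => p.1) (κ ∘ₘ θ)) (hy : Integrable (fun p => p.2) (κ ∘ₘ θ))
    (hMT : ∀ᵐ K ∂θ, κ K ∈ MT (κ K).fst (κ K).snd) :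
    ∀ᵐ K ∂θ, IsOptimal .minimize c (κ K).fst (κ K).snd (κ K) := by
  classical
  by_contra hnot
  obtain ⟨N, T, hN, hT, hNT⟩ := exists_kernel_parametrization (Eucl d × Eucl d)
  obtain ⟨N₁, T₁, hN₁, hT₁, hNT₁⟩ := exists_kernel_parametrization (Eucl d)
  obtain ⟨M, hM, hMN⟩ := exists_measurableSet_iff_mem_MT N
  have hci := Measure.ae_integrable_of_integrable_comp hopt.2.1
  have hcm : StronglyMeasurable fun t => ∫ p, c p ∂(N t) :=
    StronglyMeasurable.integral_kernel hc.stronglyMeasurable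
  let B : Set ((ℚ → ℝ) × (ℚ → ℝ)) := {q | T₁ (N.fst q.2) = T₁ (N.fst q.1) ∧
    T₁ (N.snd q.2) = T₁ (N.snd q.1) ∧ q.2 ∈ M ∧ Integrable c (N q.2) ∧
    ∫ p, c p ∂(N q.2) < ∫ p, c p ∂(N q.1)}
  have hB : MeasurableSet B := by
    refine MeasurableSet.inter ?_ (MeasurableSet.inter ?_ (MeasurableSet.inter ?_
      (MeasurableSet.inter ?_ ?_)))
    · exact measurableSet_eq_fun (hT₁.comp (N.fst.measurable.comp measurable_snd))
        (hT₁.comp (N.fst.measurable.comp measurable_fst))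
    · exact measurableSet_eq_fun (hT₁.comp (N.snd.measurable.comp measurable_snd))
        (hT₁.comp (N.snd.measurable.comp measurable_fst))
    · exact measurable_snd hM
    · exact measurable_snd (measurableSet_kernel_integrable (κ := N) (f := fun _ => c)
        (hc.comp measurable_snd).stronglyMeasurable)
    · exact measurableSet_lt (hcm.measurable.comp measurable_snd)
        (hcm.measurable.comp measurable_fst)
  have hBiff : ∀ t s, (t, s) ∈ B ↔ N s ∈ MT (N t).fst (N t).snd ∧ Integrable c (N s) ∧
      ∫ p, c p ∂(N s) < ∫ p, c p ∂(N t) := by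
    intro t s
    have h1 : T₁ (N.fst s) = T₁ (N.fst t) ↔ (N s).fst = (N t).fst := by
      change _ ↔ (N s).map Prod.fst = (N t).map Prod.fst
      rw [← N.fst_apply, ← N.fst_apply]
      exact ⟨fun h => by rw [← hNT₁ (N.fst s) inferInstance, h, hNT₁ (N.fst t) inferInstance],
        fun h => by rw [h]⟩
    have h2 : T₁ (N.snd s) = T₁ (N.snd t) ↔ (N s).snd = (N t).snd := by
      change _ ↔ (N s).map Prod.snd = (N t).map Prod.snd
      rw [← N.snd_apply, ← N.snd_apply]
      exact ⟨fun h => by rw [← hNT₁ (N.snd s) inferInstance, h, hNT₁ (N.snd t) inferInstance],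
        fun h => by rw [h]⟩
    change (T₁ (N.fst s) = T₁ (N.fst t) ∧ T₁ (N.snd s) = T₁ (N.snd t) ∧ s ∈ M ∧ _) ↔ _
    rw [h1, h2, hMN]
    constructor
    · rintro ⟨h1, h2, h3, h4⟩
      rw [h1, h2] at h3
      exact ⟨h3, h4⟩
    · rintro ⟨h3, h4⟩
      refine ⟨h3.2.1, h3.2.2.1, ?_, h4⟩
      rwa [h3.2.1, h3.2.2.1]
  let τ : 𝒦 → ℚ → ℝ := fun K => T (κ K)
  have hτ : Measurable τ := hT.comp κ.measurable
  have hNτ : ∀ K, N (τ K) = κ K := fun K => hNT _ inferInstance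
  have hpos : (θ.map τ) (Prod.fst '' B) ≠ 0 := by
    intro h0
    have h1 : θ (τ ⁻¹' (Prod.fst '' B)) = 0 :=
      le_antisymm ((Measure.le_map_apply hτ.aemeasurable _).trans h0.le) bot_le
    refine hnot ?_
    filter_upwards [measure_eq_zero_iff_ae_notMem.1 h1, hMT, hci] with K hK hK1 hK2
    refine ⟨hK1, hK2, fun ρ hρ hρc => ?_⟩
    by_contra hlt
    rw [Goal.le, not_le] at hlt
    have := hρ.1
    refine hK ⟨(τ K, T ρ), (hBiff _ _).2 ?_, rfl⟩
    rw [hNτ, hNT ρ hρ.1]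
    exact ⟨hρ, hρc, hlt⟩
  obtain ⟨E, s, hE, hEpos, hs, hsB⟩ := exists_measurable_section (θ.map τ) hB hpos
  let E' : ℕ → Set (ℚ → ℝ) := fun n => E ∩ {t | ∫⁻ p, ‖c p‖ₑ ∂(N (s t)) ≤ n}
  have hE'm : ∀ n, MeasurableSet (E' n) := fun n => hE.inter (measurableSet_le
    ((Measurable.lintegral_kernel hc.enorm).comp hs) measurable_const)
  have hEU : E = ⋃ n, E' n := by
    rw [← inter_iUnion]
    refine (inter_eq_left.2 fun t ht => ?_).symm
    have hfin : ∫⁻ p, ‖c p‖ₑ ∂(N (s t)) < ⊤ := (((hBiff _ _).1 (hsB t ht)).2.1).2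
    obtain ⟨n, hn⟩ := ENNReal.exists_nat_gt hfin.ne
    exact mem_iUnion.2 ⟨n, hn.le⟩
  obtain ⟨n, hn⟩ : ∃ n, (θ.map τ) (E' n) ≠ 0 := by
    by_contra! h0
    exact hEpos (by rw [hEU]; exact measure_iUnion_null h0)
  let F : Set 𝒦 := τ ⁻¹' (E' n)
  have hF : MeasurableSet F := hτ (hE'm n)
  have hFpos : θ F ≠ 0 := by rwa [Measure.map_apply hτ (hE'm n)] at hn
  let κ' : Kernel 𝒦 (Eucl d × Eucl d) := Kernel.piecewise hF (N.comap (s ∘ τ) (hs.comp hτ)) κ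
  have hκ'F : ∀ K ∈ F, κ' K = N (s (τ K)) := fun K hK => by
    simp [κ', Kernel.piecewise_apply, hK, Kernel.comap_apply]
  have hκ'F' : ∀ K ∉ F, κ' K = κ K := fun K hK => by
    simp [κ', Kernel.piecewise_apply, hK]
  have hFB : ∀ K ∈ F, κ' K ∈ MT (κ K).fst (κ K).snd ∧ Integrable c (κ' K) ∧
      ∫ p, c p ∂(κ' K) < ∫ p, c p ∂(κ K) := fun K hK => by
    have := (hBiff _ _).1 (hsB (τ K) hK.1)
    rwa [hNτ, ← hκ'F K hK] at this
  have hMT' : ∀ᵐ K ∂θ, κ' K ∈ MT (κ K).fst (κ K).snd := by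
    filter_upwards [hMT] with K hK
    by_cases hKF : K ∈ F
    · exact (hFB K hKF).1
    · rwa [hκ'F' K hKF]
  have hfst : (κ' ∘ₘ θ).fst = (κ ∘ₘ θ).fst := fst_comp_congr (hMT'.mono fun K hK => hK.2.1)
  have hsnd : (κ' ∘ₘ θ).snd = (κ ∘ₘ θ).snd := snd_comp_congr (hMT'.mono fun K hK => hK.2.2.1)
  have hx' : Integrable (fun p => p.1) (κ' ∘ₘ θ) := by
    refine Integrable.comp_measurable (g := fun x : Eucl d => x) ?_ measurable_fst
    rw [← Measure.fst, hfst, Measure.fst,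
      integrable_map_measure (by fun_prop) measurable_fst.aemeasurable]
    exact hx
  have hy' : Integrable (fun p => p.2) (κ' ∘ₘ θ) := by
    refine Integrable.comp_measurable (g := fun x : Eucl d => x) ?_ measurable_snd
    rw [← Measure.snd, hsnd, Measure.snd,
      integrable_map_measure (by fun_prop) measurable_snd.aemeasurable]
    exact hy
  have hρ : κ' ∘ₘ θ ∈ MT μ ν := by
    have := comp_mem_MT rfl hx' hy' (hMT'.mono fun K hK => by rwa [hK.2.1, hK.2.2.1])
    rwa [hfst, hsnd, hopt.1.2.1, hopt.1.2.2.1] at this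
  have hci' : ∀ᵐ K ∂θ, Integrable c (κ' K) := by
    filter_upwards [hci] with K hK
    by_cases hKF : K ∈ F
    · exact (hFB K hKF).2.1
    · rwa [hκ'F' K hKF]
  have hρc : Integrable c (κ' ∘ₘ θ) := by
    refine ⟨hc.aestronglyMeasurable, ?_⟩
    rw [HasFiniteIntegral, Measure.lintegral_bind κ'.measurable.aemeasurable hc.enorm.aemeasurable]
    have hle : ∀ K, ∫⁻ p, ‖c p‖ₑ ∂(κ' K) ≤ n + ∫⁻ p, ‖c p‖ₑ ∂(κ K) := by
      intro K
      by_cases hKF : K ∈ F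
      · rw [hκ'F K hKF]
        exact hKF.2.trans le_self_add
      · rw [hκ'F' K hKF]
        exact le_add_self
    refine (lintegral_mono hle).trans_lt ?_
    rw [lintegral_add_left measurable_const, ← Measure.lintegral_bind κ.measurable.aemeasurable
      hc.enorm.aemeasurable]
    refine ENNReal.add_lt_top.2 ⟨?_, hopt.2.1.2⟩
    simp
  have hfin := hopt.2.2 _ hρ hρc
  rw [Goal.le, integral_bind_kernel hopt.2.1, integral_bind_kernel hρc] at hfin
  have hle : ∀ K, ∫ p, c p ∂(κ' K) ≤ ∫ p, c p ∂(κ K) := by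
    intro K
    by_cases hKF : K ∈ F
    · exact (hFB K hKF).2.2.le
    · rw [hκ'F' K hKF]
  have hI : Integrable (fun K => ∫ p, c p ∂(κ K)) θ := integrable_integral_of_bind hopt.2.1
  have hI' : Integrable (fun K => ∫ p, c p ∂(κ' K)) θ := integrable_integral_of_bind hρc
  have hzero : ∫ K, (∫ p, c p ∂(κ K) - ∫ p, c p ∂(κ' K)) ∂θ = 0 := by
    refine le_antisymm ?_ (integral_nonneg fun K => sub_nonneg.2 (hle K))
    rw [integral_sub hI hI']
    linarith
  rw [integral_eq_zero_iff_of_nonneg (fun K => sub_nonneg.2 (hle K)) (hI.sub hI')] at hzero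
  refine hFpos (measure_eq_zero_iff_ae_notMem.2 ?_)
  filter_upwards [hzero] with K hK hKF
  have := (hFB K hKF).2.2
  simp only [Pi.zero_apply] at hK
  linarith

/-- Almost all components of an optimal mixture are optimal. -/
theorem ae_isOptimal_of_comp {g : Goal} {c : Eucl d × Eucl d → ℝ} (hc : Measurable c)
    {μ ν : Measure (Eucl d)} (hopt : IsOptimal g c μ ν (κ ∘ₘ θ))
    (hx : Integrable (fun p => p.1) (κ ∘ₘ θ)) (hy : Integrable (fun p => p.2) (κ ∘ₘ θ))
    (hMT : ∀ᵐ K ∂θ, κ K ∈ MT (κ K).fst (κ K).snd) :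
    ∀ᵐ K ∂θ, IsOptimal g c (κ K).fst (κ K).snd (κ K) := by
  rw [isOptimal_cost_iff] at hopt
  refine (ae_isOptimal_minimize_of_comp (g.measurable_cost hc) hopt hx hy hMT).mono fun K hK => ?_
  rwa [isOptimal_cost_iff]

end Gluing

end MartingaleTransport

namespace MartingaleTransport

open Filter Topology

variable {d : ℕ}

theorem exists_finset_weights_of_mem_convexHull {E : Type*} [AddCommGroup E] [Module ℝ E]
    {A : Set E} {x : E} (hx : x ∈ convexHull ℝ A) :
    ∃ (F : Finset E) (w : E → ℝ), ↑F ⊆ A ∧ (∀ y ∈ F, 0 ≤ w y) ∧ (∀ y ∉ F, w y = 0) ∧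
      ∑ y ∈ F, w y = 1 ∧ ∑ y ∈ F, w y • y = x := by
  classical
  rw [convexHull_eq_union_convexHull_finite_subsets] at hx
  simp only [mem_iUnion] at hx
  obtain ⟨F, hF, hx⟩ := hx
  obtain ⟨w, h0, h1, h2⟩ := Finset.mem_convexHull'.1 hx
  refine ⟨F, fun y => if y ∈ F then w y else 0, hF, fun y hy => by simpa [hy] using h0 y hy,
    fun y hy => by simp [hy], ?_, ?_⟩
  · rw [← h1]
    exact Finset.sum_congr rfl fun y hy => by simp [hy]
  · rw [← h2]
    exact Finset.sum_congr rfl fun y hy => by simp [hy]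

/-- A point of the relative interior of a convex hull is a convex combination charging any
prescribed finite set of points. -/
theorem exists_pos_weights_of_mem_IC {A : Set (Eucl d)} {x : Eucl d} (hx : x ∈ IC A)
    (F₀ : Finset (Eucl d)) (hF₀ : ↑F₀ ⊆ A) :
    ∃ (F : Finset (Eucl d)) (m : Eucl d → ℝ), F₀ ⊆ F ∧ ↑F ⊆ A ∧ (∀ y ∈ F, 0 < m y) ∧
      ∑ y ∈ F, m y = 1 ∧ ∑ y ∈ F, m y • y = x := by
  classical
  obtain ⟨hxA, hext⟩ := (Convex.mem_intrinsicInterior_iff (convex_convexHull ℝ A)).1 hx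
  suffices h : ∃ (G : Finset (Eucl d)) (m : Eucl d → ℝ), F₀ ⊆ G ∧ ↑G ⊆ A ∧ (∀ y ∈ G, 0 ≤ m y) ∧
      (∀ y ∈ F₀, 0 < m y) ∧ ∑ y ∈ G, m y = 1 ∧ ∑ y ∈ G, m y • y = x by
    obtain ⟨G, m, h1, h2, h3, h4, h5, h6⟩ := h
    refine ⟨G.filter fun y => 0 < m y, m, fun y hy => Finset.mem_filter.2 ⟨h1 hy, h4 y hy⟩,
      fun y hy => h2 (Finset.mem_filter.1 hy).1, fun y hy => (Finset.mem_filter.1 hy).2, ?_, ?_⟩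
    · rw [← h5]
      exact Finset.sum_filter_of_ne fun y hy hne => (h3 y hy).lt_of_ne' hne
    · rw [← h6]
      refine Finset.sum_filter_of_ne fun y hy hne => (h3 y hy).lt_of_ne' fun h => hne ?_
      rw [h, zero_smul]
  rcases F₀.eq_empty_or_nonempty with rfl | hne
  · obtain ⟨F, w, h1, h2, -, h3, h4⟩ := exists_finset_weights_of_mem_convexHull hxA
    exact ⟨F, w, by simp, h1, h2, by simp, h3, h4⟩
  set n : ℝ := (F₀.card : ℝ) with hn
  have hn0 : 0 < n := Nat.cast_pos.2 hne.card_pos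
  have hb : ∑ y ∈ F₀, n⁻¹ • y ∈ convexHull ℝ A :=
    (convex_convexHull ℝ A).sum_mem (fun _ _ => by positivity)
      (by rw [Finset.sum_const, nsmul_eq_mul, mul_inv_cancel₀ hn0.ne'])
      fun y hy => subset_convexHull ℝ A (hF₀ hy)
  obtain ⟨η, hη, hp⟩ := hext _ hb
  obtain ⟨F₁, w, h1, h2, h2', h3, h4⟩ := exists_finset_weights_of_mem_convexHull hp
  have hs1 : ∑ y ∈ F₁ ∪ F₀, w y = 1 := by
    rw [← h3]
    exact (Finset.sum_subset Finset.subset_union_left fun y _ hy => h2' y hy).symm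
  have hs2 : ∑ y ∈ F₁ ∪ F₀, w y • y = ∑ y ∈ F₁, w y • y :=
    (Finset.sum_subset Finset.subset_union_left fun y _ hy => by rw [h2' y hy, zero_smul]).symm
  let c : Eucl d → ℝ := fun y => if y ∈ F₀ then n⁻¹ else 0
  have hc1 : ∑ y ∈ F₁ ∪ F₀, c y = 1 := by
    rw [← Finset.sum_subset Finset.subset_union_right fun y _ hy => by simp [c, hy],
      Finset.sum_congr rfl fun y hy => show c y = n⁻¹ by simp [c, hy], Finset.sum_const,
      nsmul_eq_mul, mul_inv_cancel₀ hn0.ne']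
  have hc2 : ∑ y ∈ F₁ ∪ F₀, c y • y = ∑ y ∈ F₀, n⁻¹ • y := by
    rw [← Finset.sum_subset Finset.subset_union_right fun y _ hy => by simp [c, hy]]
    exact Finset.sum_congr rfl fun y hy => by simp [c, hy]
  have hw0 : ∀ y, 0 ≤ w y := fun y => by
    by_cases hy : y ∈ F₁
    · exact h2 y hy
    · exact (h2' y hy).ge
  have hc0 : ∀ y, 0 ≤ c y := fun y => by
    simp only [c]
    split_ifs <;> positivity
  refine ⟨F₁ ∪ F₀, fun y => (1 + η)⁻¹ * (w y + η * c y), Finset.subset_union_right, ?_, ?_, ?_,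
    ?_, ?_⟩
  · rw [Finset.coe_union]
    exact union_subset h1 hF₀
  · intro y _
    have := hw0 y
    have := hc0 y
    positivity
  · intro y hy
    have := hw0 y
    have : 0 < c y := by simp [c, hy, hn0]
    positivity
  · rw [← Finset.mul_sum, Finset.sum_add_distrib, ← Finset.mul_sum, hs1, hc1]
    field_simp
  · simp_rw [mul_smul, add_smul, mul_smul]
    rw [← Finset.smul_sum, Finset.sum_add_distrib, ← Finset.smul_sum, hs2, hc2, h4]
    rw [inv_smul_eq_iff₀ (by positivity)]
    module

/-- A map on the index set respecting all linear relations factors through a linear map. -/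
theorem exists_linearMap_of_forall_relation {ι V U : Type*} [AddCommGroup V] [Module ℝ V]
    [AddCommGroup U] [Module ℝ U] (f : ι → V) (u : ι → U)
    (h : ∀ σ : ι →₀ ℝ, Finsupp.linearCombination ℝ f σ = 0 →
      Finsupp.linearCombination ℝ u σ = 0) : ∃ L : V →ₗ[ℝ] U, ∀ i, L (f i) = u i := by
  let F := Finsupp.linearCombination ℝ f
  let G := F.ker.liftQ (Finsupp.linearCombination ℝ u) fun σ hσ => h σ hσ
  obtain ⟨L, hL⟩ := LinearMap.exists_extend (G.comp F.quotKerEquivRange.symm.toLinearMap)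
  refine ⟨L, fun i => ?_⟩
  have h1 : f i = F (Finsupp.single i 1) := by simp [F]
  have h2 := LinearMap.congr_fun hL ⟨F (Finsupp.single i 1), LinearMap.mem_range_self _ _⟩
  have h3 : F.quotKerEquivRange.symm ⟨F (Finsupp.single i 1), LinearMap.mem_range_self _ _⟩ =
      F.ker.mkQ (Finsupp.single i 1) := F.quotKerEquivRange_symm_apply_image _ _
  simp only [LinearMap.comp_apply, Submodule.subtype_apply, LinearEquiv.coe_coe, h3] at h2
  rw [h1, h2]
  exact (Submodule.liftQ_apply _ _ _).trans (by simp)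

theorem hasDerivAt_norm_add_smul {x y v : Eucl d} (hxy : x ≠ y) :
    HasDerivAt (fun t : ℝ => ‖x + t • v - y‖) (inner ℝ (‖x - y‖⁻¹ • (x - y)) v) 0 := by
  have h1 : HasDerivAt (fun t : ℝ => x + t • v - y) v 0 := by
    simpa using (((hasDerivAt_id (0 : ℝ)).smul_const v).const_add x).sub_const y
  have h2 := h1.norm_sq.sqrt (by simpa [sub_eq_zero] using hxy)
  simp only [Real.sqrt_sq (norm_nonneg _), zero_smul, add_zero] at h2
  convert h2 using 1
  rw [inner_smul_left, conj_trivial]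
  have : ‖x - y‖ ≠ 0 := by simpa [sub_eq_zero] using hxy
  field_simp

section Point

variable {A : Set (Eucl d)} {x : Eucl d} {ε a : ℝ} {β f : Eucl d → ℝ} {g : Eucl d}

/-- First order condition for moving the weights of a convex combination along with its
barycenter. -/
theorem deriv_eq_of_weights (hxA : x ∉ A) (hβ : ∀ y ∈ A, β y - ε * ‖x - y‖ = a + inner ℝ g (y - x))
    (hfx : f x = a)
    (hf : ∀ (F : Finset (Eucl d)) (w : Eucl d → ℝ), ↑F ⊆ A → (∀ y ∈ F, 0 ≤ w y) →
      ∑ y ∈ F, w y = 1 → ∑ y ∈ F, w y * (β y - ε * ‖∑ y ∈ F, w y • y - y‖) ≤ f (∑ y ∈ F, w y • y))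
    {F : Finset (Eucl d)} (hF : ↑F ⊆ A) {m s : Eucl d → ℝ} (hm : ∀ y ∈ F, 0 < m y)
    (hm1 : ∑ y ∈ F, m y = 1) (hmx : ∑ y ∈ F, m y • y = x) (hs : ∑ y ∈ F, s y = 0)
    {v : Eucl d} (hv : ∑ y ∈ F, s y • y = v) {D : ℝ}
    (hD : HasDerivAt (fun t : ℝ => f (x + t • v)) D 0) :
    D = inner ℝ g v - ε * ∑ y ∈ F, m y * inner ℝ (‖x - y‖⁻¹ • (x - y)) v := by
  have hφ : HasDerivAt (fun t : ℝ => f (x + t • v) -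
      ∑ y ∈ F, (m y + t * s y) * (β y - ε * ‖x + t • v - y‖))
      (D - ∑ y ∈ F, (s y * (β y - ε * ‖x - y‖) +
        m y * -(ε * inner ℝ (‖x - y‖⁻¹ • (x - y)) v))) 0 := by
    refine hD.sub (HasDerivAt.fun_sum fun y hy => ?_)
    have h1 : HasDerivAt (fun t : ℝ => m y + t * s y) (s y) 0 := by
      simpa using ((hasDerivAt_id (0 : ℝ)).mul_const (s y)).const_add (m y)
    have hne : x ≠ y := fun h => hxA (h ▸ hF hy)
    have h2 := ((hasDerivAt_norm_add_smul (v := v) hne).const_mul ε).const_sub (β y)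
    have h3 := h1.fun_mul h2
    simp only [zero_mul, add_zero, zero_smul] at h3
    exact h3
  have h0 : f (x + (0 : ℝ) • v) -
      ∑ y ∈ F, (m y + 0 * s y) * (β y - ε * ‖x + (0 : ℝ) • v - y‖) = 0 := by
    simp only [zero_smul, add_zero, zero_mul, hfx]
    rw [Finset.sum_congr rfl fun y hy => by rw [hβ y (hF hy)]]
    simp_rw [mul_add, inner_sub_right, mul_sub]
    rw [Finset.sum_add_distrib, Finset.sum_sub_distrib, ← Finset.sum_mul, ← Finset.sum_mul, hm1,
      ← hmx, inner_sum]
    simp_rw [inner_smul_right]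
    ring
  have hmin : IsLocalMin (fun t : ℝ => f (x + t • v) -
      ∑ y ∈ F, (m y + t * s y) * (β y - ε * ‖x + t • v - y‖)) 0 := by
    have hpos : ∀ᶠ t in 𝓝 (0 : ℝ), ∀ y ∈ F, 0 < m y + t * s y := by
      rw [eventually_all_finset]
      intro y hy
      have hc : ContinuousAt (fun t : ℝ => m y + t * s y) 0 := by fun_prop
      exact hc.eventually_const_lt (by simpa using hm y hy)
    filter_upwards [hpos] with t ht
    rw [h0, sub_nonneg]
    have hsum : ∑ y ∈ F, (m y + t * s y) • y = x + t • v := by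
      simp_rw [add_smul, mul_smul]
      rw [Finset.sum_add_distrib, ← Finset.smul_sum, hmx, hv]
    have := hf F (fun y => m y + t * s y) hF (fun y hy => (ht y hy).le)
      (by rw [Finset.sum_add_distrib, ← Finset.mul_sum, hm1, hs]; simp)
    rwa [hsum] at this
  have hzero := hmin.hasDerivAt_eq_zero hφ
  rw [Finset.sum_add_distrib, Finset.sum_congr rfl (fun y hy => by rw [hβ y (hF hy)])] at hzero
  have h3 : ∑ y ∈ F, s y * (a + inner ℝ g (y - x)) = inner ℝ g v := by
    simp_rw [mul_add, inner_sub_right, mul_sub]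
    rw [Finset.sum_add_distrib, Finset.sum_sub_distrib, ← Finset.sum_mul, ← Finset.sum_mul, hs,
      ← hv, inner_sum]
    simp_rw [inner_smul_right]
    ring
  have h4 : ∑ y ∈ F, m y * -(ε * inner ℝ (‖x - y‖⁻¹ • (x - y)) v) =
      -(ε * ∑ y ∈ F, m y * inner ℝ (‖x - y‖⁻¹ • (x - y)) v) := by
    rw [Finset.mul_sum, ← Finset.sum_neg_distrib]
    exact Finset.sum_congr rfl fun y _ => by ring
  rw [h3, h4] at hzero
  linarith

/-- Differentiability of the envelope makes the unit directions towards the fibre respect all affine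
relations. -/
theorem sum_smul_unit_eq_zero (hx : x ∈ IC A) (hε : ε ≠ 0) (hxA : x ∉ A)
    (hβ : ∀ y ∈ A, β y - ε * ‖x - y‖ = a + inner ℝ g (y - x)) (hfx : f x = a)
    (hf : ∀ (F : Finset (Eucl d)) (w : Eucl d → ℝ), ↑F ⊆ A → (∀ y ∈ F, 0 ≤ w y) →
      ∑ y ∈ F, w y = 1 → ∑ y ∈ F, w y * (β y - ε * ‖∑ y ∈ F, w y • y - y‖) ≤ f (∑ y ∈ F, w y • y))
    {W : Submodule ℝ (Eucl d)} (hW : ∀ y ∈ A, x - y ∈ W)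
    (hdiff : ∀ v ∈ W, DifferentiableAt ℝ (fun t : ℝ => f (x + t • v)) 0)
    (σ : Eucl d →₀ ℝ) (hσA : ↑σ.support ⊆ A) (hσ0 : ∑ y ∈ σ.support, σ y = 0)
    (hσ1 : ∑ y ∈ σ.support, σ y • y = 0) :
    ∑ y ∈ σ.support, σ y • (‖x - y‖⁻¹ • (x - y)) = 0 := by
  obtain ⟨F, m, hF₀, hF, hm, hm1, hmx⟩ := exists_pos_weights_of_mem_IC hx σ.support hσA
  have hext : ∀ (U : Eucl d → Eucl d), ∑ y ∈ F, σ y • U y = ∑ y ∈ σ.support, σ y • U y :=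
    fun U => (Finset.sum_subset hF₀ fun y _ hy => by
      rw [Finsupp.notMem_support_iff.1 hy, zero_smul]).symm
  have hext0 : ∑ y ∈ F, σ y = 0 := by
    rw [← hσ0]
    exact (Finset.sum_subset hF₀ fun y _ hy => Finsupp.notMem_support_iff.1 hy).symm
  rw [← hext (fun y => y)] at hσ1
  rw [← hext fun y => ‖x - y‖⁻¹ • (x - y)]
  set v := ∑ y ∈ F, σ y • (‖x - y‖⁻¹ • (x - y)) with hv
  have hvW : v ∈ W := W.sum_mem fun y hy => W.smul_mem _ (W.smul_mem _ (hW y (hF hy)))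
  let b : Eucl d → ℝ := fun y => σ y * ‖x - y‖⁻¹
  let s : Eucl d → ℝ := fun y => (∑ y ∈ F, b y) * m y - b y
  have hs0 : ∑ y ∈ F, s y = 0 := by
    simp only [s]
    rw [Finset.sum_sub_distrib, ← Finset.mul_sum, hm1]
    ring
  have hs1 : ∑ y ∈ F, s y • y = v := by
    simp only [s, sub_smul, mul_smul]
    rw [Finset.sum_sub_distrib, ← Finset.smul_sum, hmx, Finset.sum_smul, ← Finset.sum_sub_distrib,
      hv]
    refine Finset.sum_congr rfl fun y _ => ?_
    simp only [b]
    module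
  obtain ⟨δ, hδ, hδm⟩ : ∃ δ > 0, ∀ y ∈ F, 0 < m y + δ * σ y := by
    have hpos : ∀ᶠ t in 𝓝[>] (0 : ℝ), ∀ y ∈ F, 0 < m y + t * σ y := by
      rw [eventually_all_finset]
      intro y hy
      have hc : ContinuousAt (fun t : ℝ => m y + t * σ y) 0 := by fun_prop
      exact (hc.eventually_const_lt (by simpa using hm y hy)).filter_mono nhdsWithin_le_nhds
    obtain ⟨δ, h1, h2⟩ := (hpos.and self_mem_nhdsWithin).exists
    exact ⟨δ, h2, h1⟩
  have hD := (hdiff v hvW).hasDerivAt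
  have e1 := deriv_eq_of_weights hxA hβ hfx hf hF hm hm1 hmx hs0 hs1 hD
  have e2 := deriv_eq_of_weights hxA hβ hfx hf hF (m := fun y => m y + δ * σ y) hδm
    (by rw [Finset.sum_add_distrib, ← Finset.mul_sum, hm1, hext0]; simp)
    (by simp_rw [add_smul, mul_smul]
        rw [Finset.sum_add_distrib, ← Finset.smul_sum, hmx, hσ1]; simp) hs0 hs1 hD
  have e3 : ∑ y ∈ F, (m y + δ * σ y) * inner ℝ (‖x - y‖⁻¹ • (x - y)) v =
      ∑ y ∈ F, m y * inner ℝ (‖x - y‖⁻¹ • (x - y)) v + δ * inner ℝ v v := by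
    conv_rhs => rw [hv, sum_inner, ← hv]
    rw [Finset.mul_sum, ← Finset.sum_add_distrib]
    refine Finset.sum_congr rfl fun y _ => ?_
    rw [inner_smul_left _ v (σ y), conj_trivial]
    ring
  rw [e3] at e2
  have e4 : ε * (δ * inner ℝ v v) = 0 := by linarith
  have e5 : inner ℝ v v = (0 : ℝ) := by
    rcases mul_eq_zero.1 e4 with h | h
    · exact absurd h hε
    · exact (mul_eq_zero.1 h).resolve_left hδ.ne'
  exact inner_self_eq_zero.1 e5

/-- If the unit directions from the points of `A` towards `x` are given by an affine map, then the
closure of `A` is the set of extreme points of its convex hull. -/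
theorem closure_eq_extremePoints_of_linear (hx : x ∈ IC A) (hxA : x ∉ A)
    (L : Eucl d × ℝ →ₗ[ℝ] Eucl d) (hL : ∀ y ∈ A, L (y, 1) = ‖x - y‖⁻¹ • (x - y)) :
    closure A = (convexHull ℝ (closure A)).extremePoints ℝ := by
  have hne : ∀ y ∈ A, x ≠ y := fun y hy h => hxA (h ▸ hy)
  have hLc : Continuous L := L.continuous_of_finiteDimensional
  have hLc1 : Continuous fun y : Eucl d => L (y, 1) := hLc.comp (by fun_prop)
  have hunit : ∀ y ∈ A, ‖L (y, 1)‖ = 1 := fun y hy => by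
    rw [hL y hy]
    rw [norm_smul, norm_inv, norm_norm,
      inv_mul_cancel₀ (norm_ne_zero_iff.2 (sub_ne_zero.2 (hne y hy)))]
  have hmul : ∀ y ∈ A, ‖x - y‖ • L (y, 1) = x - y := fun y hy => by
    rw [hL y hy, smul_inv_smul₀ (norm_ne_zero_iff.2 (sub_ne_zero.2 (hne y hy)))]
  have ha : ‖L (x, 1)‖ ≠ 1 := by
    intro ha
    obtain ⟨F, m, -, hF, hm, hm1, hmx⟩ := exists_pos_weights_of_mem_IC hx ∅ (by simp)
    have e1 : L (x, 1) = ∑ y ∈ F, m y • L (y, 1) := by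
      have : (x, (1 : ℝ)) = ∑ y ∈ F, m y • (y, (1 : ℝ)) := by
        refine Prod.ext ?_ ?_
        · rw [Prod.fst_sum]
          simp [hmx]
        · rw [Prod.snd_sum]
          simp [hm1]
      rw [this, map_sum]
      simp_rw [map_smul]
    have e2 : ∑ y ∈ F, m y * (1 - inner ℝ (L (y, 1)) (L (x, 1))) = 0 := by
      simp_rw [mul_sub, mul_one]
      rw [Finset.sum_sub_distrib, hm1]
      have : ∑ y ∈ F, m y * inner ℝ (L (y, 1)) (L (x, 1)) = inner ℝ (L (x, 1)) (L (x, 1)) := by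
        conv_rhs => rw [e1, sum_inner, ← e1]
        exact Finset.sum_congr rfl fun y _ => by rw [inner_smul_left, conj_trivial]
      rw [this, real_inner_self_eq_norm_sq, ha]
      norm_num
    have e3 : ∀ y ∈ F, inner ℝ (L (y, 1)) (L (x, 1)) = (1 : ℝ) := by
      intro y hy
      have hnn : ∀ y ∈ F, 0 ≤ m y * (1 - inner ℝ (L (y, 1)) (L (x, 1))) := fun y hy => by
        refine mul_nonneg (hm y hy).le (sub_nonneg.2 ?_)
        refine (real_inner_le_norm _ _).trans ?_
        rw [hunit y (hF hy), ha, one_mul]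
      have := (Finset.sum_eq_zero_iff_of_nonneg hnn).1 e2 y hy
      have := (mul_eq_zero.1 this).resolve_left (hm y hy).ne'
      linarith
    have e4 : ∑ y ∈ F, m y * ‖x - y‖ = 0 := by
      have h1 : ∑ y ∈ F, m y • (x - y) = 0 := by
        simp_rw [smul_sub]
        rw [Finset.sum_sub_distrib, ← Finset.sum_smul, hm1, hmx, one_smul, sub_self]
      have h2 : inner ℝ (∑ y ∈ F, m y • (x - y)) (L (x, 1)) = (0 : ℝ) := by
        rw [h1, inner_zero_left]
      rw [sum_inner] at h2
      rw [← h2]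
      refine Finset.sum_congr rfl fun y hy => ?_
      rw [inner_smul_left, conj_trivial, ← hmul y (hF hy), inner_smul_left, conj_trivial, e3 y hy,
        hmul y (hF hy), mul_one]
    have hpos : ∀ y ∈ F, 0 < m y * ‖x - y‖ := fun y hy =>
      mul_pos (hm y hy) (norm_pos_iff.2 (sub_ne_zero.2 (hne y (hF hy))))
    have hFne : F.Nonempty := by
      rw [Finset.nonempty_iff_ne_empty]
      rintro rfl
      simp at hm1
    exact (Finset.sum_pos hpos hFne).ne' e4
  have hunitT : ∀ y ∈ closure A, ‖L (y, 1)‖ = 1 := fun y hy =>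
    closure_minimal hunit (isClosed_eq hLc1.norm continuous_const) hy
  have hmulT : ∀ y ∈ closure A, ‖x - y‖ • L (y, 1) = x - y := fun y hy =>
    closure_minimal hmul (isClosed_eq (by fun_prop) (by fun_prop)) hy
  refine Subset.antisymm (fun y hy => ?_) extremePoints_convexHull_subset
  set e := L (y, 1) with he
  let ℓ : Eucl d → ℝ := fun q => inner ℝ (L (q, 1)) e
  have hℓ : ∀ (p q : Eucl d) (s t : ℝ), s + t = 1 → ℓ (s • p + t • q) = s * ℓ p + t * ℓ q := by
    intro p q s t hst
    have : (s • p + t • q, (1 : ℝ)) = s • (p, (1 : ℝ)) + t • (q, (1 : ℝ)) := by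
      simp [hst]
    simp only [ℓ]
    rw [this, map_add, map_smul, map_smul, inner_add_left, inner_smul_left, inner_smul_left,
      conj_trivial, conj_trivial]
  have hℓy : ℓ y = 1 := by
    simp only [ℓ, ← he]
    rw [real_inner_self_eq_norm_sq, hunitT y hy, one_pow]
  have hTle : ∀ q ∈ closure A, q = y ∨ ℓ q < 1 := by
    intro q hq
    have hle : ℓ q ≤ 1 := by
      refine (real_inner_le_norm _ _).trans ?_
      rw [hunitT q hq, hunitT y hy, one_mul]
    rcases hle.lt_or_eq with h | h
    · exact Or.inr h
    refine Or.inl ?_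
    have hqe : L (q, 1) = e :=
      (inner_eq_one_iff_of_norm_eq_one (hunitT q hq) (hunitT y hy)).1 h
    have h1 := hmulT q hq
    have h2 := hmulT y hy
    rw [hqe] at h1
    have h3 : L ((‖x - y‖ - ‖x - q‖) • e, 0) = 0 := by
      have : ((‖x - y‖ - ‖x - q‖) • e, (0 : ℝ)) = (q, (1 : ℝ)) - (y, (1 : ℝ)) := by
        refine Prod.ext ?_ (by simp)
        simp only [Prod.fst_sub]
        rw [sub_smul, h1, h2]
        abel
      rw [this, map_sub, hqe, sub_self]
    by_cases hr : ‖x - y‖ = ‖x - q‖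
    · rw [← hr, h2] at h1
      exact (sub_right_injective h1).symm
    · exfalso
      have h4 : L (e, 0) = 0 := by
        have : ((‖x - y‖ - ‖x - q‖) • e, (0 : ℝ)) = (‖x - y‖ - ‖x - q‖) • (e, (0 : ℝ)) := by
          simp
        rw [this, map_smul] at h3
        exact (smul_eq_zero.1 h3).resolve_left (sub_ne_zero.2 hr)
      apply ha
      have : (x, (1 : ℝ)) = (y, (1 : ℝ)) + ‖x - y‖ • (e, (0 : ℝ)) := by
        refine Prod.ext ?_ (by simp)
        simp only [Prod.fst_add, Prod.smul_fst]
        rw [h2]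
        abel
      rw [this, map_add, map_smul, h4, smul_zero, add_zero]
      exact hunitT y hy
  have hhull : ∀ q ∈ convexHull ℝ (closure A), q = y ∨ ℓ q < 1 := by
    refine fun q hq => convexHull_min (t := {q | q = y ∨ ℓ q < 1}) hTle ?_ hq
    intro p hp q hq s t hs ht hst
    have hpl : ℓ p ≤ 1 := hp.elim (fun h => by rw [h, hℓy]) le_of_lt
    have hql : ℓ q ≤ 1 := hq.elim (fun h => by rw [h, hℓy]) le_of_lt
    rcases hs.eq_or_lt with rfl | hs
    · obtain rfl : t = 1 := by linarith
      simpa using hq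
    rcases ht.eq_or_lt with rfl | ht
    · obtain rfl : s = 1 := by linarith
      simpa using hp
    rcases hp with rfl | hp
    · rcases hq with rfl | hq
      · exact Or.inl (by rw [← add_smul, hst, one_smul])
      · refine Or.inr ?_
        rw [hℓ _ _ _ _ hst]
        nlinarith
    · refine Or.inr ?_
      rw [hℓ _ _ _ _ hst]
      nlinarith
  have hhull1 : ∀ q ∈ convexHull ℝ (closure A), ℓ q ≤ 1 := fun q hq =>
    (hhull q hq).elim (fun h => by rw [h, hℓy]) le_of_lt
  refine mem_extremePoints.2 ⟨subset_convexHull ℝ _ hy, ?_⟩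
  rintro p hp q hq ⟨s, t, hs, ht, hst, hpq⟩
  have h1 := hℓ p q s t hst
  rw [hpq, hℓy] at h1
  have h2 := hhull1 p hp
  have h3 := hhull1 q hq
  refine ⟨(hhull p hp).resolve_right fun h => ?_, (hhull q hq).resolve_right fun h => ?_⟩
  · nlinarith
  · nlinarith

end Point

end MartingaleTransport

namespace MartingaleTransport

open Filter Topology

variable {d : ℕ}

section Point

variable {A : Set (Eucl d)} {x : Eucl d} {ε a : ℝ} {β f : Eucl d → ℝ} {g : Eucl d}

/-- For the cost `-|x - y|` the fibre over a point of differentiability of the envelope does not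
contain the point, unless it is trivial. -/
theorem eq_of_mem_of_differentiable (hx : x ∈ IC A) (hxA : x ∈ A)
    (hβ : ∀ y ∈ A, β y - (-1) * ‖x - y‖ = a + inner ℝ g (y - x)) (hfx : f x = a)
    (hf : ∀ (F : Finset (Eucl d)) (w : Eucl d → ℝ), ↑F ⊆ A → (∀ y ∈ F, 0 ≤ w y) →
      ∑ y ∈ F, w y = 1 →
      ∑ y ∈ F, w y * (β y - (-1) * ‖∑ y ∈ F, w y • y - y‖) ≤ f (∑ y ∈ F, w y • y))
    {W : Submodule ℝ (Eucl d)} (hW : ∀ y ∈ A, x - y ∈ W)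
    (hdiff : ∀ v ∈ W, DifferentiableAt ℝ (fun t : ℝ => f (x + t • v)) 0)
    {y : Eucl d} (hy : y ∈ A) : y = x := by
  classical
  by_contra hyx
  obtain ⟨F, m, hF₀, hF, hm, hm1, hmx⟩ := exists_pos_weights_of_mem_IC hx {x, y} (by
    intro z hz
    rw [Finset.coe_insert, Finset.coe_singleton] at hz
    rcases hz with rfl | rfl <;> assumption)
  have hxF : x ∈ F := hF₀ (by simp)
  have hyF : y ∈ F := hF₀ (by simp)
  set v := x - y with hv
  have hv0 : 0 < ‖v‖ := norm_pos_iff.2 (sub_ne_zero.2 (Ne.symm hyx))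
  let s : Eucl d → ℝ := fun z => (if z = x then 1 else 0) - (if z = y then 1 else 0)
  have hs0 : ∑ z ∈ F, s z = 0 := by
    simp only [s]
    rw [Finset.sum_sub_distrib]
    simp [hxF, hyF]
  have hs1 : ∑ z ∈ F, s z • z = v := by
    simp only [s, sub_smul, ite_smul, one_smul, zero_smul]
    rw [Finset.sum_sub_distrib]
    simp [hxF, hyF, hv]
  let h : ℝ → ℝ := fun t => f (x + t • v) -
    ∑ z ∈ F.erase x, (m z + t * s z) * (β z - (-1) * ‖x + t • v - z‖) - (m x + t * s x) * β x
  have hd : DifferentiableAt ℝ h 0 := by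
    refine ((hdiff v (hW y hy)).sub (DifferentiableAt.fun_sum fun z hz => ?_)).sub (by fun_prop)
    have hne : x ≠ z := (Finset.ne_of_mem_erase hz).symm
    have := (hasDerivAt_norm_add_smul (v := v) hne).differentiableAt
    exact DifferentiableAt.mul (by fun_prop) ((this.const_mul _).const_sub _)
  have h0 : h 0 = 0 := by
    simp only [h, zero_smul, add_zero, zero_mul, hfx]
    have e1 : ∑ z ∈ F, m z * (β z - (-1) * ‖x - z‖) = a := by
      rw [Finset.sum_congr rfl fun z hz => by rw [hβ z (hF hz)]]
      simp_rw [mul_add, inner_sub_right, mul_sub]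
      rw [Finset.sum_add_distrib, Finset.sum_sub_distrib, ← Finset.sum_mul, ← Finset.sum_mul, hm1]
      conv_lhs => rw [← hmx, inner_sum]
      simp_rw [inner_smul_right]
      ring
    rw [← Finset.add_sum_erase F _ hxF] at e1
    simp only [sub_self, norm_zero, mul_zero, sub_zero] at e1
    linarith
  have hlow : ∀ᶠ t in 𝓝 (0 : ℝ), m x / 2 * (|t| * ‖v‖) ≤ h t := by
    have hpos : ∀ᶠ t in 𝓝 (0 : ℝ), ∀ z ∈ F, 0 < m z + t * s z := by
      rw [eventually_all_finset]
      intro z hz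
      have hc : ContinuousAt (fun t : ℝ => m z + t * s z) 0 := by fun_prop
      exact hc.eventually_const_lt (by simpa using hm z hz)
    have hpos' : ∀ᶠ t in 𝓝 (0 : ℝ), m x / 2 < m x + t * s x := by
      have hc : ContinuousAt (fun t : ℝ => m x + t * s x) 0 := by fun_prop
      exact hc.eventually_const_lt (by simpa using hm x hxF)
    filter_upwards [hpos, hpos'] with t ht ht'
    have hsum : ∑ z ∈ F, (m z + t * s z) • z = x + t • v := by
      simp_rw [add_smul, mul_smul]
      rw [Finset.sum_add_distrib, ← Finset.smul_sum, hmx, hs1]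
    have hle := hf F (fun z => m z + t * s z) hF (fun z hz => (ht z hz).le)
      (by rw [Finset.sum_add_distrib, ← Finset.mul_sum, hm1, hs0]; simp)
    rw [hsum, ← Finset.add_sum_erase F _ hxF] at hle
    have hn : ‖x + t • v - x‖ = |t| * ‖v‖ := by
      rw [add_sub_cancel_left, norm_smul, Real.norm_eq_abs]
    rw [hn] at hle
    have : m x / 2 * (|t| * ‖v‖) ≤ (m x + t * s x) * (|t| * ‖v‖) :=
      mul_le_mul_of_nonneg_right ht'.le (by positivity)
    simp only [h]
    nlinarith
  have hmin : IsLocalMin h 0 := by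
    filter_upwards [hlow] with t ht
    rw [h0]
    have := hm x hxF
    exact le_trans (by positivity) ht
  have hder : HasDerivAt h 0 0 := by
    have := hd.hasDerivAt
    rwa [hmin.hasDerivAt_eq_zero this] at this
  have hlit := (hasDerivAt_iff_isLittleO.1 hder).def
    (show 0 < m x / 4 * ‖v‖ from mul_pos (div_pos (hm x hxF) (by norm_num)) hv0)
  obtain ⟨t, ⟨ht1, ht2⟩, ht3⟩ := (((hlow.and hlit).filter_mono
    (nhdsWithin_le_nhds (s := Ioi (0 : ℝ)))).and self_mem_nhdsWithin).exists
  have ht3 : 0 < t := ht3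
  simp only [h0, sub_zero, smul_zero, Real.norm_eq_abs] at ht2
  have h5 : 0 < m x * (|t| * ‖v‖) := mul_pos (hm x hxF) (mul_pos (abs_pos.2 ht3.ne') hv0)
  have h6 := le_abs_self (h t)
  nlinarith

theorem closure_eq_extremePoints_of_differentiable (hx : x ∈ IC A) (hε : ε = 1 ∨ ε = -1)
    (hdiag : ε = 1 → x ∉ A)
    (hβ : ∀ y ∈ A, β y - ε * ‖x - y‖ = a + inner ℝ g (y - x)) (hfx : f x = a)
    (hf : ∀ (F : Finset (Eucl d)) (w : Eucl d → ℝ), ↑F ⊆ A → (∀ y ∈ F, 0 ≤ w y) →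
      ∑ y ∈ F, w y = 1 → ∑ y ∈ F, w y * (β y - ε * ‖∑ y ∈ F, w y • y - y‖) ≤ f (∑ y ∈ F, w y • y))
    {W : Submodule ℝ (Eucl d)} (hW : ∀ y ∈ A, x - y ∈ W)
    (hdiff : ∀ v ∈ W, DifferentiableAt ℝ (fun t : ℝ => f (x + t • v)) 0) :
    closure A = (convexHull ℝ (closure A)).extremePoints ℝ := by
  classical
  by_cases hxA : x ∈ A
  · obtain rfl : ε = -1 := hε.resolve_left fun h => hdiag h hxA
    have hA : A = {x} := Subset.antisymm
      (fun y hy => eq_of_mem_of_differentiable hx hxA hβ hfx hf hW hdiff hy)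
      (singleton_subset_iff.2 hxA)
    rw [hA, closure_singleton, convexHull_singleton, extremePoints_singleton]
  · have hε0 : ε ≠ 0 := by rcases hε with rfl | rfl <;> norm_num
    obtain ⟨L, hL⟩ := exists_linearMap_of_forall_relation
      (fun y : A => ((y : Eucl d), (1 : ℝ))) (fun y : A => ‖x - y‖⁻¹ • (x - (y : Eucl d)))
      (fun σ hσ => by
        rw [show (fun y : A => ((y : Eucl d), (1 : ℝ))) = (fun y : Eucl d => (y, (1 : ℝ))) ∘
          Subtype.val from rfl, ← Finsupp.linearCombination_mapDomain] at hσ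
        rw [show (fun y : A => ‖x - y‖⁻¹ • (x - (y : Eucl d))) =
          (fun y : Eucl d => ‖x - y‖⁻¹ • (x - y)) ∘ Subtype.val from rfl,
          ← Finsupp.linearCombination_mapDomain]
        rw [Finsupp.linearCombination_apply, Finsupp.sum] at hσ ⊢
        refine sum_smul_unit_eq_zero hx hε0 hxA hβ hfx hf hW hdiff _ ?_ ?_ ?_
        · intro y hy
          obtain ⟨z, -, rfl⟩ := Finset.mem_image.1 (Finsupp.mapDomain_support hy)
          exact z.2
        · have := congrArg Prod.snd hσ
          rw [Prod.snd_sum] at this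
          simpa using this
        · have := congrArg Prod.fst hσ
          rw [Prod.fst_sum] at this
          simpa using this)
    exact closure_eq_extremePoints_of_linear hx hxA L fun y hy => hL ⟨y, hy⟩

end Point

/-- The smallest concave function on the convex hull of `Y` above `h`. -/
noncomputable def concaveEnvelope (Y : Set (Eucl d)) (h : Eucl d → ℝ) (z : Eucl d) : ℝ :=
  sSup {r | (z, r) ∈ convexHull ℝ ((fun y => (y, h y)) '' Y)}

section Envelope

variable {Y : Set (Eucl d)} {h h' : Eucl d → ℝ} {b : ℝ} {g : Eucl d}

theorem le_of_mem_convexHull_graph (hb : ∀ y ∈ Y, h y ≤ b + inner ℝ g y) {z : Eucl d} {r : ℝ}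
    (hr : (z, r) ∈ convexHull ℝ ((fun y => (y, h y)) '' Y)) : r ≤ b + inner ℝ g z := by
  refine convexHull_min (t := {q : Eucl d × ℝ | q.2 ≤ b + inner ℝ g q.1}) ?_ ?_ hr
  · rintro _ ⟨y, hy, rfl⟩
    exact hb y hy
  · intro p hp q hq s t hs ht hst
    simp only [mem_ofPred_eq, Prod.fst_add, Prod.snd_add, Prod.smul_fst, Prod.smul_snd,
      inner_add_right, inner_smul_right, smul_eq_mul] at hp hq ⊢
    obtain rfl : s = 1 - t := by linarith
    nlinarith

theorem bddAbove_graph (hb : ∀ y ∈ Y, h y ≤ b + inner ℝ g y) (z : Eucl d) :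
    BddAbove {r | (z, r) ∈ convexHull ℝ ((fun y => (y, h y)) '' Y)} :=
  ⟨_, fun _ hr => le_of_mem_convexHull_graph hb hr⟩

theorem nonempty_graph (h : Eucl d → ℝ) {z : Eucl d} (hz : z ∈ convexHull ℝ Y) :
    {r | (z, r) ∈ convexHull ℝ ((fun y => (y, h y)) '' Y)}.Nonempty := by
  have h1 := LinearMap.image_convexHull (LinearMap.fst ℝ (Eucl d) ℝ) ((fun y => (y, h y)) '' Y)
  rw [image_image] at h1
  simp only [LinearMap.fst_apply, image_id'] at h1
  rw [← h1] at hz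
  obtain ⟨⟨z', r⟩, hr, rfl⟩ := hz
  exact ⟨r, hr⟩

theorem concaveEnvelope_le (hb : ∀ y ∈ Y, h y ≤ b + inner ℝ g y) {z : Eucl d}
    (hz : z ∈ convexHull ℝ Y) : concaveEnvelope Y h z ≤ b + inner ℝ g z :=
  csSup_le (nonempty_graph h hz) fun _ hr => le_of_mem_convexHull_graph hb hr

theorem le_concaveEnvelope (hb : ∀ y ∈ Y, h y ≤ b + inner ℝ g y) {F : Finset (Eucl d)}
    {w : Eucl d → ℝ} (hF : ↑F ⊆ Y) (hw : ∀ y ∈ F, 0 ≤ w y) (hw1 : ∑ y ∈ F, w y = 1) :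
    ∑ y ∈ F, w y * h y ≤ concaveEnvelope Y h (∑ y ∈ F, w y • y) := by
  refine le_csSup (bddAbove_graph hb _) ?_
  have := (convex_convexHull ℝ ((fun y => (y, h y)) '' Y)).sum_mem hw hw1
    (z := fun y => (y, h y)) fun y hy => subset_convexHull ℝ _ ⟨y, hF hy, rfl⟩
  rw [mem_ofPred_eq]
  convert this using 1
  refine Prod.ext ?_ ?_
  · rw [Prod.fst_sum]
    rfl
  · rw [Prod.snd_sum]
    rfl

theorem concaveOn_concaveEnvelope (hb : ∀ y ∈ Y, h y ≤ b + inner ℝ g y) :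
    ConcaveOn ℝ (convexHull ℝ Y) (concaveEnvelope Y h) := by
  refine ⟨convex_convexHull ℝ Y, fun p hp q hq s t hs ht hst => ?_⟩
  refine le_of_forall_pos_sub_le fun δ hδ => ?_
  obtain ⟨r₁, hr₁, h₁⟩ := exists_lt_of_lt_csSup (nonempty_graph h hp)
    (sub_lt_self (concaveEnvelope Y h p) hδ)
  obtain ⟨r₂, hr₂, h₂⟩ := exists_lt_of_lt_csSup (nonempty_graph h hq)
    (sub_lt_self (concaveEnvelope Y h q) hδ)
  have hmem := (convex_convexHull ℝ ((fun y => (y, h y)) '' Y)) hr₁ hr₂ hs ht hst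
  have := le_csSup (bddAbove_graph hb (s • p + t • q)) hmem
  refine le_trans ?_ this
  simp only [smul_eq_mul, Prod.smul_snd]
  obtain rfl : s = 1 - t := by linarith
  linarith [mul_le_mul_of_nonneg_left h₁.le hs, mul_le_mul_of_nonneg_left h₂.le ht]

theorem concaveEnvelope_le_add (hb : ∀ y ∈ Y, h y ≤ b + inner ℝ g y) {δ : ℝ}
    (hδ : ∀ y ∈ Y, h' y ≤ h y + δ) {z : Eucl d} (hz : z ∈ convexHull ℝ Y) :
    concaveEnvelope Y h' z ≤ concaveEnvelope Y h z + δ := by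
  refine csSup_le (nonempty_graph h' hz) fun r hr => ?_
  have hsub : convexHull ℝ ((fun y => (y, h' y)) '' Y) ⊆
      {q | ∃ r, q.2 ≤ r + δ ∧ (q.1, r) ∈ convexHull ℝ ((fun y => (y, h y)) '' Y)} := by
    refine convexHull_min ?_ ?_
    · rintro _ ⟨y, hy, rfl⟩
      exact ⟨h y, hδ y hy, subset_convexHull ℝ _ ⟨y, hy, rfl⟩⟩
    · rintro ⟨p, p'⟩ ⟨r₁, h1, h1'⟩ ⟨q, q'⟩ ⟨r₂, h2, h2'⟩ s t hs ht hst
      refine ⟨s • r₁ + t • r₂, ?_, (convex_convexHull ℝ _) h1' h2' hs ht hst⟩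
      simp only [Prod.smul_mk, Prod.mk_add_mk, smul_eq_mul] at h1 h2 ⊢
      obtain rfl : s = 1 - t := by linarith
      nlinarith
  obtain ⟨r', h1, h2⟩ := hsub hr
  exact h1.trans (add_le_add_left (le_csSup (bddAbove_graph hb z) h2) δ)

end Envelope

end MartingaleTransport

namespace MartingaleTransport

open Filter Topology Metric

variable {d : ℕ}

section Lipschitz

variable {Y : Set (Eucl d)} {β : Eucl d → ℝ} {ε b : ℝ} {g x₀ : Eucl d}

theorem sub_mul_norm_le (hε : |ε| ≤ 1) (x x' y : Eucl d) :
    β y - ε * ‖x' - y‖ ≤ β y - ε * ‖x - y‖ + ‖x - x'‖ := by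
  have h1 : |‖x - y‖ - ‖x' - y‖| ≤ ‖x - x'‖ := by
    simpa using abs_norm_sub_norm_le (x - y) (x' - y)
  have h2 : ε * (‖x - y‖ - ‖x' - y‖) ≤ ‖x - x'‖ := by
    refine (le_abs_self _).trans ?_
    rw [abs_mul]
    calc |ε| * |‖x - y‖ - ‖x' - y‖| ≤ 1 * ‖x - x'‖ :=
          mul_le_mul hε h1 (abs_nonneg _) zero_le_one
      _ = _ := one_mul _
  linarith

theorem sub_mul_norm_le_affine (hε : |ε| ≤ 1) (hb : ∀ y ∈ Y, β y - ε * ‖x₀ - y‖ ≤ b + inner ℝ g y)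
    (x : Eucl d) : ∀ y ∈ Y, β y - ε * ‖x - y‖ ≤ (b + ‖x₀ - x‖) + inner ℝ g y := fun y hy => by
  have := hb y hy
  have := sub_mul_norm_le (β := β) hε x₀ x y
  linarith

theorem abs_concaveEnvelope_sub_le (hε : |ε| ≤ 1)
    (hb : ∀ y ∈ Y, β y - ε * ‖x₀ - y‖ ≤ b + inner ℝ g y) (x x' : Eucl d) {z : Eucl d}
    (hz : z ∈ convexHull ℝ Y) :
    |concaveEnvelope Y (fun y => β y - ε * ‖x - y‖) z -
      concaveEnvelope Y (fun y => β y - ε * ‖x' - y‖) z| ≤ ‖x - x'‖ := by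
  have h1 := concaveEnvelope_le_add (sub_mul_norm_le_affine hε hb x)
    (fun y _ => sub_mul_norm_le (β := β) hε x x' y) hz
  have h2 := concaveEnvelope_le_add (sub_mul_norm_le_affine hε hb x')
    (fun y _ => sub_mul_norm_le (β := β) hε x' x y) hz
  rw [norm_sub_rev] at h2
  rw [abs_le]
  constructor <;> linarith

/-- The diagonal values of the concave envelopes are locally Lipschitz along a subspace. -/
theorem exists_lipschitzOnWith_envelope (hε : |ε| ≤ 1)
    (hb : ∀ y ∈ Y, β y - ε * ‖x₀ - y‖ ≤ b + inner ℝ g y) {W : Submodule ℝ (Eucl d)} (p : Eucl d)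
    {O : Set W} (hO : IsOpen O) (hOY : ∀ w ∈ O, p + w ∈ convexHull ℝ Y) {w₀ : W} (hw₀ : w₀ ∈ O) :
    ∃ r > 0, ∃ K, LipschitzOnWith K
      (fun w : W => concaveEnvelope Y (fun y => β y - ε * ‖p + w - y‖) (p + w)) (ball w₀ r) := by
  obtain ⟨r, hr, hrO⟩ := Metric.isOpen_iff.1 hO w₀ hw₀
  let G : Eucl d → W → ℝ := fun x w => concaveEnvelope Y (fun y => β y - ε * ‖x - y‖) (p + w)
  have hconc : ∀ x, ConcaveOn ℝ (ball w₀ r) (G x) := by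
    intro x
    refine ⟨convex_ball _ _, fun u hu v hv s t hs ht hst => ?_⟩
    have := (concaveOn_concaveEnvelope (sub_mul_norm_le_affine hε hb x)).2 (hOY u (hrO hu))
      (hOY v (hrO hv)) hs ht hst
    refine this.trans_eq ?_
    simp only [G]
    congr 1
    push_cast
    obtain rfl : s = 1 - t := by linarith
    module
  have hcont := (hconc (p + w₀)).continuousOn isOpen_ball
  obtain ⟨M, hM⟩ := (isCompact_closedBall w₀ (r / 2)).exists_bound_of_continuousOn
    (hcont.mono (closedBall_subset_ball (half_lt_self hr)))
  have hbound : ∀ x : Eucl d, ‖x - (p + w₀)‖ ≤ r → ∀ w, dist w w₀ < r / 2 → |G x w| ≤ M + r := by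
    intro x hx w hw
    have h1 := hM w (mem_closedBall.2 hw.le)
    have h2 := abs_concaveEnvelope_sub_le hε hb x (p + w₀)
      (hOY w (hrO (mem_ball.2 (hw.trans (half_lt_self hr)))))
    rw [Real.norm_eq_abs] at h1
    have h3 := abs_le.1 h1
    have h4 := abs_le.1 (h2.trans hx)
    rw [abs_le]
    simp only [G] at h3 ⊢
    constructor <;> linarith
  have hlip : ∀ x : Eucl d, ‖x - (p + w₀)‖ ≤ r →
      LipschitzOnWith (2 * (M + r) / (r / 4)).toNNReal (G x) (ball w₀ (r / 4)) := by
    intro x hx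
    have := ((hconc x).subset (ball_subset_ball (half_le_self hr.le))
      (convex_ball _ _)).lipschitzOnWith_of_abs_le (by positivity : 0 < r / 4) (hbound x hx)
    rwa [show r / 2 - r / 4 = r / 4 by ring] at this
  refine ⟨r / 4, by positivity, (2 * (M + r) / (r / 4)).toNNReal + 1, ?_⟩
  refine LipschitzOnWith.of_dist_le_mul fun u hu v hv => ?_
  have hnorm : ∀ u v : W, ‖(u : Eucl d) - v‖ = dist u v := fun u v => by
    rw [dist_eq_norm]
    rfl
  have hu' : ‖p + (u : Eucl d) - (p + w₀)‖ ≤ r := by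
    rw [add_sub_add_left_eq_sub, hnorm]
    exact (mem_ball.1 hu).le.trans (by linarith)
  have h1 := (hlip (p + u) hu').dist_le_mul u hu v hv
  have hvY : p + (v : Eucl d) ∈ convexHull ℝ Y :=
    hOY v (hrO (ball_subset_ball (by linarith) hv))
  have h2 := abs_concaveEnvelope_sub_le hε hb (p + u) (p + v) hvY
  rw [add_sub_add_left_eq_sub, hnorm] at h2
  rw [Real.dist_eq] at h1 ⊢
  refine (abs_sub_le _ (G (p + u) v) _).trans ?_
  push_cast
  rw [add_mul, one_mul]
  exact add_le_add h1 h2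

theorem ae_differentiableAt_envelope (hε : |ε| ≤ 1)
    (hb : ∀ y ∈ Y, β y - ε * ‖x₀ - y‖ ≤ b + inner ℝ g y) {W : Submodule ℝ (Eucl d)} (p : Eucl d)
    {O : Set W} (hO : IsOpen O) (hOY : ∀ w ∈ O, p + w ∈ convexHull ℝ Y) :
    volume {w | w ∈ O ∧ ¬ DifferentiableAt ℝ
      (fun w : W => concaveEnvelope Y (fun y => β y - ε * ‖p + w - y‖) (p + w)) w} = 0 := by
  refine measure_null_of_locally_null _ fun w₀ hw₀ => ?_
  obtain ⟨r, hr, K, hK⟩ := exists_lipschitzOnWith_envelope hε hb p hO hOY hw₀.1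
  refine ⟨_, inter_mem_nhdsWithin _ (ball_mem_nhds w₀ hr), ?_⟩
  refine measure_mono_null ?_ (ae_iff.1 (hK.ae_differentiableWithinAt_of_mem (μ := volume)))
  rintro w ⟨⟨-, hw⟩, hwb⟩ himp
  exact hw ((himp hwb).differentiableAt (isOpen_ball.mem_nhds hwb))

end Lipschitz

/-- For the distance cost, the fibres of a contact layer over a component consist of extreme points,
almost everywhere for an absolutely continuous measure on the component. -/
theorem ae_closure_fiber_eq_extremePoints {g : Goal} {Γ : Set (Eucl d × Eucl d)}
    {Φ : Set (Set (Eucl d))} (hΓ : ∀ x ∈ projX Γ, x ∈ IC (fiber Γ x))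
    (hΦ : IsIrreducibleConvexPaving Γ Φ) {C : Set (Eucl d)} (hC : C ∈ Φ)
    (hlayer : IsContactLayer g (fun p => ‖p.1 - p.2‖) (restr Γ C))
    (hdiag : g = Goal.minimize → ∀ x, (x, x) ∉ Γ) {m : Measure (Eucl d)}
    (hm : ∀ᵐ x ∂m, x ∈ projX Γ ∩ C) (hac : AbsContOn m (affineSpan ℝ C)) :
    ∀ᵐ x ∂m, closure (fiber Γ x) = (convexHull ℝ (closure (fiber Γ x))).extremePoints ℝ := by
  obtain ⟨ε, hε, hεc, hεd⟩ : ∃ ε : ℝ, (ε = 1 ∨ ε = -1) ∧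
      (∀ p : Eucl d × Eucl d, g.cost (fun p => ‖p.1 - p.2‖) p = ε * ‖p.1 - p.2‖) ∧
      (ε = 1 → ∀ x, (x, x) ∉ Γ) := by
    cases g
    · exact ⟨1, Or.inl rfl, fun p => by simp [Goal.cost], fun _ => hdiag rfl⟩
    · exact ⟨-1, Or.inr rfl, fun p => by simp [Goal.cost], fun h => by norm_num at h⟩
  have hε1 : |ε| ≤ 1 := by rcases hε with rfl | rfl <;> norm_num
  rw [isContactLayer_cost_iff] at hlayer
  obtain ⟨hne, α, γ, β, hadm, heq⟩ := hlayer
  have hle : ∀ x ∈ projX Γ ∩ C, ∀ y ∈ projY (restr Γ C),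
      β y - α x - inner ℝ (γ x) (y - x) ≤ ε * ‖x - y‖ := fun x hx y hy => by
    have := hadm.ineq x (by rwa [projX_restr]) y hy
    rwa [Goal.le, hεc] at this
  have heq' : ∀ x ∈ C, ∀ y ∈ fiber Γ x, β y - ε * ‖x - y‖ = α x + inner ℝ (γ x) (y - x) :=
    fun x hx y hy => by
      have := heq x y ⟨hy, hx, trivial⟩
      rw [hεc] at this
      linarith
  set Y := projY (restr Γ C) with hY
  have hfibY : ∀ x ∈ C, fiber Γ x ⊆ Y := fun x hx y hy => ⟨(x, y), ⟨hy, hx, trivial⟩, rfl⟩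
  have hCY : C ⊆ convexHull ℝ Y := by
    refine (hΦ.subset_convexHull hΓ hC).trans (convexHull_min ?_ (convex_convexHull ℝ Y))
    exact iUnion₂_subset fun z hz => (IC_subset_convexHull _).trans
      (convexHull_mono (hfibY z hz.2))
  have hb : ∀ x ∈ projX Γ ∩ C, ∀ y ∈ Y,
      β y - ε * ‖x - y‖ ≤ (α x - inner ℝ (γ x) x) + inner ℝ (γ x) y := fun x hx y hy => by
    have := hle x hx y hy
    rw [inner_sub_right] at this
    linarith
  obtain ⟨p, hpX, hpC⟩ := hΦ.1.meets C hC
  have hpV : p ∈ affineSpan ℝ C := subset_affineSpan ℝ C hpC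
  set W := (affineSpan ℝ C).direction with hWdef
  let f : Eucl d → ℝ := fun x => concaveEnvelope Y (fun y => β y - ε * ‖x - y‖) x
  let O : Set W := {w | p + (w : Eucl d) ∈ C}
  have hO : IsOpen O := by
    rw [Metric.isOpen_iff]
    intro w hw
    have hw' : p + (w : Eucl d) ∈ intrinsicInterior ℝ C := by
      rw [hΦ.1.relOpen C hC]
      exact hw
    obtain ⟨-, r, hr, hball⟩ := mem_intrinsicInterior_iff_ball.1 hw'
    refine ⟨r, hr, fun u hu => hball _ ?_ ?_⟩
    · rw [add_comm]
      exact AffineSubspace.vadd_mem_of_mem_direction u.2 hpV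
    · rw [dist_add_left]
      exact hu
  have hnull := ae_differentiableAt_envelope hε1 (hb p ⟨hpX, hpC⟩) p hO fun w hw => hCY hw
  have hemb : MeasurableEmbedding fun w : W => (w : Eucl d) + p :=
    (MeasurableEquiv.addRight p).measurableEmbedding.comp
      (MeasurableEmbedding.subtype_coe W.closed_of_finiteDimensional.measurableSet)
  have hnull' : m {x | ∃ w : W, (w : Eucl d) + p = x ∧ w ∈ O ∧
      ¬ DifferentiableAt ℝ (fun w : W => f (p + w)) w} = 0 := by
    refine hac p hpV ?_
    rw [hemb.map_apply]
    refine measure_mono_null ?_ hnull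
    rintro w ⟨w', hw', h⟩
    rwa [← hemb.injective hw']
  filter_upwards [hm, measure_eq_zero_iff_ae_notMem.1 hnull'] with x hx hxd
  have hxIC := hΓ x hx.1
  have hfib : ∀ y ∈ fiber Γ x, y ∈ affineSpan ℝ C := fun y hy =>
    subset_affineSpan_of_IC_subset hxIC (hΦ.1.IC_subset hΓ hC hx.1 hx.2) hy
  have hxV : x ∈ affineSpan ℝ C := subset_affineSpan ℝ C hx.2
  let w : W := ⟨x - p, AffineSubspace.vsub_mem_direction hxV hpV⟩
  have hwx : p + (w : Eucl d) = x := by simp [w]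
  have hwd : DifferentiableAt ℝ (fun w : W => f (p + w)) w := by
    by_contra h
    exact hxd ⟨w, by rw [add_comm, hwx], by simpa [O, hwx] using hx.2, h⟩
  refine closure_eq_extremePoints_of_differentiable (β := β) (f := f) (a := α x) (g := γ x) (W := W)
    hxIC hε (fun h => hεd h x) (heq' x hx.2) ?_ ?_
    (fun y hy => AffineSubspace.vsub_mem_direction hxV (hfib y hy)) ?_
  · refine le_antisymm ?_ ?_
    · have := concaveEnvelope_le (hb x hx) (hCY hx.2)
      simpa using this
    · obtain ⟨F, w, hF, hw0, -, hw1, hwx⟩ :=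
        exists_finset_weights_of_mem_convexHull (IC_subset_convexHull _ hxIC)
      have h1 := le_concaveEnvelope (hb x hx) (hF.trans (hfibY x hx.2)) hw0 hw1
      rw [hwx] at h1
      refine le_trans (le_of_eq ?_) h1
      rw [Finset.sum_congr rfl fun y hy => by rw [heq' x hx.2 y (hF hy)]]
      simp_rw [mul_add, inner_sub_right, mul_sub]
      rw [Finset.sum_add_distrib, Finset.sum_sub_distrib, ← Finset.sum_mul, ← Finset.sum_mul, hw1]
      have h2 : inner ℝ (γ x) (∑ y ∈ F, w y • y) = ∑ y ∈ F, w y * inner ℝ (γ x) y := by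
        rw [inner_sum]
        simp_rw [inner_smul_right]
      rw [← h2, hwx]
      ring
  · intro F w hF hw0 hw1
    exact le_concaveEnvelope (sub_mul_norm_le_affine hε1 (hb x hx) _)
      (hF.trans (hfibY x hx.2)) hw0 hw1
  · intro v hv
    have h1 : DifferentiableAt ℝ (fun t : ℝ => w + t • (⟨v, hv⟩ : W)) 0 := by fun_prop
    have h2 : DifferentiableAt ℝ (fun w : W => f (p + w)) (w + (0 : ℝ) • (⟨v, hv⟩ : W)) := by
      simpa using hwd
    have h3 : (fun t : ℝ => f (x + t • v)) =
        (fun w : W => f (p + w)) ∘ fun t : ℝ => w + t • (⟨v, hv⟩ : W) := by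
      funext t
      change f (x + t • v) = f (p + ((w : Eucl d) + t • v))
      rw [← add_assoc, hwx]
    rw [h3]
    exact DifferentiableAt.comp (0 : ℝ) h2 h1

end MartingaleTransport

theorem theorem9p1 (d : ℕ) (μ ν : Measure (Eucl d)) (hμν : ConvexOrder μ ν)
    (π : Measure (Eucl d × Eucl d)) (hπ : π ∈ MT μ ν)
    (Γ : Set (Eucl d × Eucl d)) (hΓ : MartingaleSupporting Γ) (hπΓ : π Γ = 1) :
    -- the irreducible convex paving associated to `Γ` exists and is unique
    (∃! Φ, IsIrreducibleConvexPaving Γ Φ) ∧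
    -- for optimal `π`, the concentration set can be chosen finitely exposable
    -- (and off the diagonal if the marginals have no common mass)
    (∀ (g : Goal) (c : Eucl d × Eucl d → ℝ), Continuous c → IsOptimal g c μ ν π →
      ∃ Γ' ⊆ Γ, MartingaleSupporting Γ' ∧ π Γ' = 1 ∧ FinitelyExposable g c Γ' ∧
        (μ ⟂ₘ ν → ∀ x, (x, x) ∉ Γ')) ∧
    -- the disintegration along the paving
    ∀ (Φ : Set (Set (Eucl d))) (hΦ : IsIrreducibleConvexPaving Γ Φ),
      Measurable (closureMap hΦ.1) →
      ∃ κ : Kernel (ClosedConvex d) (Eucl d × Eucl d),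
        -- (1)
        (∀ S, MeasurableSet S → π S = ∫⁻ K, κ K S ∂(closureLaw hΦ.1 π)) ∧
        (∀ᵐ K ∂(closureLaw hΦ.1 π), ∃ C ∈ Φ, K.carrier = closure C ∧
          IsProbabilityMeasure (κ K) ∧ κ K (restr Γ C) = 1) ∧
        -- (2)
        (∀ᵐ K ∂(closureLaw hΦ.1 π), ∃ C ∈ Φ, K.carrier = closure C ∧
          ∃ μC νC : Measure (Eucl d), ConvexOrder μC νC ∧
            (∀ᵐ x ∂μC, x ∈ projX Γ ∩ C) ∧ (∀ᵐ y ∂νC, y ∈ projY (restr Γ C)) ∧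
            κ K ∈ MT μC νC) ∧
        -- (3)
        (∀ (g : Goal) (c : Eucl d × Eucl d → ℝ), Measurable c → IsOptimal g c μ ν π →
          (∀ᵐ K ∂(closureLaw hΦ.1 π), IsOptimal g c (κ K).fst (κ K).snd (κ K)) ∧
          (Continuous c → FinitelyExposable g c Γ →
            (∀ C ∈ Φ, IsContactLayer g c (restr Γ C)) ∧
            (∀ᵐ K ∂(closureLaw hΦ.1 π), ∃ C ∈ Φ, K.carrier = closure C ∧
              DualityAttained g c (projX (restr Γ C)) (projY (restr Γ C)) (κ K)))) ∧
        -- (4)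
        (∀ g : Goal, IsOptimal g (fun p => ‖p.1 - p.2‖) μ ν π →
          FinitelyExposable g (fun p => ‖p.1 - p.2‖) Γ →
          (g = Goal.minimize → ∀ x, (x, x) ∉ Γ) →
          ∀ᵐ K ∂(closureLaw hΦ.1 π), ∃ C ∈ Φ, K.carrier = closure C ∧
            (AbsContOn (κ K).fst (affineSpan ℝ C) →
              ∀ᵐ x ∂(κ K).fst, closure (fiber Γ x) =
                (convexHull ℝ (closure (fiber Γ x))).extremePoints ℝ)) := by
  have hμp := isProbabilityMeasure_fst_of_mem_MT hπ
  have hπp := hπ.1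
  have hae : ∀ᵐ p ∂π, p ∈ Γ := (mem_ae_iff_prob_eq_one hΓ.1).2 hπΓ
  refine ⟨existsUnique_irreducibleConvexPaving hΓ.2,
    fun g c hc hopt => hopt.exists_concentration hμν hc hΓ.1 hae, fun Φ hΦ hm => ?_⟩
  have hx := hμν.integrable_fst hπ.2.1
  have hy := hμν.integrable_snd hπ.2.2.1
  obtain ⟨-, -, -, k, hk, hπk, hbar⟩ := id hπ
  rw [hπk] at hae
  obtain ⟨hprob, κ, hκ, hcomp, hκk, hconc⟩ := hΦ.1.exists_disintegration hΓ.1 hm hae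
  rw [← hπk] at hprob hcomp hconc
  have hbar' : ∀ᵐ p ∂π, Integrable (fun y => y) (k p.1) ∧ ∫ y, y ∂(k p.1) = p.1 := by
    rw [← hπ.2.1] at hbar
    exact ae_of_ae_map measurable_fst.aemeasurable hbar
  have hMT : ∀ᵐ K ∂(closureLaw hΦ.1 π), κ K ∈ MT (κ K).fst (κ K).snd := by
    rw [← hcomp] at hbar'
    filter_upwards [Measure.ae_ae_of_ae_comp hbar'] with K hK
    refine ⟨inferInstance, rfl, rfl, k, hk, hκk K, ?_⟩
    have hset : MeasurableSet {x : Eucl d | Integrable (fun y => y) (k x) ∧ ∫ y, y ∂(k x) = x} :=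
      (measurableSet_kernel_integrable (f := fun _ y => y)
        measurable_snd.stronglyMeasurable).inter (measurableSet_eq_fun
          (StronglyMeasurable.integral_kernel (f := fun y : Eucl d => y)
            stronglyMeasurable_id).measurable measurable_id)
    exact (ae_map_iff measurable_fst.aemeasurable hset).2 hK
  have hx' := hx
  have hy' := hy
  rw [← hcomp] at hx' hy'
  have hxK := Measure.ae_integrable_of_integrable_comp hx'
  have hyK := Measure.ae_integrable_of_integrable_comp hy'
  have hfst : ∀ K : ClosedConvex d, ∀ C : Set (Eucl d), (∀ᵐ p ∂(κ K), p ∈ restr Γ C) →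
      ∀ᵐ x ∂(κ K).fst, x ∈ projX Γ ∩ C := by
    intro K C hC
    rw [hκk K] at hC
    filter_upwards [Measure.ae_ae_of_ae_compProd hC] with x hx
    obtain ⟨y, hy⟩ := hx.exists
    exact ⟨⟨_, hy.1, rfl⟩, hy.2.1⟩
  refine ⟨κ, ?_, ?_, ?_, ?_, ?_⟩
  · intro S hS
    conv_lhs => rw [← hcomp]
    exact Measure.bind_apply hS κ.measurable.aemeasurable
  · filter_upwards [hconc] with K ⟨C, hC, hKC, hK⟩
    refine ⟨C, hC, hKC, inferInstance, ?_⟩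
    exact (mem_ae_iff_prob_eq_one (hΓ.1.inter ((hΦ.1.measurableSet hC).prod
      MeasurableSet.univ))).1 hK
  · filter_upwards [hconc, hMT, hxK, hyK] with K ⟨C, hC, hKC, hK⟩ h1 h2 h3
    refine ⟨C, hC, hKC, (κ K).fst, (κ K).snd, convexOrder_of_mem_MT h1 h2 h3, hfst K C hK, ?_, h1⟩
    exact ae_mem_image_of_ae_mem (hΓ.1.inter ((hΦ.1.measurableSet hC).prod MeasurableSet.univ)) hK
  · intro g c hc hopt
    have hoptK : ∀ᵐ K ∂(closureLaw hΦ.1 π), IsOptimal g c (κ K).fst (κ K).snd (κ K) := by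
      refine ae_isOptimal_of_comp (μ := μ) (ν := ν) hc ?_ hx' hy' hMT
      rwa [hcomp]
    refine ⟨hoptK, fun hcc hexp => ⟨fun C hC => hexp.isContactLayer_restr hcc hΓ.2 hΦ hC, ?_⟩⟩
    filter_upwards [hconc, hoptK] with K ⟨C, hC, hKC, hK⟩ h1
    exact ⟨C, hC, hKC, dualityAttained_of_isContactLayer
      (hexp.isContactLayer_restr hcc hΓ.2 hΦ hC) h1.1 hK h1.2.1⟩
  · intro g hopt hexp hdiag
    filter_upwards [hconc] with K ⟨C, hC, hKC, hK⟩
    exact ⟨C, hC, hKC, fun hac => ae_closure_fiber_eq_extremePoints hΓ.2 hΦ hC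
      (hexp.isContactLayer_restr (by fun_prop) hΓ.2 hΦ hC) hdiag (hfst K C hK) hac⟩
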